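/- For $f,g:\{0,1\}^m\to\{-1,1\}$ and $N=2^m$ put $$p(f,g)=\frac1{N^3}\Bigl(\sum_{x,y\in\{0,1\}^m} f(x)(-1)^{x\cdot y}g(y)\Bigr)^2 .$$ \textsc{Promise Fourier Checking} is the promise problem whose inputs are bit strings of length $2^{m+1}$ ($m\ge 0$), namely the truth table of $f$ followed by that of $g$ (bit $b$ stands for the value $(-1)^b$). The YES instances are those with $p(f,g)\ge 0.05$, and the NO instances are those with $p(f,g)\le 0.01$. $\mathsf{AC}^0$ is the class of promise problems solved by a nonuniform family of unbounded fan-in AND/OR/NOT circuits of size $\mathrm{poly}(n)$ and depth $O(1)$ (NOT gates do not count towards the depth). $\mathsf{BQLOGTIME}$ is the class of promise problems decided with error probability at most $1/3$ by a $\mathsf{LOGTIME}$-uniform family $\{C_n\}$ of quantum circuits in which $C_n$ has $O(\log n)$ gates, each a NOT, Hadamard, $T$, CNOT or Toffoli gate or a random-access query gate $|i\rangle|z\rangle\mapsto|i\rangle|z\oplus x_i\rangle$ to the input $x=x_1\dots x_n$. $\mathsf{LOGTIME}$-uniform means that qubit numbers and gate names are polynomially bounded in $n$ and that a deterministic multitape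 Turing machine decides in time $O(\log n)$ whether a given gate of $C_n$ (with $n$ given in binary) exists, has a given kind and has a given qubit at a given port. A probability distribution $\mathcal D$ on $\{0,1\}^n$ is $\varepsilon$-almost $k$-wise independent if every conjunction $C$ of $k$ literals on distinct bits satisfies $1-\varepsilon\le \Pr_{\mathcal D}[C]/\Pr_{\mathcal U}[C]\le 1+\varepsilon$, where $\mathcal U$ is the uniform distribution. The Generalized Linial--Nisan (GLN) Conjecture is the following statement: for all constants $a,c>0$ and $d\in\mathbb N$ and every size bound $s(n)= 2^{n^{o(1)}}$, $$\bigl|\Pr_{x\sim\mathcal D}[C(x)=1]-\Pr_{x\sim\mathcal U}[C(x)=1]\bigr|=o(1)$$ uniformly over all $k$ with $n^{a}\le k\le n$, all $n^{-c}$-almost $k$-wise independent distributions $\mathcal D$ on $\{0,1\}^n$ and all AND/OR/NOT circuits $C$ on $n$ bits of size at most $s(n)$ and depth at most $d$. **Theorem.** \textsc{Promise Fourier Checking} is in $\mathsf{BQLOGTIME}$, and if the GLN Conjecture holds, then \textsc{Promise Fourier Checking} is not in $\mathsf{AC}^0$. In particular, assuming the GLN Conjecture, there exists a promise problem in $\mathsf{BQLOGTIME}$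 that is not in $\mathsf{AC}^0$. -/

import Mathlib

namespace FourierChecking

open MeasureTheory Filter

/-! ### Promise problems on bit strings -/

/-- A promise problem: disjoint sets of YES and NO instances, sorted by input length. -/
structure PromiseProblem where
  yes : (n : ℕ) → Set (Fin n → Bool)
  no : (n : ℕ) → Set (Fin n → Bool)
  disjoint : ∀ n, Disjoint (yes n) (no n)

/-! ### Constant-depth circuits of AND, OR and NOT gates with unbounded fan-in -/

/-- The `i`-th node of a circuit on `n` input bits; its inputs are earlier nodes. -/
inductive ACGate (n i : ℕ) : Type
  | input (j : Fin n) : ACGate n i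
  | not (k : Fin i) : ACGate n i
  | and (S : Finset (Fin i)) : ACGate n i
  | or (S : Finset (Fin i)) : ACGate n i

/-- A Boolean circuit (a directed acyclic graph with arbitrary fan-out) on `n` input bits. -/
structure ACCircuit (n : ℕ) where
  size : ℕ
  gate : (i : Fin size) → ACGate n i
  out : Fin size

/-- The value of a node on the input `x`. -/
def ACCircuit.value {n : ℕ} (C : ACCircuit n) (x : Fin n → Bool) (i : Fin C.size) : Bool :=
  match C.gate i with
  | .input j => x j
  | .not k => !(C.value x ⟨k.1, k.2.trans i.2⟩)
  | .and S => decide (∀ k ∈ S, C.value x ⟨k.1, k.2.trans i.2⟩ = true)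
  | .or S => decide (∃ k ∈ S, C.value x ⟨k.1, k.2.trans i.2⟩ = true)
termination_by i.1

/-- The largest number of AND and OR gates on a path ending in a node (NOT gates are free). -/
def ACCircuit.depthAt {n : ℕ} (C : ACCircuit n) (i : Fin C.size) : ℕ :=
  match C.gate i with
  | .input _ => 0
  | .not k => C.depthAt ⟨k.1, k.2.trans i.2⟩
  | .and S => (S.sup fun k => C.depthAt ⟨k.1, k.2.trans i.2⟩) + 1
  | .or S => (S.sup fun k => C.depthAt ⟨k.1, k.2.trans i.2⟩) + 1
termination_by i.1

/-- The Boolean function computed by a circuit. -/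
def ACCircuit.eval {n : ℕ} (C : ACCircuit n) (x : Fin n → Bool) : Bool := C.value x C.out

/-- The depth of a circuit. -/
def ACCircuit.depth {n : ℕ} (C : ACCircuit n) : ℕ := C.depthAt C.out

/-- (Promise) `AC⁰`: nonuniform circuits of constant depth and polynomial size that accept the
YES instances and reject the NO instances. -/
def InAC0 (P : PromiseProblem) : Prop :=
  ∃ d c : ℕ, ∀ n : ℕ, ∃ C : ACCircuit n, C.depth ≤ d ∧ C.size ≤ (n + 2) ^ c ∧
    (∀ x ∈ P.yes n, C.eval x = true) ∧ (∀ x ∈ P.no n, C.eval x = false)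

/-! ### The Generalized Linial-Nisan Conjecture -/

/-- The uniform distribution on `{0,1}ⁿ`. -/
noncomputable def uniform (n : ℕ) : Measure (Fin n → Bool) :=
  ProbabilityTheory.uniformOn Set.univ

/-- The event that a term is satisfied: the term is the conjunction of the literals that say
that the bit `i` equals `v i`, for `i` in `S`. -/
def term {n : ℕ} (S : Finset (Fin n)) (v : Fin n → Bool) : Set (Fin n → Bool) :=
  {x | ∀ i ∈ S, x i = v i}

/-- `D` is `ε`-almost `k`-wise independent: every term of exactly `k` literals has under `D` its
probability under the uniform distribution, up to a factor between `1 - ε` and `1 + ε`. -/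
def AlmostWiseIndependent {n : ℕ} (D : Measure (Fin n → Bool)) (ε : ℝ) (k : ℕ) : Prop :=
  ∀ (S : Finset (Fin n)) (v : Fin n → Bool), S.card = k →
    1 - ε ≤ D.real (term S v) / (uniform n).real (term S v) ∧
      D.real (term S v) / (uniform n).real (term S v) ≤ 1 + ε

/-- Circuits of constant depth `d` and size `s n = 2 ^ (n ^ o(1))` do not distinguish
`n ^ (-Ω(1))`-almost `n ^ Ω(1)`-wise independent distributions from the uniform one by more than
`o(1)`. (The exponents hidden in the two `Ω` are `c` and `a`.) -/
def GLNConjecture : Prop :=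
  ∀ a c : ℝ, 0 < a → 0 < c → ∀ (d : ℕ) (s : ℕ → ℕ),
    (∀ η : ℝ, 0 < η → ∀ᶠ n : ℕ in atTop, (s n : ℝ) ≤ (2 : ℝ) ^ ((n : ℝ) ^ η)) →
    ∀ δ : ℝ, 0 < δ → ∀ᶠ n : ℕ in atTop,
      ∀ (D : Measure (Fin n → Bool)) (k : ℕ), IsProbabilityMeasure D →
        (n : ℝ) ^ a ≤ (k : ℝ) → k ≤ n → AlmostWiseIndependent D ((n : ℝ) ^ (-c)) k →
        ∀ C : ACCircuit n, C.depth ≤ d → C.size ≤ s n →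
          |D.real {x | C.eval x = true} - (uniform n).real {x | C.eval x = true}| ≤ δ

/-! ### Quantum circuits with random access to the input -/

/-- The `i`-th bit of an input string, and `0` beyond its end. -/
def readBit {n : ℕ} (x : Fin n → Bool) (i : ℕ) : Bool :=
  if h : i < n then x ⟨i, h⟩ else false

/-- The gates on `q` qubits: NOT, Hadamard, `T = diag(1, exp(iπ/4))`, controlled NOT (control
first), Toffoli (controls first), and the query gate, whose address register consists of
`⌈log₂ n⌉` qubits, least significant bit first. The qubits of a gate are distinct. -/
inductive QGate (n q : ℕ) : Type
  | x (a : Fin q) : QGate n q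
  | h (a : Fin q) : QGate n q
  | t (a : Fin q) : QGate n q
  | cnot (a b : Fin q) (hab : a ≠ b) : QGate n q
  | ccnot (a b c : Fin q) (hab : a ≠ b) (hac : a ≠ c) (hbc : b ≠ c) : QGate n q
  | query (addr : Fin (Nat.clog 2 n) → Fin q) (target : Fin q)
      (hinj : Function.Injective addr) (htarget : ∀ j, addr j ≠ target) : QGate n q

/-- The amplitudes of a `q`-qubit state in the computational basis. -/
abbrev QState (q : ℕ) : Type := (Fin q → Bool) → ℂ

/-- The action of a gate on a state, where `inp` is the input string. The query gate maps
`|i⟩|z⟩` to `|i⟩|z ⊕ inp i⟩`, and is the identity where `i` is not an index of `inp`. -/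
noncomputable def QGate.apply {n q : ℕ} (inp : Fin n → Bool) :
    QGate n q → QState q → QState q
  | .x a, ψ => fun s => ψ (Function.update s a (!(s a)))
  | .h a, ψ => fun s =>
      (ψ (Function.update s a false) + (if s a then -1 else 1) * ψ (Function.update s a true)) /
        (Real.sqrt 2 : ℂ)
  | .t a, ψ => fun s => (if s a then Complex.exp (Complex.I * Real.pi / 4) else 1) * ψ s
  | .cnot a b _, ψ => fun s => ψ (Function.update s b (xor (s b) (s a)))
  | .ccnot a b c _ _ _, ψ => fun s => ψ (Function.update s c (xor (s c) (s a && s b)))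
  | .query addr target _ _, ψ => fun s =>
      ψ (Function.update s target
        (xor (s target) (readBit inp (Nat.ofBits fun j => s (addr j)))))

/-- The code of the kind of a gate. -/
def QGate.kind {n q : ℕ} : QGate n q → ℕ
  | .x _ => 0
  | .h _ => 1
  | .t _ => 2
  | .cnot _ _ _ => 3
  | .ccnot _ _ _ _ _ _ => 4
  | .query _ _ _ _ => 5

/-- The qubits on which a gate acts, in the order of its ports. -/
def QGate.wires {n q : ℕ} : QGate n q → List ℕ
  | .x a => [a.1]
  | .h a => [a.1]
  | .t a => [a.1]
  | .cnot a b _ => [a.1, b.1]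
  | .ccnot a b c _ _ _ => [a.1, b.1, c.1]
  | .query addr target _ _ => target.1 :: List.ofFn fun j => (addr j).1

/-- A quantum circuit for inputs of length `n`. Every gate has a name, a natural number; the gates
are executed in the order of their names, which need not be consecutive. -/
structure QCircuit (n : ℕ) where
  qubits : ℕ
  qubits_pos : 0 < qubits
  gates : List (ℕ × QGate n qubits)
  sorted : (gates.map Prod.fst).Pairwise (· < ·)

/-- The number of gates, query gates included. -/
def QCircuit.size {n : ℕ} (C : QCircuit n) : ℕ := C.gates.length

/-- The state in which the circuit, started on `|0…0⟩`, ends on the input `inp`. -/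
noncomputable def QCircuit.finalState {n : ℕ} (C : QCircuit n) (inp : Fin n → Bool) :
    QState C.qubits :=
  C.gates.foldl (fun ψ g => g.2.apply inp ψ) (fun s => if s = fun _ => false then 1 else 0)

/-- The probability that a measurement of qubit `0` of the final state yields `1`. -/
noncomputable def QCircuit.acceptProb {n : ℕ} (C : QCircuit n) (inp : Fin n → Bool) : ℝ :=
  ∑ s : Fin C.qubits → Bool,
    if s ⟨0, C.qubits_pos⟩ = true then ‖C.finalState inp s‖ ^ 2 else 0

/-! ### Logarithmic-time uniformity and `BQLOGTIME` -/

/-- A query to the direct connection language. -/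
structure ConnQuery where
  n : ℕ
  gate : ℕ
  kind : ℕ
  port : ℕ
  wire : ℕ

/-- The word that presents a query to a Turing machine: five parallel tracks, which carry `n`, the
gate name, the kind code and the qubit number in binary (least significant bit first) and the port
number in unary. If the gate name and the qubit number are polynomial in `n`, the kind code is
bounded and the port number is `O(log n)`, then the word has length `O(log n)`. -/
def ConnQuery.encode (τ : ConnQuery) : List (Fin 5 → Bool) :=
  (List.range (max (max (Nat.size τ.n) (Nat.size τ.gate))
      (max (max (Nat.size τ.kind) (Nat.size τ.wire)) τ.port))).map fun i =>
    ![τ.n.testBit i, τ.gate.testBit i, τ.kind.testBit i, decide (i < τ.port), τ.wire.testBit i]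

/-- The direct connection language of a circuit family: the gate of that name in the circuit for
length `n` exists, is of that kind, and has that qubit at that port. -/
def directConnection (C : (n : ℕ) → QCircuit n) : Set ConnQuery :=
  {τ | ∃ γ : QGate τ.n (C τ.n).qubits,
    (τ.gate, γ) ∈ (C τ.n).gates ∧ γ.kind = τ.kind ∧ γ.wires[τ.port]? = some τ.wire}

open Classical in
/-- `LOGTIME`-uniformity: qubit numbers and gate names are polynomially bounded, hence have
`O(log n)` bits, and a deterministic multitape Turing machine (Mathlib's machines with finitely
many stacks) decides the direct connection language in time linear in the length of the query, that
is, in time `O(log n)`. -/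
def LogTimeUniform (C : (n : ℕ) → QCircuit n) : Prop :=
  (∃ b : ℕ, ∀ n, (C n).qubits ≤ (n + 2) ^ b ∧ ∀ g ∈ (C n).gates, g.1 < (n + 2) ^ b) ∧
  ∃ (M : Turing.TM2ComputableInTime ConnQuery.encode Computability.encodeBool
      (fun τ => decide (τ ∈ directConnection C))) (c : ℕ), ∀ l : ℕ, M.time l ≤ c * (l + 1)

/-- (Promise) `BQLOGTIME`: a `LOGTIME`-uniform family of quantum circuits with `O(log n)` gates,
among them random-access queries to the input, decides the problem with error at most `1/3`. -/
def InBQLOGTIME (P : PromiseProblem) : Prop :=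
  ∃ C : (n : ℕ) → QCircuit n, LogTimeUniform C ∧
    (∃ c : ℕ, ∀ n, (C n).size ≤ c * (Nat.log 2 n + 1)) ∧
    ∀ n, (∀ x ∈ P.yes n, 2 / 3 ≤ (C n).acceptProb x) ∧ (∀ x ∈ P.no n, (C n).acceptProb x ≤ 1 / 3)

/-! ### Promise Fourier Checking -/

/-- `p(f, g) = N⁻³ (∑ x y, f x (-1)^(x · y) g y)²` with `N = 2 ^ m`; the group `ℤˣ` is `{1, -1}`. -/
noncomputable def forrelation {m : ℕ} (f g : (Fin m → Bool) → ℤˣ) : ℝ :=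
  1 / ((2 : ℝ) ^ m) ^ 3 *
    (∑ x : Fin m → Bool, ∑ y : Fin m → Bool,
      ((f x : ℤ) : ℝ) * (-1) ^ (∑ i, if x i && y i then 1 else 0 : ℕ) * ((g y : ℤ) : ℝ)) ^ 2

/-- The Boolean function with values `±1` whose truth table starts at position `start` of the
input `inp`; the bit `1` stands for the value `-1`. -/
def truthTable {n : ℕ} (m start : ℕ) (inp : Fin n → Bool) (u : Fin m → Bool) : ℤˣ :=
  if readBit inp (start + Nat.ofBits u) then -1 else 1

/-- The number `p(f, g)` of the pair of functions on `{0,1}^m` whose truth tables, one after the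
other, form the input of length `2 ^ (m + 1)`. -/
noncomputable def inputForrelation {n : ℕ} (m : ℕ) (inp : Fin n → Bool) : ℝ :=
  forrelation (truthTable m 0 inp) (truthTable m (2 ^ m) inp)

/-- Promise Fourier Checking: is `p(f, g)` at least `0.05` or at most `0.01`? -/
noncomputable def promiseFourierChecking : PromiseProblem where
  yes n := {inp | ∃ m : ℕ, n = 2 ^ (m + 1) ∧ 0.05 ≤ inputForrelation m inp}
  no n := {inp | ∃ m : ℕ, n = 2 ^ (m + 1) ∧ inputForrelation m inp ≤ 0.01}
  disjoint n := by
    rw [Set.disjoint_left]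
    rintro inp ⟨m, hm, h⟩ ⟨m', hm', h'⟩
    have e : m + 1 = m' + 1 := Nat.pow_right_injective le_rfl (hm.symm.trans hm')
    obtain rfl : m = m' := by omega
    norm_num at h h'
    linarith

end FourierChecking

/-! Upper bound. Put `N = 2 ^ m`. The state `H g H f H |0⟩` (Hadamard transforms interleaved with
phase oracles) has at the zero address an amplitude whose square is exactly `p(f, g)`
(`norm_sq_forrelationState_zero`). The circuit runs `R` independent copies of this algorithm and
accepts when some register ends at zero, which happens with probability `1 - (1 - p) ^ R`
(`acceptProb_program`); `R = 32` separates `0.05` from `0.01`. The copies share one target qubit in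
the state `|−⟩`, which turns queries into phases, and one top address qubit, which selects the truth
table of `f` or of `g`. All copies together use a constant number of layers of at most `m + 1` gates
each.

Uniformity. Gate names and qubit numbers have the form `a * n + b * 2 ^ j`, with `a` and `b` from a
finite set that does not depend on `n`; only the last chain qubit, at `n / 2` past a multiple of
`n`, needs a factor two. Membership in the direct connection language thus becomes a Boolean
combination of linear equations, linear inequalities and statements that a linear form is a power of
two. Read from the least significant bit, each of these is checked by a finite automaton whose state
is a bounded carry (`LinForm.recognizable`). A finite automaton is a linear-time Turing machine.

Lower bound. Let `v` be a standard Gaussian vector indexed by `{0,1}^m`, with normalized Fourier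
transform `v̂`. Given `v`, the bits of `f` and `g` are drawn independently, as signs whose means are
the sines of the entries of `v̂` and `v`. Sines are bounded by one, so these means are legitimate,
and their joint moments come from the Gaussian characteristic function in closed form. The entries
of `v̂` and of `v` are separately independent, with cross covariances `±1 / √N`. Hence every pair
`x, y` pushes the correlation in the same direction, and `p` has mean at least about `e⁻²`; since `p
≤ 1`, it reaches `0.05` with constant probability (`le_forrelatedMeasure_real`). For uniform inputs
`p` has mean `1 / N`, and Markov's inequality applies (`uniform_real_le`).

This distribution is nevertheless almost independent. The ratio of the two probabilities of a term
is the mean of a product of factors `1 ± sin`, so what is needed is that every mixed moment of `j`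
sines is tiny. Such a moment is an average over sign patterns of a character times the exponential
of a quadratic form. After expanding the exponential into a sum over edge sets, only edge sets that
cover all `j` indices survive; they have at least `j / 2` edges, each costing about `1 / √N`
(`abs_sum_prod_mul_exp_le`). A circuit for the promise problem would accept with probability at
least `0.07` here and `o(1)` under the uniform distribution, contrary to the conjecture. -/

namespace FourierChecking

/-! ### Upper bound: arithmetic of queries by finite automata, and automata as linear-time machines.
-/

/-! ### Sets of queries that are recognized by finite automata -/

/-- The first column of the word that encodes a query. -/
def ConnQuery.col (τ : ConnQuery) : Fin 5 → Bool :=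
  ![τ.n.testBit 0, τ.gate.testBit 0, τ.kind.testBit 0, decide (0 < τ.port), τ.wire.testBit 0]

/-- The query whose word is that of `τ` without its first column. -/
def ConnQuery.shift (τ : ConnQuery) : ConnQuery :=
  ⟨τ.n / 2, τ.gate / 2, τ.kind / 2, τ.port - 1, τ.wire / 2⟩

/-- The length of the word that encodes a query. -/
def ConnQuery.len (τ : ConnQuery) : ℕ :=
  max (max (Nat.size τ.n) (Nat.size τ.gate)) (max (max (Nat.size τ.kind) (Nat.size τ.wire)) τ.port)

theorem size_div_two (n : ℕ) : Nat.size (n / 2) = Nat.size n - 1 := by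
  refine eq_of_forall_ge_iff fun k => ?_
  rw [Nat.size_le, tsub_le_iff_right, Nat.size_le, pow_succ]
  omega

theorem ConnQuery.len_shift (τ : ConnQuery) : τ.shift.len = τ.len - 1 := by
  simp only [ConnQuery.len, ConnQuery.shift, size_div_two]
  omega

/-- Dropping a column halves the binary tracks and decrements the unary one. Induction on `len`
therefore replaces all reasoning about words. -/
theorem ConnQuery.encode_eq_cons {τ : ConnQuery} (h : τ.len ≠ 0) :
    τ.encode = τ.col :: τ.shift.encode := by
  obtain ⟨l, hl⟩ := Nat.exists_eq_succ_of_ne_zero h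
  have hs : τ.shift.len = l := by rw [ConnQuery.len_shift, hl]; rfl
  have e₁ : τ.encode = (List.range τ.len).map fun i =>
      ![τ.n.testBit i, τ.gate.testBit i, τ.kind.testBit i, decide (i < τ.port),
        τ.wire.testBit i] := rfl
  have e₂ : τ.shift.encode = (List.range τ.shift.len).map fun i =>
      ![(τ.n / 2).testBit i, (τ.gate / 2).testBit i, (τ.kind / 2).testBit i,
        decide (i < τ.port - 1), (τ.wire / 2).testBit i] := rfl
  rw [e₁, e₂, hs, hl, List.range_succ_eq_map, List.map_cons, List.map_map]
  congr 1
  refine List.map_congr_left fun i _ => ?_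
  simp only [Function.comp, Nat.succ_eq_add_one, Nat.testBit_add_one]
  congr 4
  simp only [decide_eq_decide]
  omega

theorem ConnQuery.eq_zero_of_len_eq_zero {τ : ConnQuery} (h : τ.len = 0) :
    τ = ⟨0, 0, 0, 0, 0⟩ := by
  rcases τ with ⟨n, g, k, p, w⟩
  simp only [ConnQuery.len, Nat.max_eq_zero_iff, Nat.size_eq_zero] at h
  obtain ⟨⟨rfl, rfl⟩, ⟨rfl, rfl⟩, rfl⟩ := h
  rfl

/-- A finite automaton that reads the encoding of a query decides whether it satisfies `P`. -/
def Recognizable (P : ConnQuery → Prop) : Prop :=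
  ∃ (Q : Type) (_ : Fintype Q) (q₀ : Q) (step : Q → (Fin 5 → Bool) → Q) (acc : Q → Bool),
    ∀ τ : ConnQuery, acc (τ.encode.foldl step q₀) = true ↔ P τ

theorem Recognizable.congr {P P' : ConnQuery → Prop} (h : Recognizable P)
    (hP : ∀ τ, P τ ↔ P' τ) : Recognizable P' := by
  obtain ⟨Q, hQ, q₀, step, acc, h⟩ := h
  exact ⟨Q, hQ, q₀, step, acc, fun τ => (h τ).trans (hP τ)⟩

theorem Recognizable.not {P : ConnQuery → Prop} (h : Recognizable P) :
    Recognizable fun τ => ¬ P τ := by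
  obtain ⟨Q, hQ, q₀, step, acc, h⟩ := h
  exact ⟨Q, hQ, q₀, step, fun q => !acc q, fun τ => by simp [← h τ]⟩

theorem Recognizable.and {P P' : ConnQuery → Prop} (h : Recognizable P) (h' : Recognizable P') :
    Recognizable fun τ => P τ ∧ P' τ := by
  obtain ⟨Q, hQ, q₀, step, acc, h⟩ := h
  obtain ⟨Q', hQ', q₀', step', acc', h'⟩ := h'
  refine ⟨Q × Q', inferInstance, (q₀, q₀'), fun q b => (step q.1 b, step' q.2 b),
    fun q => acc q.1 && acc' q.2, fun τ => ?_⟩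
  have key : ∀ (l : List (Fin 5 → Bool)) (q : Q) (q' : Q'),
      l.foldl (fun (q : Q × Q') b => (step q.1 b, step' q.2 b)) (q, q') =
        (l.foldl step q, l.foldl step' q') := by
    intro l
    induction l with
    | nil => intros; rfl
    | cons b l ih => intro q q'; exact ih _ _
  rw [key, Bool.and_eq_true, h, h']

theorem Recognizable.or {P P' : ConnQuery → Prop} (h : Recognizable P) (h' : Recognizable P') :
    Recognizable fun τ => P τ ∨ P' τ :=
  (h.not.and h'.not).not.congr fun τ => by tauto

theorem Recognizable.exists_lt {P : ℕ → ConnQuery → Prop} (L : ℕ)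
    (h : ∀ t < L, Recognizable (P t)) : Recognizable fun τ => ∃ t < L, P t τ := by
  induction L with
  | zero =>
    exact ⟨Unit, inferInstance, (), fun _ _ => (), fun _ => false, by simp⟩
  | succ L ih =>
    refine ((ih fun t ht => h t (by omega)).or (h L (by omega))).congr fun τ => ?_
    constructor
    · rintro (⟨t, ht, hP⟩ | hP)
      · exact ⟨t, by omega, hP⟩
      · exact ⟨L, by omega, hP⟩
    · rintro ⟨t, ht, hP⟩
      rcases Nat.lt_succ_iff_lt_or_eq.1 ht with ht | rfl
      · exact Or.inl ⟨t, ht, hP⟩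
      · exact Or.inr hP

/-- A family of predicates that is closed under reading one column, with finitely many members
reachable, consists of recognizable predicates. -/
theorem Recognizable.of_step {Q : Type} (S : Q → ConnQuery → Prop)
    (step : Q → (Fin 5 → Bool) → Q) (hS : ∀ q τ, S q τ ↔ S (step q τ.col) τ.shift)
    (F : Set Q) (hF : F.Finite) (hstep : ∀ q ∈ F, ∀ b, step q b ∈ F) {q₀ : Q} (hq₀ : q₀ ∈ F) :
    Recognizable (S q₀) := by
  classical
  refine ⟨F, hF.fintype, ⟨q₀, hq₀⟩, fun q b => ⟨step q.1 b, hstep q.1 q.2 b⟩,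
    -- After the last column the remaining query is zero, so a state accepts iff its predicate holds
    -- there.
    fun q => decide (S q.1 ⟨0, 0, 0, 0, 0⟩), fun τ => ?_⟩
  have key : ∀ (l : ℕ) (τ : ConnQuery), τ.len = l → ∀ q : F,
      decide (S (τ.encode.foldl (fun (q : F) b => (⟨step q.1 b, hstep q.1 q.2 b⟩ : F)) q).1
        ⟨0, 0, 0, 0, 0⟩) = true ↔ S q.1 τ := by
    intro l
    induction l with
    | zero =>
      intro τ hτ q
      obtain rfl := ConnQuery.eq_zero_of_len_eq_zero hτ
      exact decide_eq_true_iff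
    | succ l ih =>
      intro τ hτ q
      rw [ConnQuery.encode_eq_cons (by omega), List.foldl_cons, hS q.1 τ]
      exact ih _ (by rw [ConnQuery.len_shift]; omega) _
  exact key _ τ rfl _

/-- Integral linear forms in the numbers of a query other than the port number. -/
structure LinForm where
  n : ℤ
  gate : ℤ
  kind : ℤ
  wire : ℤ

/-- The value of a linear form. -/
def LinForm.eval (c : LinForm) (τ : ConnQuery) : ℤ :=
  c.n * τ.n + c.gate * τ.gate + c.kind * τ.kind + c.wire * τ.wire

/-- The value of a linear form on the bits in a column. -/
def LinForm.evalCol (c : LinForm) (b : Fin 5 → Bool) : ℤ :=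
  c.n * (b 0).toNat + c.gate * (b 1).toNat + c.kind * (b 2).toNat + c.wire * (b 4).toNat

theorem LinForm.eval_eq (c : LinForm) (τ : ConnQuery) :
    c.eval τ = 2 * c.eval τ.shift + c.evalCol τ.col := by
  have key : ∀ x : ℕ, (x : ℤ) = 2 * (x / 2 : ℕ) + (x.testBit 0).toNat := by
    intro x
    rw [Nat.toNat_testBit]
    omega
  have h1 := key τ.n
  have h2 := key τ.gate
  have h3 := key τ.kind
  have h4 := key τ.wire
  simp only [LinForm.eval, LinForm.evalCol, ConnQuery.col, ConnQuery.shift]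
  simp only [Matrix.cons_val]
  linear_combination c.n * h1 + c.gate * h2 + c.kind * h3 + c.wire * h4

/-- The relations between the value of a linear form and an integer that an automaton tracks. -/
inductive LinMode
  | fail | eq | ge | pow | port

instance : Finite LinMode :=
  Finite.of_injective (fun m : LinMode => match m with
    | .fail => (0 : Fin 5)
    | .eq => 1
    | .ge => 2
    | .pow => 3
    | .port => 4) fun m m' h => by cases m <;> cases m' <;> simp_all

/-- The predicate on queries that belongs to a relation and an integer. -/
def LinForm.Holds (c : LinForm) : LinMode × ℤ → ConnQuery → Prop
  | (.fail, _), _ => False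
  | (.eq, z), τ => c.eval τ = z
  | (.ge, z), τ => z ≤ c.eval τ
  | (.pow, z), τ => ∃ j : ℕ, c.eval τ = z + 2 ^ j
  | (.port, z), τ => c.eval τ = z + 2 ^ τ.port

/-- The transition of the automaton for a linear form. -/
def LinForm.step (c : LinForm) (q : LinMode × ℤ) (b : Fin 5 → Bool) : LinMode × ℤ :=
  match q with
  | (.fail, _) => (.fail, 0)
  | (.eq, z) => if (z - c.evalCol b) % 2 = 0 then (.eq, (z - c.evalCol b) / 2) else (.fail, 0)
  -- Half of `z - c.evalCol b`, rounded up.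
  | (.ge, z) => (.ge, (z - c.evalCol b + 1) / 2)
  | (.pow, z) =>
    if (z - c.evalCol b) % 2 = 0 then (.pow, (z - c.evalCol b) / 2)
    else (.eq, (z - c.evalCol b + 1) / 2)
  | (.port, z) =>
    if b 3 then
      if (z - c.evalCol b) % 2 = 0 then (.port, (z - c.evalCol b) / 2) else (.fail, 0)
    else
      if (z - c.evalCol b) % 2 = 0 then (.fail, 0) else (.eq, (z - c.evalCol b + 1) / 2)

/-- By `LinForm.eval_eq` a column changes the target `z` into half of `z - c.evalCol τ.col`, and
parity decides the rest. In the modes `pow` and `port` an odd difference forces the power to be `2 ^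
0`, after which the exact equation `eq` remains; an even one halves the power. Halving `2 ^ port`
matches the decrement of the unary track. -/
theorem LinForm.holds_step (c : LinForm) (q : LinMode × ℤ) (τ : ConnQuery) :
    c.Holds q τ ↔ c.Holds (c.step q τ.col) τ.shift := by
  have h := c.eval_eq τ
  obtain ⟨m, z⟩ := q
  cases m with
  | fail => rfl
  | eq =>
    simp only [LinForm.step]
    split_ifs <;> simp only [LinForm.Holds] <;> constructor <;> intro h' <;>
      first | exact h'.elim | omega
  | ge =>
    simp only [LinForm.step, LinForm.Holds]
    omega
  | pow =>
    simp only [LinForm.step]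
    split_ifs with hp <;> simp only [LinForm.Holds]
    · constructor
      · rintro ⟨j, hj⟩
        cases j with
        | zero => simp only [pow_zero] at hj; omega
        | succ j => exact ⟨j, by rw [pow_succ] at hj; omega⟩
      · rintro ⟨j, hj⟩
        exact ⟨j + 1, by rw [pow_succ]; omega⟩
    · constructor
      · rintro ⟨j, hj⟩
        cases j with
        | zero => simp only [pow_zero] at hj; omega
        | succ j => rw [pow_succ] at hj; omega
      · intro hj
        exact ⟨0, by rw [pow_zero]; omega⟩
  | port =>
    have hb : τ.col 3 = decide (0 < τ.port) := rfl
    have hs : τ.shift.port = τ.port - 1 := rfl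
    simp only [LinForm.step, hb, decide_eq_true_eq]
    split_ifs with h0 hp hp <;> simp only [LinForm.Holds, hs]
    · obtain ⟨p, hp'⟩ := Nat.exists_eq_succ_of_ne_zero h0.ne'
      rw [hp', Nat.succ_eq_add_one, pow_succ, Nat.add_sub_cancel]
      constructor <;> intro h' <;>
      first | exact h'.elim | omega
    · obtain ⟨p, hp'⟩ := Nat.exists_eq_succ_of_ne_zero h0.ne'
      rw [hp', Nat.succ_eq_add_one, pow_succ]
      constructor <;> intro h' <;>
      first | exact h'.elim | omega
    · rw [Nat.eq_zero_of_not_pos h0, pow_zero]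
      constructor <;> intro h' <;>
      first | exact h'.elim | omega
    · rw [Nat.eq_zero_of_not_pos h0, pow_zero]
      constructor <;> intro h' <;>
      first | exact h'.elim | omega

theorem LinForm.abs_evalCol_le (c : LinForm) (b : Fin 5 → Bool) :
    |c.evalCol b| ≤ |c.n| + |c.gate| + |c.kind| + |c.wire| := by
  have key : ∀ (a : ℤ) (x : Bool), |a * x.toNat| ≤ |a| := by
    intro a x
    cases x <;> simp
  exact (abs_add_le _ _).trans (add_le_add ((abs_add_le _ _).trans (add_le_add
    ((abs_add_le _ _).trans (add_le_add (key _ _) (key _ _))) (key _ _))) (key _ _))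

/-- The carry stays bounded: a step halves it after adding at most the sum of the absolute
coefficients and one, so it never leaves the interval `[-B, B]`. -/
theorem LinForm.recognizable (c : LinForm) (q : LinMode × ℤ) : Recognizable (c.Holds q) := by
  set B : ℤ := |c.n| + |c.gate| + |c.kind| + |c.wire| + 1 + |q.2| with hB
  refine Recognizable.of_step c.Holds c.step c.holds_step (Set.univ ×ˢ Set.Icc (-B) B)
    (Set.finite_univ.prod (Set.finite_Icc _ _)) ?_ ?_
  · rintro ⟨m, z⟩ ⟨-, hz⟩ b
    have hb := abs_le.1 (c.abs_evalCol_le b)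
    have h0 := abs_nonneg q.2
    simp only [Set.mem_Icc] at hz
    refine ⟨trivial, ?_⟩
    simp only [Set.mem_Icc]
    cases m <;> simp only [LinForm.step] <;> (try split_ifs) <;> constructor <;>
      (try dsimp only) <;> omega
  · refine ⟨trivial, ?_⟩
    have h0 := abs_le.1 (le_refl |q.2|)
    have h1 := abs_nonneg c.n
    have h2 := abs_nonneg c.gate
    have h3 := abs_nonneg c.kind
    have h4 := abs_nonneg c.wire
    simp only [Set.mem_Icc]
    omega

/-! ### Finite automata as Turing machines -/

/-- The machine that runs a finite automaton on its input stack and pushes the answer onto its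
output stack. -/
def automatonMachine (Q : Type) [Fintype Q] (q₀ : Q) (step : Q → (Fin 5 → Bool) → Q)
    (acc : Q → Bool) : Turing.FinTM2 where
  K := Bool
  k₀ := false
  k₁ := true
  Γ k := cond k Bool (Fin 5 → Bool)
  Λ := Unit
  main := ()
  σ := Q × Bool
  initialState := (q₀, false)
  Γk₀Fin := inferInstanceAs (Fintype (Fin 5 → Bool))
  m _ := .pop false (fun v b => match b with
      | none => (v.1, true)
      | some b => (step v.1 b, false))
    (.branch (fun v => v.2)
      -- The prescribed halting configuration carries the initial internal state, hence the reset
      -- before `halt`.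
      (.push true (fun v => acc v.1) (.load (fun _ => (q₀, false)) .halt))
      (.goto fun _ => ()))

/-- Popping, updating and jumping form a single machine step, so each symbol costs one step; the
additional step notices the empty stack and writes the answer. -/
theorem automatonMachine_run (Q : Type) [Fintype Q] (q₀ : Q) (step : Q → (Fin 5 → Bool) → Q)
    (acc : Q → Bool) (l : List (Fin 5 → Bool)) (q : Q) :
    (flip bind (automatonMachine Q q₀ step acc).step)^[l.length + 1]
      (some ⟨some (), (q, false), fun k => match k with
        | false => l
        | true => []⟩) =
      some ⟨none, (q₀, false), fun k => match k with
        | false => []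
        | true => [acc (l.foldl step q)]⟩ := by
  induction l generalizing q with
  | nil =>
    rw [List.length_nil, Function.iterate_succ_apply, Function.iterate_zero_apply]
    change some _ = some _
    congr 1
    change Turing.TM2.Cfg.mk _ _ _ = _
    congr 1
    funext k
    cases k <;> rfl
  | cons b l ih =>
    rw [List.length_cons, Function.iterate_succ_apply, List.foldl_cons, ← ih]
    congr 1
    change some _ = some _
    congr 1
    change Turing.TM2.Cfg.mk _ _ _ = _
    congr 1
    funext k
    cases k <;> rfl

open Classical in
theorem Recognizable.computableInTime {A : Set ConnQuery} (h : Recognizable (· ∈ A)) :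
    ∃ (M : Turing.TM2ComputableInTime ConnQuery.encode Computability.encodeBool
      (fun τ => decide (τ ∈ A))) (c : ℕ), ∀ l : ℕ, M.time l ≤ c * (l + 1) := by
  obtain ⟨Q, hQ, q₀, step, acc, h⟩ := h
  refine ⟨{ tm := automatonMachine Q q₀ step acc
            inputAlphabet := Equiv.refl (Fin 5 → Bool)
            outputAlphabet := Equiv.refl Bool
            time := fun l => l + 1
            outputsFun := fun τ => ⟨⟨τ.encode.length + 1, ?_⟩, le_rfl⟩ }, 1, fun l => by simp⟩
  have hacc : acc (τ.encode.foldl step q₀) = decide (τ ∈ A) := by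
    rw [Bool.eq_iff_iff, h, decide_eq_true_iff]
  have hrun := automatonMachine_run Q q₀ step acc τ.encode q₀
  rw [hacc] at hrun
  have hid : List.map (Equiv.refl (Fin 5 → Bool)).invFun τ.encode = τ.encode := List.map_id _
  convert hrun using 2
  · change some (Turing.TM2.Cfg.mk _ _ _) = _
    congr 2
    funext k
    cases k
    · exact hid
    · rfl
  · change some (Turing.TM2.Cfg.mk _ _ _) = _
    congr 2
    funext k
    cases k <;> rfl

end FourierChecking

/-! ### Upper bound: layout of the circuits and their uniformity. -/

namespace FourierChecking

/-! ### The circuits -/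

/-- The qubits of the circuit for inputs of length `2 ^ (m + 1)` that runs `R` copies of the
forrelation algorithm: the answer, the target and the last address qubit of the queries, and for
each copy the address register and a chain that records which initial parts of the address
vanish. -/
inductive Wire (R m : ℕ) : Type
  | out
  | target
  | top
  | addr (r : Fin R) (j : Fin m)
  | chain (r : Fin R) (j : Fin (m + 1))

namespace Wire

variable {R m : ℕ}

/-- The quotient of the qubit number by the input length. -/
def tag : Wire R m → ℕ
  | out => 0
  | target => 1
  | top => 2
  | addr r _ => 3 + 2 * r
  | chain r _ => 4 + 2 * r

/-- The remainder of the qubit number modulo the input length. -/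
def low : Wire R m → ℕ
  | out => 0
  | target => 0
  | top => 0
  -- Port `0` of a query gate is the target, so address bit `j` sits at port `j + 1` and this number
  -- is `2 ^ port`, a quantity that the automata can track.
  | addr _ j => 2 ^ (j.1 + 1)
  | chain _ j => 2 ^ j.1

theorem low_lt (w : Wire R m) : w.low < 2 ^ (m + 1) := by
  cases w with
  | out => exact Nat.two_pow_pos _
  | target => exact Nat.two_pow_pos _
  | top => exact Nat.two_pow_pos _
  | addr r j => exact Nat.pow_lt_pow_right one_lt_two (by omega)
  | chain r j => exact Nat.pow_lt_pow_right one_lt_two j.2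

theorem tag_lt (w : Wire R m) : w.tag < 2 * R + 3 := by
  cases w <;> simp only [tag] <;> omega

/-- The number of a qubit. -/
def num (w : Wire R m) : ℕ := w.tag * 2 ^ (m + 1) + w.low

theorem num_lt (w : Wire R m) : w.num < (2 * R + 3) * 2 ^ (m + 1) := by
  have h := Nat.mul_le_mul_right (2 ^ (m + 1)) (Nat.succ_le_of_lt w.tag_lt)
  rw [Nat.succ_mul] at h
  exact (Nat.add_lt_add_left w.low_lt _).trans_le h

theorem num_injective : Function.Injective (num : Wire R m → ℕ) := by
  intro w w' h
  have hp := Nat.two_pow_pos (m + 1)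
  have htag : w.tag = w'.tag := by
    have h' := congrArg (· / 2 ^ (m + 1)) h
    simpa only [num, Nat.mul_comm _ (2 ^ (m + 1)), Nat.mul_add_div hp,
      Nat.div_eq_of_lt (low_lt _), Nat.add_zero] using h'
  have hlow : w.low = w'.low := by
    simp only [num, htag] at h
    exact Nat.add_left_cancel h
  cases w <;> cases w' <;> simp only [tag, low] at htag hlow <;> first | rfl | omega | skip
  · rename_i r j r' j'
    have := Nat.pow_right_injective le_rfl hlow
    obtain rfl : r = r' := by omega
    obtain rfl : j = j' := by omega
    rfl
  · rename_i r j r' j'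
    have := Nat.pow_right_injective le_rfl hlow
    obtain rfl : r = r' := by omega
    obtain rfl : j = j' := by omega
    rfl

/-- A qubit of the circuit. -/
def fin (w : Wire R m) : Fin ((2 * R + 3) * 2 ^ (m + 1)) := ⟨w.num, w.num_lt⟩

theorem fin_injective : Function.Injective (fin : Wire R m → _) := fun _ _ h =>
  num_injective (Fin.ext_iff.1 h)

theorem fin_ne {w w' : Wire R m} (h : w ≠ w') : w.fin ≠ w'.fin := fin_injective.ne h

/-- The qubit that carries bit `j` of the address in copy `r`. -/
def address (r : Fin R) (j : ℕ) : Wire R m := if h : j < m then addr r ⟨j, h⟩ else top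

end Wire

/-- The layers of the circuit: gates on single qubits, and gates on a whole register. -/
inductive Layer (R : ℕ) : Type
  | notTarget
  | hadTarget
  | notTop
  | had (r : Fin R)
  | query (r : Fin R)
  | not (r : Fin R)
  | notChain (r : Fin R)
  | cnotIn (r : Fin R)
  | toffoli (r : Fin R)
  | cnotOut (r : Fin R)

/-- The query gate of copy `r`. -/
def queryGate (R m : ℕ) (r : Fin R) : QGate (2 ^ (m + 1)) ((2 * R + 3) * 2 ^ (m + 1)) :=
  .query (fun j => (Wire.address r j.1 : Wire R m).fin) (Wire.target : Wire R m).fin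
    (by
      intro j j' h
      have hj := j.2
      have hj' := j'.2
      have e := Wire.fin_injective h
      simp only [Nat.clog_pow 2 (m + 1) one_lt_two] at hj hj'
      unfold Wire.address at e
      split_ifs at e
      · simp only [Wire.addr.injEq, Fin.mk.injEq, true_and] at e
        exact Fin.ext e
      · exact Fin.ext (by omega))
    (by
      intro j
      refine Wire.fin_ne ?_
      unfold Wire.address
      split_ifs <;> simp)

/-- The gates of a layer with the lower parts of their names. -/
def Layer.gates {R : ℕ} (m : ℕ) :
    Layer R → List (ℕ × QGate (2 ^ (m + 1)) ((2 * R + 3) * 2 ^ (m + 1)))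
  | .notTarget => [(0, .x (Wire.target : Wire R m).fin)]
  | .hadTarget => [(0, .h (Wire.target : Wire R m).fin)]
  | .notTop => [(0, .x (Wire.top : Wire R m).fin)]
  | .had r => (List.finRange m).map fun j => (2 ^ j.1, .h (Wire.addr r j).fin)
  | .query r => [(0, queryGate R m r)]
  | .not r => (List.finRange m).map fun j => (2 ^ j.1, .x (Wire.addr r j).fin)
  | .notChain r => [(0, .x (Wire.chain r 0 : Wire R m).fin)]
  | .cnotIn r => [(0, .cnot (Wire.out : Wire R m).fin (Wire.chain r 0 : Wire R m).fin
      (Wire.fin_ne (by simp)))]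
  | .toffoli r => (List.finRange m).map fun j =>
      (2 ^ j.1, .ccnot (Wire.chain r j.castSucc).fin (Wire.addr r j).fin (Wire.chain r j.succ).fin
        (Wire.fin_ne (by simp)) (Wire.fin_ne (by simp [Fin.ext_iff])) (Wire.fin_ne (by simp)))
  | .cnotOut r => [(0, .cnot (Wire.chain r (Fin.last m) : Wire R m).fin (Wire.out : Wire R m).fin
      (Wire.fin_ne (by simp)))]

theorem Layer.gates_pairwise {R : ℕ} (m : ℕ) (ℓ : Layer R) :
    ((ℓ.gates m).map Prod.fst).Pairwise (· < ·) := by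
  have key : ∀ f : Fin m → QGate (2 ^ (m + 1)) ((2 * R + 3) * 2 ^ (m + 1)),
      (((List.finRange m).map fun j => (2 ^ j.1, f j)).map Prod.fst).Pairwise (· < ·) := by
    intro f
    rw [List.map_map, List.pairwise_map]
    exact (List.pairwise_lt_finRange m).imp fun h => Nat.pow_lt_pow_right one_lt_two h
  cases ℓ <;> first | exact List.pairwise_singleton _ _ | exact key _

theorem Layer.fst_lt {R m : ℕ} {ℓ : Layer R}
    {g : ℕ × QGate (2 ^ (m + 1)) ((2 * R + 3) * 2 ^ (m + 1))} (hg : g ∈ ℓ.gates m) :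
    g.1 < 2 ^ (m + 1) := by
  cases ℓ <;> simp only [Layer.gates, List.mem_singleton, List.mem_map] at hg <;>
    first
    | (subst hg; exact Nat.two_pow_pos _)
    | (obtain ⟨j, -, rfl⟩ := hg; exact Nat.pow_lt_pow_right one_lt_two (by omega))

theorem Layer.length_gates_le {R : ℕ} (m : ℕ) (ℓ : Layer R) : (ℓ.gates m).length ≤ m + 1 := by
  cases ℓ <;> simp [Layer.gates]

/-- The sequence of layers: phase kickback target, `R` runs of the forrelation algorithm, and the
test whether some run ends with an address register that is zero. -/
def program (R : ℕ) : List (Layer R) :=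
  [.notTarget, .hadTarget] ++
    ((List.finRange R).flatMap fun r =>
      [.had r, .query r, .had r, .notTop, .query r, .notTop, .had r]) ++
    (List.finRange R).flatMap fun r => [.not r, .notChain r, .cnotIn r, .toffoli r, .cnotOut r]

/-- The gates of a sequence of layers with their names. -/
def layerGates (R m : ℕ) (p : List (Layer R)) :
    List (ℕ × QGate (2 ^ (m + 1)) ((2 * R + 3) * 2 ^ (m + 1))) :=
  (List.finRange p.length).flatMap fun t =>
    ((p.get t).gates m).map fun g => (t.1 * 2 ^ (m + 1) + g.1, g.2)

theorem layerGates_pairwise (R m : ℕ) (p : List (Layer R)) :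
    ((layerGates R m p).map Prod.fst).Pairwise (· < ·) := by
  rw [layerGates, List.map_flatMap, List.pairwise_flatMap]
  constructor
  · intro t _
    have h := (p.get t).gates_pairwise m
    rw [List.map_map, List.pairwise_map]
    rw [List.pairwise_map] at h
    exact h.imp fun h => Nat.add_lt_add_left h _
  · refine (List.pairwise_lt_finRange _).imp fun {t t'} h a ha b hb => ?_
    simp only [List.mem_map, exists_exists_and_eq_and] at ha hb
    obtain ⟨g, hg, rfl⟩ := ha
    obtain ⟨g', hg', rfl⟩ := hb
    have h1 := Layer.fst_lt hg
    have h2 := Nat.mul_le_mul_right (2 ^ (m + 1)) (Nat.succ_le_of_lt (Fin.lt_def.1 h))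
    rw [Nat.succ_mul] at h2
    omega

theorem mem_layerGates {R m : ℕ} {p : List (Layer R)}
    {g : ℕ × QGate (2 ^ (m + 1)) ((2 * R + 3) * 2 ^ (m + 1))} :
    g ∈ layerGates R m p ↔ ∃ t : Fin p.length, ∃ low,
      (low, g.2) ∈ (p.get t).gates m ∧ g.1 = t.1 * 2 ^ (m + 1) + low := by
  simp only [layerGates, List.mem_flatMap, List.mem_finRange, true_and, List.mem_map]
  refine exists_congr fun t => ?_
  constructor
  · rintro ⟨g', hg', rfl⟩
    exact ⟨g'.1, hg', rfl⟩
  · rintro ⟨low, hl, h⟩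
    exact ⟨(low, g.2), hl, Prod.ext h.symm rfl⟩

theorem layerGates_map_snd (R m : ℕ) (p : List (Layer R)) :
    (layerGates R m p).map Prod.snd = p.flatMap fun ℓ => (ℓ.gates m).map Prod.snd := by
  have h : p.flatMap (fun ℓ => (ℓ.gates m).map Prod.snd) =
      ((List.finRange p.length).map p.get).flatMap fun ℓ => (ℓ.gates m).map Prod.snd := by
    rw [List.map_get_finRange]
  rw [h, List.flatMap_map]
  simp only [layerGates, List.map_flatMap, List.map_map]
  rfl

theorem length_layerGates_le (R m : ℕ) (p : List (Layer R)) :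
    (layerGates R m p).length ≤ p.length * (m + 1) := by
  rw [← List.length_map (f := Prod.snd), layerGates_map_snd, List.length_flatMap]
  refine (List.sum_le_card_nsmul _ (m + 1) ?_).trans (by simp)
  simp only [List.mem_map]
  rintro _ ⟨ℓ, -, rfl⟩
  rw [List.length_map]
  exact ℓ.length_gates_le m

/-- The circuit that runs a sequence of layers. -/
def layerCircuit (R m : ℕ) (p : List (Layer R)) : QCircuit (2 ^ (m + 1)) where
  qubits := (2 * R + 3) * 2 ^ (m + 1)
  qubits_pos := by positivity
  gates := layerGates R m p
  sorted := layerGates_pairwise R m p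

open Classical in
/-- The family of circuits that is trivial unless the input length is `2 ^ (m + 1)`. -/
noncomputable def layerFamily (R : ℕ) (p : List (Layer R)) (n : ℕ) : QCircuit n :=
  if h : ∃ m, n = 2 ^ (m + 1) then h.choose_spec ▸ layerCircuit R h.choose p
  else ⟨1, one_pos, [], by simp⟩

/-- The exponent picked by choice equals `m` only propositionally. Stating the claim for an
arbitrary `m'` allows substitution, after which the transport is trivial. -/
theorem layerFamily_two_pow (R : ℕ) (p : List (Layer R)) (m : ℕ) :
    layerFamily R p (2 ^ (m + 1)) = layerCircuit R m p := by
  have h : ∃ m', 2 ^ (m + 1) = 2 ^ (m' + 1) := ⟨m, rfl⟩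
  have key : ∀ (m' : ℕ) (e : 2 ^ (m + 1) = 2 ^ (m' + 1)),
      (e ▸ layerCircuit R m' p : QCircuit (2 ^ (m + 1))) = layerCircuit R m p := by
    intro m' e
    obtain rfl : m = m' := by
      have := Nat.pow_right_injective le_rfl e
      omega
    rfl
  rw [layerFamily, dif_pos h]
  exact key _ h.choose_spec

theorem layerFamily_of_not (R : ℕ) (p : List (Layer R)) {n : ℕ} (h : ¬ ∃ m, n = 2 ^ (m + 1)) :
    layerFamily R p n = ⟨1, one_pos, [], by simp⟩ := dif_neg h

end FourierChecking

namespace FourierChecking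

/-! ### Uniformity of the circuits -/

/-- The wires and names of the gates that a layer with index `t` contributes. -/
def Layer.Connected {R : ℕ} (t : ℕ) (ℓ : Layer R) (τ : ConnQuery) : Prop :=
  ∃ m, τ.n = 2 ^ (m + 1) ∧ ∃ low, τ.gate = t * 2 ^ (m + 1) + low ∧
    ∃ γ, (low, γ) ∈ ℓ.gates m ∧ γ.kind = τ.kind ∧ γ.wires[τ.port]? = some τ.wire

/-- The number of layers does not depend on `n`, so the language is a finite union with one set per
layer, and layers can be treated separately. The repeated bound on `t` serves the shape of
`Recognizable.exists_lt`. -/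
theorem mem_directConnection_layerFamily {R : ℕ} {p : List (Layer R)} {τ : ConnQuery} :
    τ ∈ directConnection (layerFamily R p) ↔
      ∃ t < p.length, ∃ h : t < p.length, (p.get ⟨t, h⟩).Connected t τ := by
  obtain ⟨n, g, k, i, w⟩ := τ
  simp only [directConnection, Set.mem_ofPred_eq, Layer.Connected]
  by_cases h : ∃ m, n = 2 ^ (m + 1)
  · obtain ⟨m, rfl⟩ := h
    rw [layerFamily_two_pow]
    constructor
    · rintro ⟨γ, hγ, hk, hw⟩
      obtain ⟨t, low, hl, hg⟩ := mem_layerGates.1 hγ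
      exact ⟨t, t.2, t.2, m, rfl, low, hg, γ, hl, hk, hw⟩
    · rintro ⟨t, -, ht, m', hm', low, hg, γ, hl, hk, hw⟩
      obtain rfl : m = m' := by
        have := Nat.pow_right_injective le_rfl hm'
        omega
      exact ⟨γ, mem_layerGates.2 ⟨⟨t, ht⟩, low, hl, hg⟩, hk, hw⟩
  · rw [layerFamily_of_not R p h]
    constructor
    · rintro ⟨γ, hγ, -⟩
      exact absurd hγ List.not_mem_nil
    · rintro ⟨t, -, ht, m, hm, -⟩
      exact absurd ⟨m, hm⟩ h

theorem recognizable_eq (c : LinForm) (z : ℤ) : Recognizable fun τ => c.eval τ = z :=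
  c.recognizable (.eq, z)

theorem recognizable_port_eq (p : ℕ) : Recognizable fun τ => τ.port = p := by
  -- For the zero form, mode `port` says `0 = -2 ^ p + 2 ^ τ.port`.
  refine ((⟨0, 0, 0, 0⟩ : LinForm).recognizable (.port, -2 ^ p)).congr fun τ => ?_
  have h : ((⟨0, 0, 0, 0⟩ : LinForm).Holds (.port, -2 ^ p) τ) ↔ (2 : ℤ) ^ τ.port = 2 ^ p := by
    simp only [LinForm.Holds, LinForm.eval]
    constructor <;> intro h <;> linarith
  rw [h]
  constructor
  · intro h
    exact Nat.pow_right_injective le_rfl (by exact_mod_cast h)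
  · rintro rfl
    rfl

theorem recognizable_isPow :
    Recognizable fun τ => ∃ m, τ.n = 2 ^ (m + 1) := by
  -- The inequality `2 ≤ n` excludes `n = 2 ^ 0`.
  refine (((⟨1, 0, 0, 0⟩ : LinForm).recognizable (.pow, 0)).and
    ((⟨1, 0, 0, 0⟩ : LinForm).recognizable (.ge, 2))).congr fun τ => ?_
  simp only [LinForm.Holds, LinForm.eval]
  constructor
  · rintro ⟨⟨j, hj⟩, h2⟩
    have hj' : τ.n = 2 ^ j := by
      have : (τ.n : ℤ) = 2 ^ j := by linarith
      exact_mod_cast this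
    cases j with
    | zero => rw [hj'] at h2; norm_num at h2
    | succ j => exact ⟨j, hj'⟩
  · rintro ⟨m, hm⟩
    refine ⟨⟨m + 1, by rw [hm]; push_cast; ring⟩, ?_⟩
    have := Nat.two_pow_pos m
    rw [pow_succ] at hm
    omega

/-- The query concerns a gate with one of finitely many names and with a fixed qubit. -/
theorem recognizable_single (t κ p : ℕ) (a b : ℕ) : Recognizable fun τ =>
    (∃ m, τ.n = 2 ^ (m + 1)) ∧ τ.gate = t * τ.n ∧ τ.kind = κ ∧ τ.port = p ∧
      2 * τ.wire = a * τ.n + b := by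
  -- The equation is for twice the wire because the last chain qubit has lower part `2 ^ m = n / 2`.
  refine (recognizable_isPow.and ((recognizable_eq ⟨-t, 1, 0, 0⟩ 0).and
    ((recognizable_eq ⟨0, 0, 1, 0⟩ κ).and ((recognizable_port_eq p).and
      (recognizable_eq ⟨-a, 0, 0, 2⟩ b))))).congr fun τ => ?_
  simp only [LinForm.eval]
  zify
  refine and_congr Iff.rfl (and_congr ?_ (and_congr ?_ (and_congr Iff.rfl ?_))) <;>
    constructor <;> intro h <;> linarith

/-- The query concerns a gate on a register and a qubit at a fixed position relative to it. -/
theorem recognizable_ranged (t κ p : ℕ) (a b : ℕ) : Recognizable fun τ =>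
    ∃ m, τ.n = 2 ^ (m + 1) ∧ ∃ j < m, τ.gate = t * τ.n + 2 ^ j ∧ τ.kind = κ ∧ τ.port = p ∧
      τ.wire = a * τ.n + b * 2 ^ j := by
  -- The gate name determines `2 ^ j = gate - t * n`. Substituting this makes the wire equation
  -- linear and turns `j < m`, that is `2 * 2 ^ j < n`, into a linear inequality.
  refine (recognizable_isPow.and (((⟨-t, 1, 0, 0⟩ : LinForm).recognizable (.pow, 0)).and
    (((⟨1 + 2 * t, -2, 0, 0⟩ : LinForm).recognizable (.ge, 1)).and
    ((recognizable_eq ⟨0, 0, 1, 0⟩ κ).and ((recognizable_port_eq p).and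
      (recognizable_eq ⟨-a + b * t, -b, 0, 1⟩ 0)))))).congr fun τ => ?_
  simp only [LinForm.Holds, LinForm.eval]
  constructor
  · rintro ⟨⟨m, hm⟩, ⟨j, hj⟩, hlt, hk, hp, hw⟩
    have hg : (τ.gate : ℤ) = t * τ.n + 2 ^ j := by linarith
    refine ⟨m, hm, j, ?_, by exact_mod_cast hg, by exact_mod_cast (by linarith : (τ.kind : ℤ) = κ),
      hp, ?_⟩
    · rw [hg, hm] at hlt
      push_cast at hlt
      have h : (2 : ℤ) ^ j < 2 ^ m := by
        have := pow_succ (2 : ℤ) m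
        linarith
      exact (pow_lt_pow_iff_right₀ (one_lt_two)).1 h
    · have : (τ.wire : ℤ) = a * τ.n + b * 2 ^ j := by
        rw [hg] at hw
        linarith
      exact_mod_cast this
  · rintro ⟨m, hm, j, hj, hg, hk, hp, hw⟩
    have hg' : (τ.gate : ℤ) = t * τ.n + 2 ^ j := by exact_mod_cast hg
    have hw' : (τ.wire : ℤ) = a * τ.n + b * 2 ^ j := by exact_mod_cast hw
    have hlt : (2 : ℤ) ^ j < 2 ^ m := pow_lt_pow_right₀ one_lt_two hj
    have hm' : (τ.n : ℤ) = 2 * 2 ^ m := by rw [hm, pow_succ]; push_cast; ring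
    refine ⟨⟨m, hm⟩, ⟨j, by rw [hg']; ring⟩, ?_, by rw [hk]; ring, hp, by rw [hg', hw']; ring⟩
    rw [hg']
    have : (1 : ℤ) ≤ τ.n - 2 * 2 ^ j := by rw [hm']; linarith
    linarith

/-- The query concerns a query gate. -/
theorem recognizable_query (t a : ℕ) : Recognizable fun τ =>
    ∃ m, τ.n = 2 ^ (m + 1) ∧ τ.gate = t * τ.n ∧ τ.kind = 5 ∧
      (τ.port = 0 ∧ τ.wire = τ.n ∨
        (∃ j < m, τ.port = j + 1 ∧ τ.wire = a * τ.n + 2 ^ (j + 1)) ∨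
        τ.port = m + 1 ∧ τ.wire = 2 * τ.n) := by
  -- Ports of ordinary address bits are those with `wire - a * n = 2 ^ port` and `2 ≤ 2 ^ port < n`;
  -- the top address qubit is at the port with `2 ^ port = n`.
  refine (recognizable_isPow.and ((recognizable_eq ⟨-t, 1, 0, 0⟩ 0).and
    ((recognizable_eq ⟨0, 0, 1, 0⟩ 5).and
      (((recognizable_port_eq 0).and (recognizable_eq ⟨-1, 0, 0, 1⟩ 0)).or
      ((((⟨-a, 0, 0, 1⟩ : LinForm).recognizable (.port, 0)).and
        (((⟨-a, 0, 0, 1⟩ : LinForm).recognizable (.ge, 2)).and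
          ((⟨1 + a, 0, 0, -1⟩ : LinForm).recognizable (.ge, 1)))).or
      (((⟨1, 0, 0, 0⟩ : LinForm).recognizable (.port, 0)).and
        (recognizable_eq ⟨-2, 0, 0, 1⟩ 0))))))).congr fun τ => ?_
  simp only [LinForm.Holds, LinForm.eval]
  constructor
  · rintro ⟨⟨m, hm⟩, hg, hk, hw⟩
    refine ⟨m, hm, by zify; linarith, by zify; linarith, ?_⟩
    rcases hw with ⟨hp, hw⟩ | ⟨hp, h2, h1⟩ | ⟨hp, hw⟩
    · exact Or.inl ⟨hp, by zify; linarith⟩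
    · refine Or.inr (Or.inl ?_)
      have hw : (τ.wire : ℤ) = a * τ.n + 2 ^ τ.port := by linarith
      rw [hw] at h2 h1
      obtain ⟨j, hj⟩ : ∃ j, τ.port = j + 1 := by
        rcases h : τ.port with _ | j
        · rw [h, pow_zero] at h2
          linarith
        · exact ⟨j, rfl⟩
      refine ⟨j, ?_, hj, ?_⟩
      · have h : (2 : ℤ) ^ (j + 1) < 2 ^ (m + 1) := by
          rw [hm] at h1
          rw [← hj]
          push_cast at h1
          linarith
        have := (pow_lt_pow_iff_right₀ (one_lt_two)).1 h
        omega
      · rw [← hj]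
        exact_mod_cast hw
    · refine Or.inr (Or.inr ⟨?_, by zify; linarith⟩)
      have h : 2 ^ (m + 1) = 2 ^ τ.port := by
        rw [← hm]
        zify
        linarith
      exact (Nat.pow_right_injective le_rfl h).symm
  · rintro ⟨m, hm, hg, hk, hw⟩
    zify at hg hk
    refine ⟨⟨m, hm⟩, by linarith, by linarith, ?_⟩
    rcases hw with ⟨hp, hw⟩ | ⟨j, hj, hp, hw⟩ | ⟨hp, hw⟩
    · exact Or.inl ⟨hp, by rw [hw]; ring⟩
    · refine Or.inr (Or.inl ?_)
      have hw' : (τ.wire : ℤ) = a * τ.n + 2 ^ (j + 1) := by exact_mod_cast hw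
      have hlt : (2 : ℤ) ^ (j + 1) < 2 ^ (m + 1) := pow_lt_pow_right₀ one_lt_two (by omega)
      have hm' : (τ.n : ℤ) = 2 ^ (m + 1) := by exact_mod_cast hm
      have h1 : (1 : ℤ) ≤ 2 ^ j := one_le_pow₀ one_le_two
      have h2 := pow_succ (2 : ℤ) j
      rw [hw', hp]
      refine ⟨by ring, by linarith, ?_⟩
      have : (1 : ℤ) ≤ τ.n - 2 ^ (j + 1) := by rw [hm']; linarith
      linarith
    · refine Or.inr (Or.inr ⟨?_, by rw [hw]; push_cast; ring⟩)
      rw [hm, hp]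
      push_cast
      ring

theorem getElem?_cons_eq_some {a w i : ℕ} {l : List ℕ} :
    (a :: l)[i]? = some w ↔ (i = 0 ∧ w = a) ∨ ∃ i', i = i' + 1 ∧ l[i']? = some w := by
  cases i <;> simp [eq_comm]

theorem queryGate_wires {R m : ℕ} {r : Fin R} {i w : ℕ} :
    (queryGate R m r).wires[i]? = some w ↔
      (i = 0 ∧ w = 2 ^ (m + 1) ∨
        (∃ j < m, i = j + 1 ∧ w = (3 + 2 * r) * 2 ^ (m + 1) + 2 ^ (j + 1)) ∨
        i = m + 1 ∧ w = 2 * 2 ^ (m + 1)) := by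
  have hc : Nat.clog 2 (2 ^ (m + 1)) = m + 1 := Nat.clog_pow 2 (m + 1) one_lt_two
  simp only [queryGate, QGate.wires, getElem?_cons_eq_some, List.getElem?_ofFn,
    Option.dite_none_right_eq_some, Option.some.injEq]
  have ht : ((Wire.target : Wire R m).fin : ℕ) = 2 ^ (m + 1) := by
    simp [Wire.fin, Wire.num, Wire.tag, Wire.low]
  rw [ht]
  refine or_congr Iff.rfl ?_
  constructor
  · rintro ⟨j, rfl, hj, rfl⟩
    rw [hc] at hj
    rcases Nat.lt_succ_iff_lt_or_eq.1 hj with h | rfl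
    · left
      refine ⟨j, h, rfl, ?_⟩
      simp [Wire.fin, Wire.address, h, Wire.num, Wire.tag, Wire.low]
    · right
      refine ⟨rfl, ?_⟩
      simp [Wire.fin, Wire.address, Wire.num, Wire.tag, Wire.low]
  · rintro (⟨j, hj, rfl, rfl⟩ | ⟨rfl, rfl⟩)
    · refine ⟨j, rfl, by omega, ?_⟩
      simp [Wire.fin, Wire.address, hj, Wire.num, Wire.tag, Wire.low]
    · refine ⟨m, rfl, by omega, ?_⟩
      simp [Wire.fin, Wire.address, Wire.num, Wire.tag, Wire.low]

theorem Layer.connected_singleton {R : ℕ} {t : ℕ} {ℓ : Layer R}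
    {γ : (m : ℕ) → QGate (2 ^ (m + 1)) ((2 * R + 3) * 2 ^ (m + 1))}
    (h : ∀ m, ℓ.gates m = [(0, γ m)]) (τ : ConnQuery) :
    ℓ.Connected t τ ↔ ∃ m, τ.n = 2 ^ (m + 1) ∧ τ.gate = t * τ.n ∧ (γ m).kind = τ.kind ∧
      (γ m).wires[τ.port]? = some τ.wire := by
  refine exists_congr fun m => and_congr_right fun hm => ?_
  simp only [h, List.mem_singleton, Prod.mk.injEq, hm]
  constructor
  · rintro ⟨_, hg, _, ⟨rfl, rfl⟩, hk, hw⟩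
    exact ⟨hg, hk, hw⟩
  · rintro ⟨hg, hk, hw⟩
    exact ⟨0, hg, _, ⟨rfl, rfl⟩, hk, hw⟩

theorem Layer.connected_ranged {R : ℕ} {t : ℕ} {ℓ : Layer R}
    {γ : (m : ℕ) → Fin m → QGate (2 ^ (m + 1)) ((2 * R + 3) * 2 ^ (m + 1))}
    (h : ∀ m, ℓ.gates m = (List.finRange m).map fun j => (2 ^ j.1, γ m j)) (τ : ConnQuery) :
    ℓ.Connected t τ ↔ ∃ m, τ.n = 2 ^ (m + 1) ∧ ∃ j : Fin m, τ.gate = t * τ.n + 2 ^ j.1 ∧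
      (γ m j).kind = τ.kind ∧ (γ m j).wires[τ.port]? = some τ.wire := by
  refine exists_congr fun m => and_congr_right fun hm => ?_
  simp only [h, List.mem_map, List.mem_finRange, true_and, Prod.mk.injEq, hm]
  constructor
  · rintro ⟨_, hg, _, ⟨j, rfl, rfl⟩, hk, hw⟩
    exact ⟨j, hg, hk, hw⟩
  · rintro ⟨j, hg, hk, hw⟩
    exact ⟨_, hg, _, ⟨j, rfl, rfl⟩, hk, hw⟩

theorem Layer.recognizable_of_unary {R t κ a b : ℕ} {ℓ : Layer R}
    {γ : (m : ℕ) → QGate (2 ^ (m + 1)) ((2 * R + 3) * 2 ^ (m + 1))} {w : (m : ℕ) → ℕ}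
    (h : ∀ m, ℓ.gates m = [(0, γ m)]) (hκ : ∀ m, (γ m).kind = κ) (hγ : ∀ m, (γ m).wires = [w m])
    (hw : ∀ m, 2 * w m = a * 2 ^ (m + 1) + b) : Recognizable (ℓ.Connected t) := by
  refine (recognizable_single t κ 0 a b).congr fun τ => ?_
  rw [Layer.connected_singleton h]
  simp only [hκ, hγ, getElem?_cons_eq_some, List.getElem?_nil, reduceCtorEq, and_false,
    exists_false, or_false]
  constructor
  · rintro ⟨⟨m, hm⟩, hg, hk, hp, hw'⟩
    exact ⟨m, hm, hg, hk.symm, hp, by have := hw m; rw [← hm] at this; omega⟩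
  · rintro ⟨m, hm, hg, hk, hp, hw'⟩
    exact ⟨⟨m, hm⟩, hg, hk.symm, hp, by rw [hw', hw, hm]⟩

theorem Layer.recognizable_of_cnot {R t κ a b a' b' : ℕ} {ℓ : Layer R}
    {γ : (m : ℕ) → QGate (2 ^ (m + 1)) ((2 * R + 3) * 2 ^ (m + 1))} {w w' : (m : ℕ) → ℕ}
    (h : ∀ m, ℓ.gates m = [(0, γ m)]) (hκ : ∀ m, (γ m).kind = κ)
    (hγ : ∀ m, (γ m).wires = [w m, w' m])
    (hw : ∀ m, 2 * w m = a * 2 ^ (m + 1) + b) (hw' : ∀ m, 2 * w' m = a' * 2 ^ (m + 1) + b') :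
    Recognizable (ℓ.Connected t) := by
  refine ((recognizable_single t κ 0 a b).or (recognizable_single t κ 1 a' b')).congr fun τ => ?_
  rw [Layer.connected_singleton h]
  simp only [hκ, hγ, getElem?_cons_eq_some, List.getElem?_nil, reduceCtorEq, and_false,
    exists_false, or_false]
  constructor
  · rintro (⟨⟨m, hm⟩, hg, hk, hp, hv⟩ | ⟨⟨m, hm⟩, hg, hk, hp, hv⟩)
    · exact ⟨m, hm, hg, hk.symm, Or.inl ⟨hp, by have := hw m; rw [← hm] at this; omega⟩⟩
    · exact ⟨m, hm, hg, hk.symm, Or.inr ⟨0, hp, rfl,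
        by have := hw' m; rw [← hm] at this; omega⟩⟩
  · rintro ⟨m, hm, hg, hk, ⟨hp, hv⟩ | ⟨i, hp, rfl, hv⟩⟩
    · exact Or.inl ⟨⟨m, hm⟩, hg, hk.symm, hp, by rw [hv, hw, hm]⟩
    · exact Or.inr ⟨⟨m, hm⟩, hg, hk.symm, hp, by rw [hv, hw', hm]⟩

theorem Layer.recognizable_of_register {R t κ a : ℕ} {ℓ : Layer R}
    {γ : (m : ℕ) → Fin m → QGate (2 ^ (m + 1)) ((2 * R + 3) * 2 ^ (m + 1))}
    (h : ∀ m, ℓ.gates m = (List.finRange m).map fun j => (2 ^ j.1, γ m j))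
    (hκ : ∀ m j, (γ m j).kind = κ)
    (hγ : ∀ m j, (γ m j).wires = [a * 2 ^ (m + 1) + 2 ^ (j.1 + 1)]) :
    Recognizable (ℓ.Connected t) := by
  refine (recognizable_ranged t κ 0 a 2).congr fun τ => ?_
  rw [Layer.connected_ranged h]
  simp only [hκ, hγ, getElem?_cons_eq_some, List.getElem?_nil, reduceCtorEq, and_false,
    exists_false, or_false]
  refine exists_congr fun m => and_congr_right fun hm => ?_
  constructor
  · rintro ⟨j, hj, hg, hk, hp, hw⟩
    exact ⟨⟨j, hj⟩, hg, hk.symm, hp, by rw [hw, hm, pow_succ' 2 j]⟩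
  · rintro ⟨j, hg, hk, hp, hw⟩
    exact ⟨j, j.2, hg, hk.symm, hp, by rw [hw, hm, pow_succ' 2 j.1]⟩

theorem Layer.recognizable_toffoli {R t : ℕ} (r : Fin R) :
    Recognizable ((Layer.toffoli r).Connected t) := by
  refine ((recognizable_ranged t 4 0 (4 + 2 * r) 1).or ((recognizable_ranged t 4 1 (3 + 2 * r) 2).or
    (recognizable_ranged t 4 2 (4 + 2 * r) 2))).congr fun τ => ?_
  rw [Layer.connected_ranged (fun _ => rfl)]
  simp only [QGate.kind, QGate.wires, getElem?_cons_eq_some, List.getElem?_nil, reduceCtorEq,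
    and_false, exists_false, or_false, Wire.fin, Wire.num, Wire.tag, Wire.low, Fin.val_castSucc,
    Fin.val_succ]
  constructor
  · rintro (⟨m, hm, j, hj, hg, hk, hp, hw⟩ | ⟨m, hm, j, hj, hg, hk, hp, hw⟩ |
      ⟨m, hm, j, hj, hg, hk, hp, hw⟩)
    · exact ⟨m, hm, ⟨j, hj⟩, hg, hk.symm, Or.inl ⟨hp, by rw [hw, hm, one_mul]⟩⟩
    · exact ⟨m, hm, ⟨j, hj⟩, hg, hk.symm, Or.inr ⟨0, hp, Or.inl ⟨rfl, by
        rw [hw, hm, pow_succ' 2 j]⟩⟩⟩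
    · exact ⟨m, hm, ⟨j, hj⟩, hg, hk.symm, Or.inr ⟨1, hp, Or.inr ⟨0, rfl, rfl, by
        rw [hw, hm, pow_succ' 2 j]⟩⟩⟩
  · rintro ⟨m, hm, j, hg, hk, ⟨hp, hw⟩ | ⟨_, hp, ⟨rfl, hw⟩ | ⟨_, rfl, rfl, hw⟩⟩⟩
    · exact Or.inl ⟨m, hm, j, j.2, hg, hk.symm, hp, by rw [hw, hm, one_mul]⟩
    · exact Or.inr (Or.inl ⟨m, hm, j, j.2, hg, hk.symm, hp, by rw [hw, hm, pow_succ' 2 j.1]⟩)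
    · exact Or.inr (Or.inr ⟨m, hm, j, j.2, hg, hk.symm, hp, by rw [hw, hm, pow_succ' 2 j.1]⟩)

theorem Layer.recognizable_query {R t : ℕ} (r : Fin R) :
    Recognizable ((Layer.query r).Connected t) := by
  refine (FourierChecking.recognizable_query t (3 + 2 * r)).congr fun τ => ?_
  rw [Layer.connected_singleton (fun _ => rfl)]
  refine exists_congr fun m => and_congr_right fun hm => and_congr_right fun _ => ?_
  rw [queryGate_wires, hm]
  exact and_congr_left fun _ => eq_comm

theorem Layer.recognizable {R : ℕ} (t : ℕ) (ℓ : Layer R) : Recognizable (ℓ.Connected t) := by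
  cases ℓ with
  | notTarget =>
    exact Layer.recognizable_of_unary (a := 2) (b := 0) (fun _ => rfl) (fun _ => rfl)
      (fun _ => rfl) fun m => by simp [Wire.fin, Wire.num, Wire.tag, Wire.low]
  | hadTarget =>
    exact Layer.recognizable_of_unary (a := 2) (b := 0) (fun _ => rfl) (fun _ => rfl)
      (fun _ => rfl) fun m => by simp [Wire.fin, Wire.num, Wire.tag, Wire.low]
  | notTop =>
    exact Layer.recognizable_of_unary (a := 4) (b := 0) (fun _ => rfl) (fun _ => rfl)
      (fun _ => rfl) fun m => by simp [Wire.fin, Wire.num, Wire.tag, Wire.low]; ring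
  | had r =>
    exact Layer.recognizable_of_register (a := 3 + 2 * r) (fun _ => rfl) (fun _ _ => rfl)
      fun _ _ => rfl
  | query r => exact Layer.recognizable_query r
  | not r =>
    exact Layer.recognizable_of_register (a := 3 + 2 * r) (fun _ => rfl) (fun _ _ => rfl)
      fun _ _ => rfl
  | notChain r =>
    exact Layer.recognizable_of_unary (a := 2 * (4 + 2 * r)) (b := 2) (fun _ => rfl)
      (fun _ => rfl) (fun _ => rfl) fun m => by simp [Wire.fin, Wire.num, Wire.tag, Wire.low]; ring
  | cnotIn r =>
    exact Layer.recognizable_of_cnot (a := 0) (b := 0) (a' := 2 * (4 + 2 * r)) (b' := 2)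
      (fun _ => rfl) (fun _ => rfl) (fun _ => rfl)
      (fun m => by simp [Wire.fin, Wire.num, Wire.tag, Wire.low])
      fun m => by simp [Wire.fin, Wire.num, Wire.tag, Wire.low]; ring
  | toffoli r => exact Layer.recognizable_toffoli r
  | cnotOut r =>
    exact Layer.recognizable_of_cnot (a := 2 * (4 + 2 * r) + 1) (b := 0) (a' := 0) (b' := 0)
      (fun _ => rfl) (fun _ => rfl) (fun _ => rfl)
      (fun m => by simp [Wire.fin, Wire.num, Wire.tag, Wire.low]; ring)
      fun m => by simp [Wire.fin, Wire.num, Wire.tag, Wire.low]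

theorem logTimeUniform_layerFamily (R : ℕ) (p : List (Layer R)) :
    LogTimeUniform (layerFamily R p) := by
  constructor
  · refine ⟨2 * R + 3 + p.length + 1, fun n => ?_⟩
    by_cases h : ∃ m, n = 2 ^ (m + 1)
    · obtain ⟨m, rfl⟩ := h
      rw [layerFamily_two_pow]
      set n := 2 ^ (m + 1) with hn
      -- A constant `a ≤ B` is at most `2 ^ B ≤ (n + 2) ^ B`, and one more factor `n + 2` pays for
      -- `n`.
      have hb : ∀ a ≤ 2 * R + 3 + p.length, a * n ≤ (n + 2) ^ (2 * R + 3 + p.length + 1) := by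
        intro a ha
        rw [pow_succ]
        refine Nat.mul_le_mul (ha.trans (Nat.lt_two_pow_self.le.trans ?_)) (by omega)
        exact Nat.pow_le_pow_left (Nat.le_add_left 2 n) _
      refine ⟨hb _ (by omega), fun g hg => ?_⟩
      obtain ⟨t, low, hl, hg⟩ := mem_layerGates.1 hg
      have h1 := Layer.fst_lt hl
      have h2 := hb (t.1 + 1) (by omega)
      rw [hg]
      rw [Nat.succ_mul] at h2
      exact (Nat.add_lt_add_left h1 _).trans_le h2
    · rw [layerFamily_of_not R p h]
      exact ⟨Nat.one_le_pow _ _ (by omega), fun g hg => absurd hg List.not_mem_nil⟩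
  · refine Recognizable.computableInTime ?_
    refine (Recognizable.exists_lt (P := fun t τ => ∃ h : t < p.length,
      (p.get ⟨t, h⟩).Connected t τ) p.length fun t ht => ?_).congr fun τ =>
        mem_directConnection_layerFamily.symm
    exact (Layer.recognizable t (p.get ⟨t, ht⟩)).congr fun τ => ⟨fun h => ⟨ht, h⟩, fun h => h.2⟩

end FourierChecking

/-! ### Upper bound: the forrelation algorithm and the acceptance probability. -/

namespace FourierChecking

open Function

/-! ### The Hadamard transform -/

/-- The character of `{0,1}^m` with index `u`. -/
def character {m : ℕ} (u v : Fin m → Bool) : ℝ := ∏ j, if u j && v j then -1 else 1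

theorem character_eq_pow {m : ℕ} (u v : Fin m → Bool) :
    character u v = (-1) ^ (∑ i, if u i && v i then 1 else 0 : ℕ) := by
  rw [← Finset.prod_pow_eq_pow_sum]
  exact Finset.prod_congr rfl fun j _ => by split_ifs <;> simp

theorem character_zero_left {m : ℕ} (v : Fin m → Bool) : character (fun _ => false) v = 1 := by
  simp [character]

/-- The Hadamard gate on qubit `j`. -/
noncomputable def hadamardAt {m : ℕ} (j : Fin m) (α : QState m) : QState m := fun u =>
  (α (update u j false) + (if u j then -1 else 1) * α (update u j true)) / (Real.sqrt 2 : ℂ)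

/-- The Hadamard transform. -/
noncomputable def hadamard {m : ℕ} (α : QState m) : QState m :=
  (List.finRange m).foldl (fun α j => hadamardAt j α) α

/-- The kernel of a partial transform is a product over qubits: a sign over `√2` on those already
treated, a Kronecker delta on the others. Appending a qubit replaces one delta by a sign. -/
theorem foldl_hadamardAt {m : ℕ} (l : List (Fin m)) (hl : l.Nodup) (α : QState m)
    (u : Fin m → Bool) : l.foldl (fun α j => hadamardAt j α) α u =
      ∑ v, (∏ j, if j ∈ l then (if u j && v j then -1 else 1) / (Real.sqrt 2 : ℂ)
        else if u j = v j then 1 else 0) * α v := by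
  induction l using List.reverseRecOn generalizing u with
  | nil =>
    simp only [List.foldl_nil, List.not_mem_nil, if_false]
    rw [Finset.sum_eq_single u]
    · simp
    · intro v _ hv
      obtain ⟨j, hj⟩ := Function.ne_iff.1 hv
      rw [Finset.prod_eq_zero (Finset.mem_univ j) (if_neg hj.symm), zero_mul]
    · simp
  | append_singleton l i ih =>
    have hi : i ∉ l := by
      intro h
      exact (List.nodup_append.1 hl).2.2 _ h _ (List.mem_singleton_self _) rfl
    rw [List.foldl_append, List.foldl_cons, List.foldl_nil]
    simp only [hadamardAt, ih (List.nodup_append.1 hl).1, Finset.mul_sum]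
    rw [← Finset.sum_add_distrib, Finset.sum_div]
    refine Finset.sum_congr rfl fun v _ => ?_
    have key : ∀ b : Bool, (∏ j, if j ∈ l then
        (if (update u i b) j && v j then -1 else 1) / (Real.sqrt 2 : ℂ)
          else if (update u i b) j = v j then 1 else 0) = (if b = v i then 1 else 0) *
        ∏ j ∈ Finset.univ.erase i, if j ∈ l then
          (if u j && v j then -1 else 1) / (Real.sqrt 2 : ℂ) else if u j = v j then 1 else 0 := by
      intro b
      rw [← Finset.mul_prod_erase _ _ (Finset.mem_univ i), if_neg hi, update_self]
      congr 1
      refine Finset.prod_congr rfl fun j hj => ?_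
      rw [update_of_ne (Finset.ne_of_mem_erase hj)]
    rw [key, key, ← Finset.mul_prod_erase _ _ (Finset.mem_univ i)]
    have hp : (∏ j ∈ Finset.univ.erase i, if j ∈ l ++ [i] then
          (if u j && v j then -1 else 1) / (Real.sqrt 2 : ℂ) else if u j = v j then 1 else 0) =
        ∏ j ∈ Finset.univ.erase i, if j ∈ l then
          (if u j && v j then -1 else 1) / (Real.sqrt 2 : ℂ) else if u j = v j then 1 else 0 := by
      refine Finset.prod_congr rfl fun j hj => ?_
      have : j ∈ l ++ [i] ↔ j ∈ l := by simp [Finset.ne_of_mem_erase hj]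
      simp only [this]
    rw [hp]
    have hmem : i ∈ l ++ [i] := by simp
    generalize (∏ j ∈ Finset.univ.erase i, if j ∈ l then
      (if u j && v j then -1 else 1) / (Real.sqrt 2 : ℂ) else if u j = v j then 1 else 0) = c
    simp only [hmem, if_true]
    cases u i <;> cases v i <;> simp <;> ring

theorem hadamard_apply {m : ℕ} (α : QState m) (u : Fin m → Bool) :
    hadamard α u = (1 / (Real.sqrt 2 : ℂ)) ^ m * ∑ v, (character u v : ℂ) * α v := by
  rw [hadamard, foldl_hadamardAt _ (List.nodup_finRange m), Finset.mul_sum]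
  refine Finset.sum_congr rfl fun v _ => ?_
  simp only [List.mem_finRange, if_true, Finset.prod_div_distrib, Finset.prod_const,
    Finset.card_univ, Fintype.card_fin, character]
  have : ((∏ j, if (u j && v j) = true then (-1 : ℝ) else 1 : ℝ) : ℂ) =
      ∏ j, if (u j && v j) = true then (-1 : ℂ) else 1 := by
    rw [Complex.ofReal_prod]
    exact Finset.prod_congr rfl fun j _ => by split_ifs <;> simp
  rw [this]
  ring

/-- The basis state that is flipped at qubit `j`. -/
def flipAt {ι : Type*} [DecidableEq ι] (j : ι) (u : ι → Bool) : ι → Bool := update u j (!(u j))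

theorem flipAt_involutive {ι : Type*} [DecidableEq ι] (j : ι) : Involutive (flipAt j) := by
  intro u
  funext i
  by_cases h : i = j
  · subst h
    simp [flipAt]
  · simp [flipAt, h]

/-- Pairing each basis state with its flip at `j` reduces the claim to the parallelogram law. -/
theorem sum_norm_sq_hadamardAt {m : ℕ} (j : Fin m) (α : QState m) :
    ∑ u, ‖hadamardAt j α u‖ ^ 2 = ∑ u, ‖α u‖ ^ 2 := by
  have key : ∀ F : (Fin m → Bool) → ℝ, 2 * ∑ u, F u = ∑ u, (F u + F (flipAt j u)) := by
    intro F
    rw [Finset.sum_add_distrib, two_mul]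
    congr 1
    exact (Equiv.sum_comp (flipAt_involutive j).toPerm F).symm
  refine mul_left_cancel₀ (two_ne_zero (α := ℝ)) ?_
  rw [key, key]
  refine Finset.sum_congr rfl fun u _ => ?_
  have h2 : ‖(Real.sqrt 2 : ℂ)‖ ^ 2 = 2 := by
    rw [Complex.norm_real, Real.norm_of_nonneg (Real.sqrt_nonneg 2), Real.sq_sqrt zero_le_two]
  have hpl : ∀ x y : ℂ, ‖x + y‖ ^ 2 + ‖x - y‖ ^ 2 = 2 * (‖x‖ ^ 2 + ‖y‖ ^ 2) := by
    intro x y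
    have := parallelogram_law_with_norm ℝ x y
    nlinarith
  have hu : ∀ b, u j = b → update u j b = u := by
    rintro _ rfl
    exact update_eq_self j u
  have hf : ∀ b, u j = b → flipAt j u = update u j (!b) := by
    rintro _ rfl
    rfl
  have hp := hpl (α (update u j false)) (α (update u j true))
  cases h : u j
  · rw [hf _ h]
    simp only [hadamardAt, h, update_idem, update_self, norm_div, div_pow, h2, Bool.not_false,
      if_true, Bool.false_eq_true, if_false]
    rw [hu _ h] at *
    rw [one_mul, neg_one_mul, ← sub_eq_add_neg]
    linarith
  · rw [hf _ h]
    simp only [hadamardAt, h, update_idem, update_self, norm_div, div_pow, h2, Bool.not_true,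
      if_true, Bool.false_eq_true, if_false]
    rw [hu _ h] at *
    rw [one_mul, neg_one_mul, ← sub_eq_add_neg]
    linarith

theorem sum_norm_sq_hadamard {m : ℕ} (α : QState m) :
    ∑ u, ‖hadamard α u‖ ^ 2 = ∑ u, ‖α u‖ ^ 2 := by
  rw [hadamard]
  induction List.finRange m generalizing α with
  | nil => rfl
  | cons j l ih => rw [List.foldl_cons, ih, sum_norm_sq_hadamardAt]

/-! ### One run of the forrelation algorithm -/

/-- The state in which all qubits are `0`. -/
noncomputable def zeroState (m : ℕ) : QState m := fun u => if u = fun _ => false then 1 else 0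

/-- The phase oracle of a function with values `±1`. -/
noncomputable def phaseOracle {m : ℕ} (f : (Fin m → Bool) → ℤˣ) (α : QState m) : QState m :=
  fun u => ((f u : ℤ) : ℂ) * α u

/-- The state at the end of a run of the forrelation algorithm. -/
noncomputable def forrelationState {m : ℕ} (f g : (Fin m → Bool) → ℤˣ) : QState m :=
  hadamard (phaseOracle g (hadamard (phaseOracle f (hadamard (zeroState m)))))

theorem norm_units_cast (a : ℤˣ) : ‖((a : ℤ) : ℂ)‖ = 1 := by
  rcases Int.units_eq_one_or a with rfl | rfl <;> simp

theorem sum_norm_sq_forrelationState {m : ℕ} (f g : (Fin m → Bool) → ℤˣ) :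
    ∑ u, ‖forrelationState f g u‖ ^ 2 = 1 := by
  simp only [forrelationState, sum_norm_sq_hadamard, phaseOracle, norm_mul, norm_units_cast,
    one_mul, zeroState]
  rw [Finset.sum_eq_single (fun _ => false)]
  · simp
  · intro u _ hu
    simp [hu]
  · simp

/-- At the zero address the outer transform is a plain sum, and the innermost one prepares a
constant vector. What remains is the double sum over `x` and `y`, with a factor `2 ^ (-m / 2)` from
each of the three transforms. -/
theorem norm_sq_forrelationState_zero {m : ℕ} (f g : (Fin m → Bool) → ℤˣ) :
    ‖forrelationState f g fun _ => false‖ ^ 2 = forrelation f g := by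
  have h0 : ∀ x : Fin m → Bool, hadamard (zeroState m) x =
      (1 / (Real.sqrt 2 : ℂ)) ^ m := by
    intro x
    rw [hadamard_apply]
    simp [character, zeroState]
  have hsum : forrelationState f g (fun _ => false) = (((1 / Real.sqrt 2) ^ m) ^ 3 *
      ∑ x : Fin m → Bool, ∑ y : Fin m → Bool,
        ((f x : ℤ) : ℝ) * character x y * ((g y : ℤ) : ℝ) : ℝ) := by
    rw [forrelationState, hadamard_apply]
    push_cast
    rw [Finset.sum_comm, Finset.mul_sum, Finset.mul_sum]
    refine Finset.sum_congr rfl fun y _ => ?_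
    rw [phaseOracle, hadamard_apply, character_zero_left, Finset.mul_sum, Finset.mul_sum,
      Finset.mul_sum, Finset.mul_sum, Finset.mul_sum]
    refine Finset.sum_congr rfl fun x _ => ?_
    have hc : character y x = character x y := by
      simp only [character, Bool.and_comm]
    rw [hc, phaseOracle, h0]
    push_cast
    ring
  rw [hsum, Complex.norm_real, Real.norm_eq_abs, sq_abs, mul_pow, forrelation]
  congr 1
  · have h2 : (1 / Real.sqrt 2) ^ 2 = (1 / 2 : ℝ) := by
      rw [div_pow, Real.sq_sqrt zero_le_two, one_pow]
    rw [← pow_mul, ← pow_mul, ← pow_mul, (by ring : m * (3 * 2) = 2 * (m * 3)),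
      pow_mul (1 / Real.sqrt 2) 2, h2]
    simp
  · simp only [character_eq_pow]

theorem forrelation_le_one {m : ℕ} (f g : (Fin m → Bool) → ℤˣ) : forrelation f g ≤ 1 := by
  rw [← norm_sq_forrelationState_zero, ← sum_norm_sq_forrelationState f g]
  exact Finset.single_le_sum (f := fun u => ‖forrelationState f g u‖ ^ 2)
    (fun u _ => by positivity) (Finset.mem_univ _)

end FourierChecking

namespace FourierChecking

open Function

/-! ### The quantum part of the circuits -/

section

variable {R m : ℕ}

/-- The content of the address register of copy `r`. -/
def addrReg (r : Fin R) (s : Fin ((2 * R + 3) * 2 ^ (m + 1)) → Bool) : Fin m → Bool :=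
  fun j => s (Wire.addr r j).fin

theorem addrReg_update_addr (r : Fin R) (s : Fin ((2 * R + 3) * 2 ^ (m + 1)) → Bool) (j : Fin m)
    (b : Bool) : addrReg r (update s (Wire.addr r j).fin b) = update (addrReg r s) j b := by
  funext i
  by_cases h : i = j
  · subst h
    simp [addrReg]
  · rw [update_of_ne h]
    exact update_of_ne (Wire.fin_ne (by simpa using h)) _ _

theorem addrReg_update_of_ne (r : Fin R) (s : Fin ((2 * R + 3) * 2 ^ (m + 1)) → Bool)
    {w : Wire R m} (hw : ∀ j, Wire.addr r j ≠ w) (b : Bool) :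
    addrReg r (update s w.fin b) = addrReg r s :=
  funext fun j => update_of_ne (Wire.fin_ne (hw j)) _ _

/-- The action of a layer on states. -/
noncomputable def Layer.run (inp : Fin (2 ^ (m + 1)) → Bool) (ℓ : Layer R)
    (ψ : QState ((2 * R + 3) * 2 ^ (m + 1))) : QState ((2 * R + 3) * 2 ^ (m + 1)) :=
  (ℓ.gates m).foldl (fun ψ g => g.2.apply inp ψ) ψ

theorem foldl_apply_flatMap (p : List (Layer R)) (inp : Fin (2 ^ (m + 1)) → Bool)
    (ψ : QState ((2 * R + 3) * 2 ^ (m + 1))) :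
    (p.flatMap fun ℓ => (ℓ.gates m).map Prod.snd).foldl (fun ψ γ => γ.apply inp ψ) ψ =
      p.foldl (fun ψ ℓ => ℓ.run inp ψ) ψ := by
  rw [List.foldl_flatMap]
  simp only [List.foldl_map]
  rfl

theorem layerCircuit_finalState (p : List (Layer R)) (inp : Fin (2 ^ (m + 1)) → Bool) :
    (layerCircuit R m p).finalState inp =
      p.foldl (fun ψ ℓ => ℓ.run inp ψ) (zeroState ((2 * R + 3) * 2 ^ (m + 1))) := by
  have h : ∀ ψ : QState ((2 * R + 3) * 2 ^ (m + 1)),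
      (layerGates R m p).foldl (fun ψ g => g.2.apply inp ψ) ψ =
        p.foldl (fun ψ ℓ => ℓ.run inp ψ) ψ := by
    intro ψ
    have e : (layerGates R m p).foldl (fun ψ g => g.2.apply inp ψ) ψ =
        ((layerGates R m p).map Prod.snd).foldl (fun ψ γ => γ.apply inp ψ) ψ := by
      rw [List.foldl_map]
    rw [e, layerGates_map_snd, foldl_apply_flatMap]
  exact h _

/-- The factor `B` describes all other qubits and plays the role of a tensor factor, since it does
not depend on the register of copy `r`. -/
theorem Layer.run_had (inp : Fin (2 ^ (m + 1)) → Bool) (r : Fin R)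
    {B : QState ((2 * R + 3) * 2 ^ (m + 1))}
    (hB : ∀ s j b, B (update s (Wire.addr r j).fin b) = B s) (α : QState m) :
    (Layer.had r).run inp (fun s => B s * α (addrReg r s)) =
      fun s => B s * hadamard α (addrReg r s) := by
  simp only [Layer.run, Layer.gates, List.foldl_map, hadamard]
  induction List.finRange m generalizing α with
  | nil => rfl
  | cons j l ih =>
    rw [List.foldl_cons, List.foldl_cons, ← ih]
    congr 1
    funext s
    simp only [QGate.apply, hB, addrReg_update_addr, hadamardAt]
    have : s (Wire.addr r j).fin = addrReg r s j := rfl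
    rw [this]
    ring

/-- The top qubit is the most significant address bit; it shifts the query by `2 ^ m`, from the
table of `f` to that of `g`. -/
theorem ofBits_address (r : Fin R) (s : Fin ((2 * R + 3) * 2 ^ (m + 1)) → Bool) :
    Nat.ofBits (fun j : Fin (Nat.clog 2 (2 ^ (m + 1))) =>
      s (Wire.address r j.1 : Wire R m).fin) =
        (if s (Wire.top : Wire R m).fin then 2 ^ m else 0) + Nat.ofBits (addrReg r s) := by
  have hc : Nat.clog 2 (2 ^ (m + 1)) = m + 1 := Nat.clog_pow 2 (m + 1) one_lt_two
  have hlt : Nat.ofBits (addrReg r s) < 2 ^ m := Nat.ofBits_lt_two_pow _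
  refine Nat.eq_of_testBit_eq fun i => ?_
  rcases lt_trichotomy i m with h | h | h
  · rw [Nat.testBit_ofBits_lt _ _ (by omega)]
    have e : s (Wire.address r i : Wire R m).fin = (Nat.ofBits (addrReg r s)).testBit i := by
      rw [Nat.testBit_ofBits_lt _ _ h, Wire.address, dif_pos h]
      rfl
    dsimp only
    rw [e]
    split_ifs
    · rw [Nat.testBit_two_pow_add_gt h]
    · rw [Nat.zero_add]
  · subst h
    rw [Nat.testBit_ofBits_lt _ _ (by omega)]
    have e : (Wire.address r i : Wire R i) = Wire.top := by
      rw [Wire.address, dif_neg (lt_irrefl _)]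
    dsimp only
    rw [e]
    split_ifs with h
    · rw [Nat.testBit_two_pow_add_eq, Nat.testBit_ofBits_ge _ _ le_rfl, h]
      rfl
    · rw [Nat.zero_add, Nat.testBit_ofBits_ge _ _ le_rfl]
      simpa using h
  · rw [Nat.testBit_ofBits_ge _ _ (by omega), Nat.testBit_lt_two_pow]
    refine lt_of_lt_of_le ?_ (Nat.pow_le_pow_right two_pos h)
    rw [Nat.pow_succ]
    split_ifs <;> omega

/-- Phase kickback: `B` changes sign when the target is flipped, so a query that flips the target on
input bit `1` multiplies by the value of the function. -/
theorem Layer.run_query (inp : Fin (2 ^ (m + 1)) → Bool) (r : Fin R)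
    {B : QState ((2 * R + 3) * 2 ^ (m + 1))}
    (hB : ∀ s, B (flipAt (Wire.target : Wire R m).fin s) = -B s) {b : Bool}
    (hb : ∀ s, B s ≠ 0 → s (Wire.top : Wire R m).fin = b) (α : QState m) :
    (Layer.query r).run inp (fun s => B s * α (addrReg r s)) = fun s => B s *
      phaseOracle (truthTable m (if b then 2 ^ m else 0) inp) α (addrReg r s) := by
  funext s
  rw [phaseOracle]
  simp only [Layer.run, Layer.gates, List.foldl_cons, List.foldl_nil, queryGate, QGate.apply,
    ofBits_address]
  rw [addrReg_update_of_ne r s (by simp)]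
  -- The top qubit is known only where `B` is nonzero. Elsewhere antisymmetry makes `B` vanish at
  -- the flipped state as well, so both sides are zero.
  by_cases h0 : B s = 0
  · have h1 : ∀ c, B (update s (Wire.target : Wire R m).fin
        (xor (s (Wire.target : Wire R m).fin) c)) = 0 := by
      intro c
      cases c
      · rw [Bool.xor_false, update_eq_self, h0]
      · rw [Bool.xor_true]
        exact (hB s).trans (by rw [h0, neg_zero])
    rw [h1, h0, zero_mul, zero_mul]
  · rw [hb s h0, truthTable]
    cases readBit inp ((if b then 2 ^ m else 0) + Nat.ofBits (addrReg r s))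
    · rw [Bool.xor_false, update_eq_self]
      simp
    · have := hB s
      rw [flipAt] at this
      rw [Bool.xor_true, this]
      simp

/-- The indicator function of the states whose last address qubit is `b`. -/
noncomputable def topIs (b : Bool) : QState ((2 * R + 3) * 2 ^ (m + 1)) :=
  fun s => if s (Wire.top : Wire R m).fin = b then 1 else 0

theorem Layer.run_notTop (inp : Fin (2 ^ (m + 1)) → Bool) (r : Fin R)
    {B : QState ((2 * R + 3) * 2 ^ (m + 1))}
    (hB : ∀ s b, B (update s (Wire.top : Wire R m).fin b) = B s) (b : Bool) (α : QState m) :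
    (Layer.notTop : Layer R).run inp (fun s => B s * topIs b s * α (addrReg r s)) =
      fun s => B s * topIs (!b) s * α (addrReg r s) := by
  funext s
  simp only [Layer.run, Layer.gates, List.foldl_cons, List.foldl_nil, QGate.apply, hB, topIs,
    addrReg_update_of_ne r s (w := Wire.top) (by simp), update_self]
  congr 2
  cases s (Wire.top : Wire R m).fin <;> cases b <;> rfl

/-- A run of the forrelation algorithm on the register of copy `r`. -/
theorem run_copy (inp : Fin (2 ^ (m + 1)) → Bool) (r : Fin R)
    {B : QState ((2 * R + 3) * 2 ^ (m + 1))}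
    (hB : ∀ s j b, B (update s (Wire.addr r j).fin b) = B s)
    (hB' : ∀ s b, B (update s (Wire.top : Wire R m).fin b) = B s)
    (hB'' : ∀ s, B (flipAt (Wire.target : Wire R m).fin s) = -B s) :
    [Layer.had r, .query r, .had r, .notTop, .query r, .notTop, .had r].foldl
      (fun ψ ℓ => ℓ.run inp ψ)
      (fun s => B s * topIs false s * zeroState m (addrReg r s)) =
      fun s => B s * topIs false s *
        forrelationState (truthTable m 0 inp) (truthTable m (2 ^ m) inp) (addrReg r s) := by
  have h1 : ∀ b : Bool, ∀ s j c, B (update s (Wire.addr r j).fin c) *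
      topIs b (update s (Wire.addr r j).fin c) = B s * topIs b s := by
    intro b s j c
    rw [hB, topIs, topIs, update_of_ne (Wire.fin_ne (by simp))]
  have h2 : ∀ b : Bool, ∀ s, B (flipAt (Wire.target : Wire R m).fin s) *
      topIs b (flipAt (Wire.target : Wire R m).fin s) = -(B s * topIs b s) := by
    intro b s
    rw [hB'', topIs, topIs, flipAt, update_of_ne (Wire.fin_ne (by simp)), neg_mul]
  have h3 : ∀ b : Bool, ∀ s : Fin ((2 * R + 3) * 2 ^ (m + 1)) → Bool, B s * topIs b s ≠ 0 →
      s (Wire.top : Wire R m).fin = b := by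
    intro b s h
    by_contra hne
    rw [topIs, if_neg hne, mul_zero] at h
    exact h rfl
  simp only [List.foldl_cons, List.foldl_nil]
  rw [Layer.run_had inp r (h1 false), Layer.run_query inp r (h2 false) (h3 false),
    Layer.run_had inp r (h1 false), Layer.run_notTop inp r hB', Bool.not_false,
    Layer.run_query inp r (h2 true) (h3 true), Layer.run_notTop inp r hB', Bool.not_true,
    Layer.run_had inp r (h1 false)]
  rfl

/-- The runs on all registers. -/
theorem run_copies (inp : Fin (2 ^ (m + 1)) → Bool) {β : QState ((2 * R + 3) * 2 ^ (m + 1))}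
    (hβ : ∀ s r j b, β (update s (Wire.addr r j).fin b) = β s)
    (hβ' : ∀ s b, β (update s (Wire.top : Wire R m).fin b) = β s)
    (hβ'' : ∀ s, β (flipAt (Wire.target : Wire R m).fin s) = -β s)
    (l : List (Fin R)) (hl : l.Nodup) (A : Fin R → QState m)
    (hA : ∀ r ∈ l, A r = zeroState m) :
    (l.flatMap fun r => [Layer.had r, .query r, .had r, .notTop, .query r, .notTop, .had r]).foldl
      (fun ψ ℓ => ℓ.run inp ψ) (fun s => β s * topIs false s * ∏ r, A r (addrReg r s)) =
      fun s => β s * topIs false s * ∏ r, (if r ∈ l then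
        forrelationState (truthTable m 0 inp) (truthTable m (2 ^ m) inp) else A r)
          (addrReg r s) := by
  induction l generalizing A with
  | nil => simp
  | cons r l ih =>
    obtain ⟨hrl, hl⟩ := List.nodup_cons.1 hl
    set F := forrelationState (truthTable m 0 inp) (truthTable m (2 ^ m) inp) with hF
    -- Relative to copy `r`, the factors of the other registers belong to the spectator factor `B`
    -- of `run_copy`.
    have hsplit : ∀ A : Fin R → QState m,
        (fun s : Fin ((2 * R + 3) * 2 ^ (m + 1)) → Bool =>
          β s * topIs false s * ∏ r, A r (addrReg r s)) = fun s =>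
          (β s * ∏ i ∈ Finset.univ.erase r, A i (addrReg i s)) * topIs false s *
            A r (addrReg r s) := by
      intro A
      funext s
      rw [← Finset.mul_prod_erase _ _ (Finset.mem_univ r)]
      ring
    have hprod : ∀ (w : Wire R m), (∀ i, i ≠ r → ∀ j, Wire.addr i j ≠ w) → ∀ s b,
        ∏ i ∈ Finset.univ.erase r, A i (addrReg i (update s w.fin b)) =
          ∏ i ∈ Finset.univ.erase r, A i (addrReg i s) := by
      intro w hw s b
      refine Finset.prod_congr rfl fun i hi => ?_
      rw [addrReg_update_of_ne i s (hw i (Finset.ne_of_mem_erase hi))]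
    rw [List.flatMap_cons, List.foldl_append, hsplit, hA r List.mem_cons_self, run_copy inp r]
    · have hA' : ∀ i ∈ l, update A r F i = zeroState m := by
        intro i hi
        rw [update_of_ne (by rintro rfl; exact hrl hi)]
        exact hA i (List.mem_cons_of_mem r hi)
      have e : (fun s : Fin ((2 * R + 3) * 2 ^ (m + 1)) → Bool =>
          (β s * ∏ i ∈ Finset.univ.erase r, A i (addrReg i s)) * topIs false s *
            F (addrReg r s)) = fun s =>
          β s * topIs false s * ∏ i, update A r F i (addrReg i s) := by
        rw [hsplit]
        funext s
        rw [update_self]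
        congr 3
        refine Finset.prod_congr rfl fun i hi => ?_
        rw [update_of_ne (Finset.ne_of_mem_erase hi)]
      rw [e, ih hl _ hA']
      funext s
      congr 1
      refine Finset.prod_congr rfl fun i _ => ?_
      by_cases hi : i = r
      · subst hi
        simp [hrl]
      · simp [hi]
    · intro s j b
      rw [hβ, hprod _ (by intro i hi j' h; exact hi (by simpa using (Wire.addr.inj h).1))]
    · intro s b
      rw [hβ', hprod _ (by simp)]
    · intro s
      rw [hβ'', flipAt, hprod _ (by simp), neg_mul]

/-- All qubits other than the target, the last address qubit and the address registers are `0`. -/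
def Idle (s : Fin ((2 * R + 3) * 2 ^ (m + 1)) → Bool) : Prop :=
  ∀ i, i ≠ (Wire.target : Wire R m).fin → i ≠ (Wire.top : Wire R m).fin →
    (∀ (r : Fin R) (j : Fin m), i ≠ (Wire.addr r j).fin) → s i = false

open Classical in
/-- The state of the target and of the idle qubits. -/
noncomputable def kickback : QState ((2 * R + 3) * 2 ^ (m + 1)) := fun s =>
  if Idle s then (if s (Wire.target : Wire R m).fin then -1 else 1) / (Real.sqrt 2 : ℂ) else 0

theorem idle_update {s : Fin ((2 * R + 3) * 2 ^ (m + 1)) → Bool} {w : Wire R m}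
    (hw : w = .target ∨ w = .top ∨ ∃ r j, w = .addr r j) (b : Bool) :
    Idle (update s w.fin b) ↔ Idle s := by
  refine forall_congr' fun i => forall_congr' fun h1 => forall_congr' fun h2 =>
    forall_congr' fun h3 => ?_
  rw [update_of_ne]
  rcases hw with rfl | rfl | ⟨r, j, rfl⟩
  exacts [h1, h2, h3 r j]

theorem eq_false_iff {s : Fin ((2 * R + 3) * 2 ^ (m + 1)) → Bool} :
    (s = fun _ => false) ↔ Idle s ∧ s (Wire.target : Wire R m).fin = false ∧
      s (Wire.top : Wire R m).fin = false ∧ ∀ r : Fin R, addrReg r s = fun _ : Fin m => false := by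
  constructor
  · rintro rfl
    exact ⟨fun _ _ _ _ => rfl, rfl, rfl, fun _ => rfl⟩
  · rintro ⟨h1, h2, h3, h4⟩
    funext i
    by_cases ht : i = (Wire.target : Wire R m).fin
    · rw [ht, h2]
    by_cases ht' : i = (Wire.top : Wire R m).fin
    · rw [ht', h3]
    by_cases ha : ∀ (r : Fin R) (j : Fin m), i ≠ (Wire.addr r j).fin
    · exact h1 i ht ht' ha
    · push Not at ha
      obtain ⟨r, j, rfl⟩ := ha
      exact congrFun (h4 r) j

theorem run_prepare (inp : Fin (2 ^ (m + 1)) → Bool) :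
    [Layer.notTarget, .hadTarget].foldl (fun ψ (ℓ : Layer R) => ℓ.run inp ψ)
      (zeroState ((2 * R + 3) * 2 ^ (m + 1))) =
      fun s => kickback s * topIs false s *
        ∏ r : Fin R, zeroState m (addrReg r s) := by
  classical
  funext s
  simp only [List.foldl_cons, List.foldl_nil, Layer.run, Layer.gates, QGate.apply, zeroState,
    eq_false_iff,
    update_self, update_idem]
  have h1 : ∀ b, Idle (update s (Wire.target : Wire R m).fin b) ↔ Idle s :=
    idle_update (Or.inl rfl)
  have h2 : ∀ b, update s (Wire.target : Wire R m).fin b (Wire.top : Wire R m).fin =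
      s (Wire.top : Wire R m).fin := fun b => update_of_ne (Wire.fin_ne (by simp)) _ _
  have h3 : ∀ (r : Fin R) (b : Bool), addrReg r (update s (Wire.target : Wire R m).fin b) =
      (addrReg r s : Fin m → Bool) := fun r b => addrReg_update_of_ne r s (by simp) b
  simp only [h1, h2, h3, Finset.prod_boole, Finset.mem_univ, true_imp_iff, kickback, topIs]
  by_cases hi : Idle s <;> by_cases ht : s (Wire.top : Wire R m).fin = false <;>
    by_cases ha : ∀ r : Fin R, addrReg r s = fun _ : Fin m => false <;>
    simp [hi, ht, ha]

/-- The layers of the program that contain Hadamard gates or queries. -/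
theorem run_quantum (inp : Fin (2 ^ (m + 1)) → Bool) :
    ([Layer.notTarget, .hadTarget] ++ (List.finRange R).flatMap fun r =>
      [Layer.had r, .query r, .had r, .notTop, .query r, .notTop, .had r]).foldl
      (fun ψ (ℓ : Layer R) => ℓ.run inp ψ)
      (zeroState ((2 * R + 3) * 2 ^ (m + 1))) =
      fun s => kickback s * topIs false s * ∏ r : Fin R,
        forrelationState (truthTable m 0 inp) (truthTable m (2 ^ m) inp) (addrReg r s) := by
  rw [List.foldl_append, run_prepare, run_copies inp _ _ _ _ (List.nodup_finRange R)
    (fun _ => zeroState m) fun _ _ => rfl]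
  · simp
  · intro s r j b
    rw [kickback, kickback, idle_update (Or.inr (Or.inr ⟨r, j, rfl⟩)),
      update_of_ne (Wire.fin_ne (by simp))]
  · intro s b
    rw [kickback, kickback, idle_update (Or.inr (Or.inl rfl)),
      update_of_ne (Wire.fin_ne (by simp))]
  · intro s
    rw [kickback, kickback, flipAt, idle_update (Or.inl rfl), update_self]
    split_ifs <;> simp_all <;> ring

end

end FourierChecking

namespace FourierChecking

open Function

/-! ### The classical part of the circuits -/

/-- The action of a NOT, controlled NOT or Toffoli gate on basis states. -/
def QGate.onBasis {n q : ℕ} : QGate n q → (Fin q → Bool) → Fin q → Bool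
  | .x a, s => update s a (!(s a))
  | .cnot a b _, s => update s b (xor (s b) (s a))
  | .ccnot a b c _ _ _, s => update s c (xor (s c) (s a && s b))
  | _, s => s

/-- The gate permutes the basis states. -/
def QGate.IsClassical {n q : ℕ} (γ : QGate n q) : Prop :=
  ∀ (inp : Fin n → Bool) (ψ : QState q), γ.apply inp ψ = fun s => ψ (γ.onBasis s)

theorem QGate.onBasis_involutive {n q : ℕ} (γ : QGate n q) : Involutive γ.onBasis := by
  intro s
  cases γ with
  | x a => simp [onBasis]
  | cnot a b hab => simp [onBasis, update_of_ne hab]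
  | ccnot a b c hab hac hbc => simp [onBasis, update_of_ne hac, update_of_ne hbc]
  | h a => rfl
  | t a => rfl
  | query addr target _ _ => rfl

/-- Classical gates can be moved from the state to the observable: each acts by an involution of the
basis states, along which the sum is reindexed. -/
theorem sum_mul_norm_sq_foldl {n q : ℕ} (inp : Fin n → Bool) (l : List (QGate n q))
    (hl : ∀ γ ∈ l, γ.IsClassical) (F : (Fin q → Bool) → ℝ) (ψ : QState q) :
    ∑ s, F s * ‖l.foldl (fun ψ γ => γ.apply inp ψ) ψ s‖ ^ 2 =
      ∑ s, F (l.foldl (fun s γ => γ.onBasis s) s) * ‖ψ s‖ ^ 2 := by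
  induction l generalizing ψ with
  | nil => rfl
  | cons γ l ih =>
    simp only [List.foldl_cons]
    rw [ih (fun γ' h => hl γ' (List.mem_cons_of_mem γ h)), hl γ List.mem_cons_self inp ψ]
    rw [← Equiv.sum_comp γ.onBasis_involutive.toPerm]
    refine Finset.sum_congr rfl fun s _ => ?_
    simp only [Involutive.coe_toPerm, γ.onBasis_involutive s]

theorem foldl_finRange_induction {S : Type*} {m : ℕ} (P : ℕ → S → Prop) (f : S → Fin m → S)
    {s : S} (h0 : P 0 s) (hstep : ∀ (j : Fin m) s, P j s → P (j + 1) (f s j)) :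
    P m ((List.finRange m).foldl f s) := by
  have key : ∀ k ≤ m, P k (((List.finRange m).take k).foldl f s) := by
    intro k hk
    induction k with
    | zero => simpa using h0
    | succ k ih =>
      rw [List.take_succ_eq_append_getElem (by simpa using hk), List.foldl_append]
      simpa using hstep ⟨k, hk⟩ _ (ih (by omega))
  have := key m le_rfl
  rwa [List.take_of_length_le (by simp)] at this

section

variable {R m : ℕ}

/-- The action of a layer on basis states. -/
def Layer.onBasis (ℓ : Layer R) (s : Fin ((2 * R + 3) * 2 ^ (m + 1)) → Bool) :
    Fin ((2 * R + 3) * 2 ^ (m + 1)) → Bool :=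
  (ℓ.gates m).foldl (fun s g => g.2.onBasis s) s

theorem foldl_onBasis_flatMap (p : List (Layer R))
    (s : Fin ((2 * R + 3) * 2 ^ (m + 1)) → Bool) :
    (p.flatMap fun ℓ => (ℓ.gates m).map Prod.snd).foldl (fun s γ => γ.onBasis s) s =
      p.foldl (fun s ℓ => ℓ.onBasis s) s := by
  rw [List.foldl_flatMap]
  simp only [List.foldl_map]
  rfl

open Classical in
theorem Layer.onBasis_not (r : Fin R) (s : Fin ((2 * R + 3) * 2 ^ (m + 1)) → Bool)
    (w : Wire R m) : (Layer.not r).onBasis s w.fin =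
      if ∃ j, w = .addr r j then !(s w.fin) else s w.fin := by
  have key := foldl_finRange_induction
    (P := fun k (t : Fin ((2 * R + 3) * 2 ^ (m + 1)) → Bool) => ∀ w : Wire R m, t w.fin =
      if ∃ j : Fin m, j.1 < k ∧ w = .addr r j then !(s w.fin) else s w.fin)
    (fun s j => (QGate.x (Wire.addr r j).fin :
      QGate (2 ^ (m + 1)) ((2 * R + 3) * 2 ^ (m + 1))).onBasis s) (s := s) (by simp) (by
        intro j t ht w
        simp only [QGate.onBasis]
        by_cases h : w = .addr r j
        · subst h
          rw [update_self, ht, if_neg, if_pos ⟨j, by omega, rfl⟩]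
          rintro ⟨i, hi, h⟩
          obtain rfl : j = i := by simpa using h
          omega
        · rw [update_of_ne (Wire.fin_ne h), ht]
          congr 1
          refine propext (exists_congr fun i => and_congr_left fun hi => ?_)
          have : i.1 ≠ j := by
            intro e
            exact h (by rw [hi, Fin.ext e])
          omega)
  have e : (Layer.not r).onBasis s = (List.finRange m).foldl
      (fun s j => (QGate.x (Wire.addr r j).fin :
        QGate (2 ^ (m + 1)) ((2 * R + 3) * 2 ^ (m + 1))).onBasis s) s := by
    simp only [Layer.onBasis, Layer.gates, List.foldl_map]
  rw [e, key]
  simp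

theorem Layer.onBasis_toffoli (r : Fin R) (s : Fin ((2 * R + 3) * 2 ^ (m + 1)) → Bool)
    (hs : ∀ j : Fin m, s (Wire.chain r j.succ).fin = false) :
    (Layer.toffoli r).onBasis s (Wire.chain r (Fin.last m)).fin =
        decide (s (Wire.chain r 0 : Wire R m).fin = true ∧ ∀ j : Fin m,
          s (Wire.addr r j).fin = true) ∧
      ∀ w : Wire R m, (∀ j, w ≠ .chain r j) → (Layer.toffoli r).onBasis s w.fin = s w.fin := by
  have key := foldl_finRange_induction
    -- Invariant after `k` gates: chain qubits up to `k` hold the conjunctions of initial segments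
    -- of the address with the first chain qubit, and later ones are still zero.
    (P := fun k (t : Fin ((2 * R + 3) * 2 ^ (m + 1)) → Bool) =>
      (∀ j : Fin (m + 1), t (Wire.chain r j).fin =
        decide (j.1 ≤ k ∧ s (Wire.chain r 0 : Wire R m).fin = true ∧ ∀ i : Fin m, i.1 < j →
          s (Wire.addr r i).fin = true)) ∧
      ∀ w : Wire R m, (∀ j, w ≠ .chain r j) → t w.fin = s w.fin)
    (fun s j => (QGate.ccnot (Wire.chain r j.castSucc).fin (Wire.addr r j).fin
      (Wire.chain r j.succ).fin (Wire.fin_ne (by simp)) (Wire.fin_ne (by simp [Fin.ext_iff]))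
      (Wire.fin_ne (by simp)) : QGate (2 ^ (m + 1)) ((2 * R + 3) * 2 ^ (m + 1))).onBasis s)
    (s := s) (by
        refine ⟨fun j => ?_, fun _ _ => rfl⟩
        rcases Fin.eq_zero_or_eq_succ j with rfl | ⟨j, rfl⟩
        · simp
        · rw [hs]
          simp) (by
        rintro j t ⟨ht, ht'⟩
        simp only [QGate.onBasis]
        refine ⟨fun i => ?_, fun w hw => ?_⟩
        · by_cases h : i = j.succ
          · subst h
            rw [update_self, ht, ht, ht' _ (by simp), Bool.eq_iff_iff]
            simp only [Fin.val_succ, Fin.val_castSucc, Nat.not_succ_le_self, false_and,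
              decide_false, Bool.false_xor, Bool.and_eq_true, decide_eq_true_iff, le_refl,
              true_and]
            constructor
            · rintro ⟨⟨h1, h2⟩, h3⟩
              refine ⟨h1, fun i hi => ?_⟩
              rcases Nat.lt_succ_iff_lt_or_eq.1 hi with hi | hi
              · exact h2 i hi
              · rwa [Fin.ext hi]
            · rintro ⟨h1, h2⟩
              exact ⟨⟨h1, fun i hi => h2 i (by omega)⟩, h2 j (by omega)⟩
          · rw [update_of_ne (Wire.fin_ne (by simpa using h)), ht, decide_eq_decide]
            have : i.1 ≠ j.1 + 1 := fun e => h (Fin.ext e)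
            exact and_congr_left fun _ => by omega
        · rw [update_of_ne (Wire.fin_ne (hw _)), ht' w hw])
  have e : (Layer.toffoli r).onBasis s = (List.finRange m).foldl
      (fun s j => (QGate.ccnot (Wire.chain r j.castSucc).fin (Wire.addr r j).fin
        (Wire.chain r j.succ).fin (Wire.fin_ne (by simp)) (Wire.fin_ne (by simp [Fin.ext_iff]))
        (Wire.fin_ne (by simp)) : QGate (2 ^ (m + 1)) ((2 * R + 3) * 2 ^ (m + 1))).onBasis s)
      s := by
    simp only [Layer.onBasis, Layer.gates, List.foldl_map]
  rw [e]
  refine ⟨?_, key.2⟩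
  rw [key.1, decide_eq_decide]
  simp

theorem Layer.onBasis_notChain (r : Fin R) (s : Fin ((2 * R + 3) * 2 ^ (m + 1)) → Bool) :
    (Layer.notChain r).onBasis s = update s (Wire.chain r 0 : Wire R m).fin
      (!(s (Wire.chain r 0 : Wire R m).fin)) := rfl

theorem Layer.onBasis_cnotIn (r : Fin R) (s : Fin ((2 * R + 3) * 2 ^ (m + 1)) → Bool) :
    (Layer.cnotIn r).onBasis s = update s (Wire.chain r 0 : Wire R m).fin
      (xor (s (Wire.chain r 0 : Wire R m).fin) (s (Wire.out : Wire R m).fin)) := rfl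

theorem Layer.onBasis_cnotOut (r : Fin R) (s : Fin ((2 * R + 3) * 2 ^ (m + 1)) → Bool) :
    (Layer.cnotOut r).onBasis s = update s (Wire.out : Wire R m).fin
      (xor (s (Wire.out : Wire R m).fin) (s (Wire.chain r (Fin.last m) : Wire R m).fin)) := rfl

/-- The layers that test whether the register of copy `r` is zero. -/
theorem onBasis_test (r : Fin R) (s : Fin ((2 * R + 3) * 2 ^ (m + 1)) → Bool)
    (hs : ∀ j, s (Wire.chain r j : Wire R m).fin = false) :
    ([Layer.not r, .notChain r, .cnotIn r, .toffoli r, .cnotOut r].foldl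
        (fun s ℓ => ℓ.onBasis s) s (Wire.out : Wire R m).fin =
      decide (s (Wire.out : Wire R m).fin = true ∨ addrReg r s = fun _ : Fin m => false)) ∧
    ∀ w : Wire R m, w ≠ .out → (∀ j, w ≠ .addr r j) → (∀ j, w ≠ .chain r j) →
      [Layer.not r, .notChain r, .cnotIn r, .toffoli r, .cnotOut r].foldl
        (fun s ℓ => ℓ.onBasis s) s w.fin = s w.fin := by
  classical
  simp only [List.foldl_cons, List.foldl_nil]
  set s₁ := (Layer.not r).onBasis s with hs₁
  have h₁ : ∀ w : Wire R m, s₁ w.fin = if ∃ j, w = .addr r j then !(s w.fin) else s w.fin :=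
    Layer.onBasis_not r s
  -- The chain starts with the negation of `out`, so its end holds `¬ out ∧ zero register`. Adding
  -- this to `out` modulo two gives `out ∨ zero register`, which accumulates a disjunction over the
  -- copies.
  have e : (Layer.cnotIn r).onBasis ((Layer.notChain r).onBasis s₁) =
      update s₁ (Wire.chain r 0 : Wire R m).fin
        (xor (!(s₁ (Wire.chain r 0 : Wire R m).fin)) (s₁ (Wire.out : Wire R m).fin)) := by
    rw [Layer.onBasis_notChain, Layer.onBasis_cnotIn, update_idem, update_self,
      update_of_ne (Wire.fin_ne (w := .out) (w' := .chain r 0) (by simp))]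
  rw [Layer.onBasis_cnotOut, e]
  have hc0 : s₁ (Wire.chain r 0 : Wire R m).fin = false := by rw [h₁, if_neg (by simp), hs]
  have hout : s₁ (Wire.out : Wire R m).fin = s (Wire.out : Wire R m).fin := by
    rw [h₁, if_neg (by simp)]
  rw [hc0, hout]
  set s₂ := update s₁ (Wire.chain r 0 : Wire R m).fin
    (xor (!false) (s (Wire.out : Wire R m).fin)) with hs₂
  have h₂ : ∀ w : Wire R m, w ≠ .chain r 0 → s₂ w.fin = s₁ w.fin :=
    fun w hw => update_of_ne (Wire.fin_ne hw) _ _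
  obtain ⟨hlast, hother⟩ := Layer.onBasis_toffoli r s₂ (by
    intro j
    rw [h₂ _ (by simp [Fin.ext_iff]), h₁, if_neg (by simp), hs])
  constructor
  · rw [update_self, hlast, hother _ (by simp), h₂ _ (by simp), hout]
    have hc : s₂ (Wire.chain r 0 : Wire R m).fin = !(s (Wire.out : Wire R m).fin) := by
      rw [hs₂, update_self, Bool.not_false, Bool.true_xor]
    have ha : (∀ j : Fin m, s₂ (Wire.addr r j).fin = true) ↔ addrReg r s = fun _ => false := by
      rw [funext_iff]
      refine forall_congr' fun j => ?_
      rw [h₂ _ (by simp), h₁, if_pos ⟨j, rfl⟩, addrReg]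
      cases s (Wire.addr r j).fin <;> simp
    rw [hc, Bool.eq_iff_iff]
    cases s (Wire.out : Wire R m).fin <;> simp [ha]
  · intro w hw hwa hwc
    rw [update_of_ne (Wire.fin_ne hw), hother w hwc, h₂ w (hwc 0), h₁, if_neg]
    rintro ⟨j, hj⟩
    exact hwa j hj

theorem onBasis_tests (l : List (Fin R)) (hl : l.Nodup)
    (s : Fin ((2 * R + 3) * 2 ^ (m + 1)) → Bool)
    (hs : ∀ r ∈ l, ∀ j, s (Wire.chain r j : Wire R m).fin = false) :
    (l.flatMap fun r => [Layer.not r, .notChain r, .cnotIn r, .toffoli r, .cnotOut r]).foldl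
        (fun s ℓ => ℓ.onBasis s) s (Wire.out : Wire R m).fin = true ↔
      s (Wire.out : Wire R m).fin = true ∨ ∃ r ∈ l, addrReg r s = fun _ : Fin m => false := by
  induction l generalizing s with
  | nil => simp
  | cons r l ih =>
    obtain ⟨hrl, hl⟩ := List.nodup_cons.1 hl
    obtain ⟨h1, h2⟩ := onBasis_test r s (hs r List.mem_cons_self)
    rw [List.flatMap_cons, List.foldl_append, ih hl]
    · rw [h1, decide_eq_true_iff, or_assoc]
      refine or_congr_right ?_
      simp only [List.mem_cons, exists_eq_or_imp]
      refine or_congr_right (exists_congr fun i => and_congr_right fun hi => ?_)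
      have : addrReg i ([Layer.not r, .notChain r, .cnotIn r, .toffoli r, .cnotOut r].foldl
          (fun s ℓ => ℓ.onBasis s) s) = addrReg i s := by
        funext j
        exact h2 _ (by simp) (by rintro j' h; exact hrl ((Wire.addr.inj h).1 ▸ hi)) (by simp)
      rw [this]
    · intro i hi j
      rw [h2 _ (by simp) (by simp) (by rintro j' h; exact hrl ((Wire.chain.inj h).1 ▸ hi))]
      exact hs i (List.mem_cons_of_mem r hi) j

/-- The basis state with given target bit and address registers and zeros elsewhere. -/
noncomputable def ofRegisters (x : Bool × (Fin R → Fin m → Bool)) :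
    Fin ((2 * R + 3) * 2 ^ (m + 1)) → Bool :=
  Function.extend (Wire.fin : Wire R m → _) (fun w => match w with
    | .target => x.1
    | .addr r j => x.2 r j
    | _ => false) fun _ => false

theorem ofRegisters_fin (x : Bool × (Fin R → Fin m → Bool)) (w : Wire R m) :
    ofRegisters x w.fin = match w with
    | .target => x.1
    | .addr r j => x.2 r j
    | _ => false := Wire.fin_injective.extend_apply _ _ _

theorem addrReg_ofRegisters (x : Bool × (Fin R → Fin m → Bool)) (r : Fin R) :
    addrReg r (ofRegisters x) = x.2 r := funext fun j => ofRegisters_fin x (.addr r j)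

theorem ofRegisters_injective :
    Injective (ofRegisters : Bool × (Fin R → Fin m → Bool) → _) := by
  intro x y h
  refine Prod.ext ?_ (funext fun r => ?_)
  · have := congrFun h (Wire.target : Wire R m).fin
    rwa [ofRegisters_fin, ofRegisters_fin] at this
  · rw [← addrReg_ofRegisters x, h, addrReg_ofRegisters]

theorem idle_ofRegisters (x : Bool × (Fin R → Fin m → Bool)) : Idle (ofRegisters x) := by
  intro i h1 h2 h3
  by_cases h : ∃ w : Wire R m, w.fin = i
  · obtain ⟨w, rfl⟩ := h
    rw [ofRegisters_fin]
    cases w with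
    | target => exact absurd rfl h1
    | addr r j => exact absurd rfl (h3 r j)
    | out => rfl
    | top => rfl
    | chain r j => rfl
  · exact Function.extend_apply' _ _ _ h

theorem mem_range_ofRegisters {s : Fin ((2 * R + 3) * 2 ^ (m + 1)) → Bool} (hs : Idle s)
    (ht : s (Wire.top : Wire R m).fin = false) :
    s ∈ Set.range (ofRegisters : Bool × (Fin R → Fin m → Bool) → _) := by
  refine ⟨(s (Wire.target : Wire R m).fin, fun r => addrReg r s), funext fun i => ?_⟩
  by_cases h : ∃ w : Wire R m, w.fin = i
  · obtain ⟨w, rfl⟩ := h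
    rw [ofRegisters_fin]
    cases w with
    | target => rfl
    | addr r j => rfl
    | top => exact ht.symm
    | out => exact (hs _ (Wire.fin_ne (by simp)) (Wire.fin_ne (by simp))
        fun r j => Wire.fin_ne (by simp)).symm
    | chain r j => exact (hs _ (Wire.fin_ne (by simp)) (Wire.fin_ne (by simp))
        fun r j => Wire.fin_ne (by simp)).symm
  · have e : ofRegisters (s (Wire.target : Wire R m).fin, fun r => addrReg r s) i = false :=
      Function.extend_apply' _ _ _ h
    rw [e]
    push Not at h
    exact (hs i (h _).symm (h _).symm fun r j => (h _).symm).symm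

/-- The acceptance probability of the circuit: some run of the forrelation algorithm accepts. -/
theorem acceptProb_program (inp : Fin (2 ^ (m + 1)) → Bool) :
    (layerCircuit R m (program R)).acceptProb inp = 1 - (1 - inputForrelation m inp) ^ R := by
  classical
  set F := forrelationState (truthTable m 0 inp) (truthTable m (2 ^ m) inp) with hF
  set tests : List (Layer R) := (List.finRange R).flatMap fun r =>
    [.not r, .notChain r, .cnotIn r, .toffoli r, .cnotOut r] with htests
  set ψ : QState ((2 * R + 3) * 2 ^ (m + 1)) := fun s =>
    kickback s * topIs false s * ∏ r : Fin R, F (addrReg r s) with hψ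
  have hfinal : (layerCircuit R m (program R)).finalState inp =
      (tests.flatMap fun ℓ => (ℓ.gates m).map Prod.snd).foldl (fun ψ γ => γ.apply inp ψ) ψ := by
    rw [layerCircuit_finalState, program, List.foldl_append, run_quantum]
    exact (foldl_apply_flatMap tests inp ψ).symm
  have hclass : ∀ γ ∈ tests.flatMap fun ℓ => (ℓ.gates m).map Prod.snd, γ.IsClassical := by
    intro γ hγ
    simp only [htests, List.mem_flatMap, List.mem_finRange, true_and, List.mem_map] at hγ
    obtain ⟨ℓ, ⟨r, hℓ⟩, g, hg, rfl⟩ := hγ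
    simp only [List.mem_cons, List.not_mem_nil, or_false] at hℓ
    rcases hℓ with rfl | rfl | rfl | rfl | rfl <;>
      simp only [Layer.gates, List.mem_singleton, List.mem_map] at hg
    · obtain ⟨j, -, rfl⟩ := hg
      exact fun _ _ => rfl
    · subst hg
      exact fun _ _ => rfl
    · subst hg
      exact fun _ _ => rfl
    · obtain ⟨j, -, rfl⟩ := hg
      exact fun _ _ => rfl
    · subst hg
      exact fun _ _ => rfl
  have hout : (⟨0, (layerCircuit R m (program R)).qubits_pos⟩ :
      Fin ((2 * R + 3) * 2 ^ (m + 1))) = (Wire.out : Wire R m).fin := by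
    simp [Wire.fin, Wire.num, Wire.tag, Wire.low]
  have hbasis : ∀ s : Fin ((2 * R + 3) * 2 ^ (m + 1)) → Bool,
      (tests.flatMap fun ℓ => (ℓ.gates m).map Prod.snd).foldl (fun s γ => γ.onBasis s) s =
        tests.foldl (fun s ℓ => ℓ.onBasis s) s := foldl_onBasis_flatMap tests
  -- The factor `1 / 2` is the weight of either target value; summing over both restores total mass
  -- one.
  have hnorm : ∀ x : Bool × (Fin R → Fin m → Bool),
      ‖ψ (ofRegisters x)‖ ^ 2 = 1 / 2 * ∏ r, ‖F (x.2 r)‖ ^ 2 := by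
    intro x
    have hk : ‖kickback (ofRegisters x)‖ ^ 2 = 1 / 2 := by
      rw [kickback, if_pos (idle_ofRegisters x), norm_div, div_pow, Complex.norm_real,
        Real.norm_of_nonneg (Real.sqrt_nonneg 2), Real.sq_sqrt zero_le_two]
      split_ifs <;> simp
    have ht : topIs false (ofRegisters x) = 1 := by
      rw [topIs, ofRegisters_fin, if_pos rfl]
    simp only [hψ, norm_mul, mul_pow, hk, ht, norm_prod, addrReg_ofRegisters, mul_one,
      Finset.prod_pow]
  have hsum : (layerCircuit R m (program R)).acceptProb inp =
      ∑ x : Bool × (Fin R → Fin m → Bool), (if ∃ r, x.2 r = fun _ => false then 1 else 0) *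
        (1 / 2 * ∏ r, ‖F (x.2 r)‖ ^ 2) := by
    have h1 : (layerCircuit R m (program R)).acceptProb inp =
        ∑ s : Fin ((2 * R + 3) * 2 ^ (m + 1)) → Bool,
          (if s (Wire.out : Wire R m).fin = true then 1 else 0) *
            ‖(tests.flatMap fun ℓ => (ℓ.gates m).map Prod.snd).foldl
              (fun ψ γ => γ.apply inp ψ) ψ s‖ ^ 2 := by
      rw [QCircuit.acceptProb, hfinal]
      refine Finset.sum_congr rfl fun s _ => ?_
      rw [ite_mul, one_mul, zero_mul, ← hout]
      rfl
    rw [h1, sum_mul_norm_sq_foldl inp _ hclass (fun s => if s (Wire.out : Wire R m).fin = true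
      then 1 else 0)]
    symm
    refine Fintype.sum_of_injective ofRegisters ofRegisters_injective _ _ ?_ ?_
    · intro s hs
      have : ψ s = 0 := by
        by_contra h
        refine hs (mem_range_ofRegisters ?_ ?_)
        · by_contra hi
          exact h (by simp only [hψ, kickback, if_neg hi, zero_mul])
        · by_contra hi
          exact h (by simp only [hψ, topIs, if_neg hi, mul_zero, zero_mul])
      rw [this, norm_zero, zero_pow two_ne_zero, mul_zero]
    · intro x
      have hiff := onBasis_tests (List.finRange R) (List.nodup_finRange R) (ofRegisters x)
        fun r _ j => ofRegisters_fin x (.chain r j)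
      rw [hnorm, hbasis]
      congr 1
      refine if_congr (Iff.symm (hiff.trans ?_)) rfl rfl
      rw [ofRegisters_fin]
      simp [addrReg_ofRegisters]
  -- Passing to the complement makes the event a product over the copies, so that the sum becomes an
  -- `R`-th power.
  have hcompl : ∀ y : Fin R → Fin m → Bool,
      (if ∃ r, y r = fun _ => false then 1 else 0) * (1 / 2 * ∏ r, ‖F (y r)‖ ^ 2) =
        1 / 2 * ∏ r, ‖F (y r)‖ ^ 2 -
          1 / 2 * ∏ r, (if y r = fun _ => false then 0 else ‖F (y r)‖ ^ 2) := by
    intro y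
    by_cases h : ∃ r, y r = fun _ => false
    · obtain ⟨r, hr⟩ := h
      rw [if_pos ⟨r, hr⟩, Finset.prod_eq_zero (f := fun r => if y r = fun _ => false then (0 : ℝ)
        else ‖F (y r)‖ ^ 2) (Finset.mem_univ r) (if_pos hr)]
      ring
    · rw [if_neg h, zero_mul]
      have : ∀ r, (if y r = fun _ => false then (0 : ℝ) else ‖F (y r)‖ ^ 2) = ‖F (y r)‖ ^ 2 :=
        fun r => if_neg fun hr => h ⟨r, hr⟩
      simp only [this, sub_self]
  have hall : ∑ u, ‖F u‖ ^ 2 = 1 := sum_norm_sq_forrelationState _ _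
  have hrest : ∑ u, (if u = fun _ => false then 0 else ‖F u‖ ^ 2) =
      1 - inputForrelation m inp := by
    have h0 : ‖F fun _ => false‖ ^ 2 = inputForrelation m inp :=
      norm_sq_forrelationState_zero _ _
    rw [← hall, ← h0, ← Finset.add_sum_erase _ _ (Finset.mem_univ fun _ : Fin m => false),
      ← Finset.add_sum_erase _ (fun u => ‖F u‖ ^ 2) (Finset.mem_univ fun _ : Fin m => false),
      if_pos rfl, zero_add, add_sub_cancel_left]
    exact Finset.sum_congr rfl fun u hu => if_neg (Finset.ne_of_mem_erase hu)
  rw [hsum, Fintype.sum_prod_type]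
  simp only [hcompl, Finset.sum_sub_distrib, ← Finset.mul_sum, ← Fintype.sum_pow
    (fun u => ‖F u‖ ^ 2), ← Fintype.sum_pow
    (fun u : Fin m → Bool => if u = fun _ => false then (0 : ℝ) else ‖F u‖ ^ 2), hall, hrest]
  simp

end

theorem layerFamily_size_le (R : ℕ) (p : List (Layer R)) (n : ℕ) :
    (layerFamily R p n).size ≤ p.length * (Nat.log 2 n + 1) := by
  by_cases h : ∃ m, n = 2 ^ (m + 1)
  · obtain ⟨m, rfl⟩ := h
    rw [layerFamily_two_pow, Nat.log_pow one_lt_two]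
    exact (length_layerGates_le R m p).trans (Nat.mul_le_mul_left _ (by omega))
  · rw [layerFamily_of_not _ _ h]
    exact Nat.zero_le _

/-- The number of copies must satisfy `0.95 ^ R ≤ 1 / 3` and `2 / 3 ≤ 0.99 ^ R`, which holds for `R`
from `22` to `40`. -/
theorem inBQLOGTIME_promiseFourierChecking : InBQLOGTIME promiseFourierChecking := by
  refine ⟨layerFamily 32 (program 32), logTimeUniform_layerFamily _ _,
    ⟨(program 32).length, layerFamily_size_le 32 _⟩, fun n => ⟨?_, ?_⟩⟩
  · rintro inp ⟨m, rfl, hm⟩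
    rw [layerFamily_two_pow, acceptProb_program]
    have h1 : inputForrelation m inp ≤ 1 := forrelation_le_one _ _
    have h2 : (1 - inputForrelation m inp) ^ 32 ≤ (1 - 0.05) ^ 32 :=
      pow_le_pow_left₀ (by linarith) (by linarith) 32
    have h3 : ((1 - 0.05) ^ 32 : ℝ) ≤ 1 / 3 := by norm_num
    linarith
  · rintro inp ⟨m, rfl, hm⟩
    rw [layerFamily_two_pow, acceptProb_program]
    have h2 : ((1 - 0.01) ^ 32 : ℝ) ≤ (1 - inputForrelation m inp) ^ 32 :=
      pow_le_pow_left₀ (by norm_num) (by linarith) 32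
    have h3 : (2 / 3 : ℝ) ≤ (1 - 0.01) ^ 32 := by norm_num
    linarith

end FourierChecking

/-! ### Lower bound: inputs as sign patterns, and the second moment under the uniform distribution.
-/

namespace FourierChecking

open Function MeasureTheory

/-! ### Sums over sign patterns -/

/-- The sign that a bit stands for. -/
def sgn (b : Bool) : ℝ := if b then -1 else 1

theorem sgn_not (b : Bool) : sgn (!b) = -sgn b := by cases b <;> simp [sgn]

theorem sgn_mul_self (b : Bool) : sgn b * sgn b = 1 := by cases b <;> simp [sgn]

theorem abs_sgn (b : Bool) : |sgn b| = 1 := by cases b <;> simp [sgn]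

theorem sum_eq_zero_of_flipAt {ι : Type*} [Fintype ι] [DecidableEq ι] (i : ι)
    {F : (ι → Bool) → ℝ} (hF : ∀ z, F (flipAt i z) = -F z) : ∑ z, F z = 0 := by
  have h := Equiv.sum_comp (flipAt_involutive i).toPerm F
  simp only [Involutive.coe_toPerm, hF, Finset.sum_neg_distrib] at h
  linarith

theorem sum_prod_bool {ι : Type*} [Fintype ι] [DecidableEq ι] {𝕜 : Type*} [CommSemiring 𝕜]
    (h : ι → Bool → 𝕜) : ∑ z : ι → Bool, ∏ i, h i (z i) = ∏ i, (h i true + h i false) := by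
  have := Finset.prod_univ_sum (fun _ : ι => (Finset.univ : Finset Bool)) h
  rw [Fintype.piFinset_univ] at this
  rw [← this]
  exact Finset.prod_congr rfl fun i _ => Fintype.sum_bool _

/-! ### The two truth tables in an input string -/

/-- The position in the input of a value of the first or of the second function. -/
def position (m : ℕ) : (Fin m → Bool) ⊕ (Fin m → Bool) → Fin (2 ^ (m + 1))
  | .inl x => ⟨0 + Nat.ofBits x, by have := Nat.ofBits_lt_two_pow x; rw [pow_succ]; omega⟩
  | .inr y => ⟨2 ^ m + Nat.ofBits y, by have := Nat.ofBits_lt_two_pow y; rw [pow_succ]; omega⟩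

theorem ofBits_injective (m : ℕ) : Injective (Nat.ofBits : (Fin m → Bool) → ℕ) := by
  intro x y h
  funext i
  rw [← Nat.testBit_ofBits_lt x i i.2, h, Nat.testBit_ofBits_lt y i i.2]

theorem position_bijective (m : ℕ) : Bijective (position m) := by
  rw [Fintype.bijective_iff_injective_and_card]
  constructor
  · rintro (x | x) (y | y) h <;> simp only [position, Fin.mk.injEq] at h
    · rw [ofBits_injective m (by omega : Nat.ofBits x = Nat.ofBits y)]
    · have := Nat.ofBits_lt_two_pow x
      omega
    · have := Nat.ofBits_lt_two_pow y
      omega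
    · rw [ofBits_injective m (by omega : Nat.ofBits x = Nat.ofBits y)]
  · simp [pow_succ, mul_two]

/-- The positions of the input in bijection with the values of the two functions. -/
noncomputable def positionEquiv (m : ℕ) :
    (Fin m → Bool) ⊕ (Fin m → Bool) ≃ Fin (2 ^ (m + 1)) :=
  Equiv.ofBijective (position m) (position_bijective m)

/-- The input string with given values of the two functions. -/
noncomputable def toInput {m : ℕ} :
    ((Fin m → Bool) ⊕ (Fin m → Bool) → Bool) ≃ (Fin (2 ^ (m + 1)) → Bool) :=
  (positionEquiv m).arrowCongr (Equiv.refl Bool)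

theorem toInput_position {m : ℕ} (z : (Fin m → Bool) ⊕ (Fin m → Bool) → Bool)
    (i : (Fin m → Bool) ⊕ (Fin m → Bool)) : toInput z (position m i) = z i := by
  have : toInput z (positionEquiv m i) = z i := by
    simp [toInput, Equiv.arrowCongr]
  exact this

/-- The correlation between the first function and the Fourier transform of the second. -/
noncomputable def correlation {m : ℕ} (z : (Fin m → Bool) ⊕ (Fin m → Bool) → Bool) : ℝ :=
  ∑ x : Fin m → Bool, ∑ y : Fin m → Bool, sgn (z (.inl x)) * character x y * sgn (z (.inr y))

theorem inputForrelation_toInput {m : ℕ} (z : (Fin m → Bool) ⊕ (Fin m → Bool) → Bool) :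
    inputForrelation m (toInput z) = 1 / ((2 : ℝ) ^ m) ^ 3 * correlation z ^ 2 := by
  have h : ∀ (b : Bool), (((if b then -1 else 1 : ℤˣ) : ℤ) : ℝ) = sgn b := by
    intro b
    cases b <;> simp [sgn]
  have h1 : ∀ x : Fin m → Bool, readBit (toInput z) (0 + Nat.ofBits x) = z (.inl x) := by
    intro x
    have hx := (position m (.inl x)).2
    exact (dif_pos hx).trans (toInput_position z (.inl x))
  have h2 : ∀ y : Fin m → Bool, readBit (toInput z) (2 ^ m + Nat.ofBits y) = z (.inr y) := by
    intro y
    have hy := (position m (.inr y)).2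
    exact (dif_pos hy).trans (toInput_position z (.inr y))
  simp only [inputForrelation, forrelation, truthTable, h, h1, h2, ← character_eq_pow]
  rfl

theorem character_mul_self {m : ℕ} (x y : Fin m → Bool) : character x y * character x y = 1 := by
  rw [character, ← Finset.prod_mul_distrib]
  exact Finset.prod_eq_one fun j _ => by split_ifs <;> simp

/-- The second moment of the correlation of independent uniformly random functions. -/
theorem sum_correlation_sq (m : ℕ) :
    ∑ z : (Fin m → Bool) ⊕ (Fin m → Bool) → Bool, correlation z ^ 2 =
      2 ^ (2 ^ (m + 1)) * ((2 : ℝ) ^ m) ^ 2 := by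
  have hexp : ∀ z : (Fin m → Bool) ⊕ (Fin m → Bool) → Bool, correlation z ^ 2 =
      ∑ p : (Fin m → Bool) × (Fin m → Bool), ∑ p' : (Fin m → Bool) × (Fin m → Bool),
        (sgn (z (.inl p.1)) * character p.1 p.2 * sgn (z (.inr p.2))) *
          (sgn (z (.inl p'.1)) * character p'.1 p'.2 * sgn (z (.inr p'.2))) := by
    intro z
    rw [correlation, sq, ← Fintype.sum_prod_type', Finset.sum_mul_sum]
  simp only [hexp]
  rw [Finset.sum_comm]
  have hterm : ∀ p : (Fin m → Bool) × (Fin m → Bool),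
      ∑ z : (Fin m → Bool) ⊕ (Fin m → Bool) → Bool,
        ∑ p' : (Fin m → Bool) × (Fin m → Bool),
        (sgn (z (.inl p.1)) * character p.1 p.2 * sgn (z (.inr p.2))) *
          (sgn (z (.inl p'.1)) * character p'.1 p'.2 * sgn (z (.inr p'.2))) =
        2 ^ (2 ^ (m + 1)) := by
    rintro ⟨x, y⟩
    -- Only `(x', y') = (x, y)` contributes: otherwise some sign occurs exactly once, and flipping
    -- it negates the summand.
    rw [Finset.sum_comm, Finset.sum_eq_single (x, y)]
    · have h1 : ∀ z : (Fin m → Bool) ⊕ (Fin m → Bool) → Bool,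
          (sgn (z (.inl x)) * character x y * sgn (z (.inr y))) *
            (sgn (z (.inl x)) * character x y * sgn (z (.inr y))) = 1 := by
        intro z
        have h1 := sgn_mul_self (z (.inl x))
        have h2 := sgn_mul_self (z (.inr y))
        have h3 := character_mul_self x y
        calc _ = (sgn (z (.inl x)) * sgn (z (.inl x))) * (character x y * character x y) *
            (sgn (z (.inr y)) * sgn (z (.inr y))) := by ring
          _ = 1 := by rw [h1, h2, h3]; norm_num
      simp only [h1, Finset.sum_const, Finset.card_univ, nsmul_eq_mul, mul_one]
      rw [Fintype.card_fun, Fintype.card_sum, Fintype.card_fun]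
      simp [pow_succ, mul_two]
    · rintro ⟨x', y'⟩ - hne
      by_cases hx : x' = x
      · have hy : y' ≠ y := fun h => hne (by rw [hx, h])
        refine sum_eq_zero_of_flipAt (.inr y) fun z => ?_
        have h1 : flipAt (.inr y) z (.inr y) = !(z (.inr y)) := update_self _ _ _
        have h2 : flipAt (.inr y) z (.inr y') = z (.inr y') := update_of_ne (by simpa using hy) _ _
        have h3 : ∀ x, flipAt (.inr y) z (.inl x) = z (.inl x) :=
          fun x => update_of_ne (by simp) _ _
        simp only [h1, h2, h3, sgn_not]
        ring
      · refine sum_eq_zero_of_flipAt (.inl x) fun z => ?_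
        have h1 : flipAt (.inl x) z (.inl x) = !(z (.inl x)) := update_self _ _ _
        have h2 : flipAt (.inl x) z (.inl x') = z (.inl x') := update_of_ne (by simpa using hx) _ _
        have h3 : ∀ y, flipAt (.inl x) z (.inr y) = z (.inr y) :=
          fun y => update_of_ne (by simp) _ _
        simp only [h1, h2, h3, sgn_not]
        ring
    · simp
  rw [Finset.sum_congr rfl fun p _ => hterm p]
  simp only [Finset.sum_const, Finset.card_univ, Fintype.card_prod, Fintype.card_fun,
    Fintype.card_bool, Fintype.card_fin, nsmul_eq_mul]
  push_cast
  ring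

/-! ### Distributions on inputs -/

/-- The measure on inputs with given weights. -/
noncomputable def inputMeasure {m : ℕ} (W : ((Fin m → Bool) ⊕ (Fin m → Bool) → Bool) → ℝ) :
    Measure (Fin (2 ^ (m + 1)) → Bool) :=
  ∑ z, ENNReal.ofReal (W z) • Measure.dirac (toInput z)

open Classical in
theorem inputMeasure_real {m : ℕ} {W : ((Fin m → Bool) ⊕ (Fin m → Bool) → Bool) → ℝ}
    (hW : ∀ z, 0 ≤ W z) (A : Set (Fin (2 ^ (m + 1)) → Bool)) :
    (inputMeasure W).real A = ∑ z, W z * if toInput z ∈ A then 1 else 0 := by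
  have h : inputMeasure W A =
      ENNReal.ofReal (∑ z, W z * if toInput z ∈ A then 1 else 0) := by
    rw [inputMeasure, Measure.finsetSum_apply, ENNReal.ofReal_sum_of_nonneg]
    · refine Finset.sum_congr rfl fun z _ => ?_
      rw [Measure.smul_apply, Measure.dirac_apply, smul_eq_mul, Set.indicator_apply,
        ENNReal.ofReal_mul (hW z)]
      split_ifs <;> simp
    · intro z _
      split_ifs <;> simp [hW z]
  rw [Measure.real, h, ENNReal.toReal_ofReal]
  exact Finset.sum_nonneg fun z _ => by split_ifs <;> simp [hW z]

open Classical in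
theorem uniform_real {m : ℕ} (A : Set (Fin (2 ^ (m + 1)) → Bool)) :
    (uniform (2 ^ (m + 1))).real A = ∑ z : (Fin m → Bool) ⊕ (Fin m → Bool) → Bool,
      (1 / 2) ^ (2 ^ (m + 1)) * if toInput z ∈ A then 1 else 0 := by
  rw [uniform, Measure.real, ProbabilityTheory.uniformOn_univ, Measure.count_apply_finite _
    (Set.toFinite A), ← Finset.mul_sum,
    Equiv.sum_comp toInput fun u => if u ∈ A then (1 : ℝ) else 0,
    Finset.sum_boole, Fintype.card_fun, Fintype.card_bool, Fintype.card_fin]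
  have : (Set.toFinite A).toFinset = Finset.univ.filter (· ∈ A) := by
    ext
    simp
  rw [this, ENNReal.toReal_div]
  simp [div_eq_mul_inv, mul_comm]

end FourierChecking

/-! ### Lower bound: Gaussian characteristic functions and moments of sines. -/

namespace FourierChecking

open Function MeasureTheory ProbabilityTheory

/-! ### Sign averages of exponentials of quadratic forms -/

/-- The left side is `e ^ t + (a - 1) * sinh t`. With `sinh t ≤ t * e ^ t` this is at most `e ^ t *
(1 + (a - 1) * t)`, and `1 + x ≤ e ^ x` finishes. -/
theorem cosh_add_mul_sinh_le (t : ℝ) {a : ℝ} (ha : 1 ≤ a) :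
    Real.cosh t + a * Real.sinh t ≤ Real.exp (a * t) := by
  have h1 : Real.sinh t ≤ t * Real.exp t := by
    have h := Real.add_one_le_exp (-(2 * t))
    have h2 : Real.exp (-t) = Real.exp t * Real.exp (-(2 * t)) := by
      rw [← Real.exp_add]
      congr 1
      ring
    rw [Real.sinh_eq, h2]
    nlinarith [Real.exp_pos t]
  have h2 : Real.cosh t + a * Real.sinh t = Real.exp t + (a - 1) * Real.sinh t := by
    rw [← Real.cosh_add_sinh]
    ring
  have h3 : Real.exp (a * t) = Real.exp t * Real.exp ((a - 1) * t) := by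
    rw [← Real.exp_add]
    congr 1
    ring
  have h4 := Real.add_one_le_exp ((a - 1) * t)
  rw [h2, h3]
  nlinarith [mul_le_mul_of_nonneg_left h1 (sub_nonneg.2 ha),
    mul_le_mul_of_nonneg_left h4 (Real.exp_pos t).le]

theorem exp_neg_mul_sign {c s : ℝ} (hs : s = 1 ∨ s = -1) :
    Real.exp (-(c * s)) = -(Real.sinh c) * s + Real.cosh c := by
  rcases hs with rfl | rfl
  · rw [mul_one, mul_one, ← Real.cosh_sub_sinh]
    ring
  · rw [mul_neg_one, neg_neg, ← Real.cosh_add_sinh]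
    ring

theorem sgn_mul_sgn_eq (a b : Bool) : sgn a * sgn b = 1 ∨ sgn a * sgn b = -1 := by
  cases a <;> cases b <;> simp [sgn]

/-- The top Fourier coefficient of the exponential of a quadratic form with small coefficients is
exponentially small. -/
theorem abs_sum_prod_mul_exp_le {ι κ : Type*} [Fintype ι] [DecidableEq ι] [DecidableEq κ]
    (J : Finset ι) (P : Finset κ) (a b : κ → ι) (c : κ → ℝ) {w : ℝ} (hw : 1 ≤ w) :
    |∑ ε : ι → Bool, (∏ i ∈ J, sgn (ε i)) *
        Real.exp (-∑ p ∈ P, c p * (sgn (ε (a p)) * sgn (ε (b p))))| ≤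
      2 ^ Fintype.card ι * (w⁻¹ ^ J.card * Real.exp (w ^ 2 * ∑ p ∈ P, |c p|)) := by
  have hw0 : 0 < w := by linarith
  -- Since the argument is `±c p`, each exponential factor is affine in the sign: `cosh c - s * sinh
  -- c`. The product expands over sets `E` of edges on which the `sinh` term is taken.
  have hexp : ∀ ε : ι → Bool,
      (∏ i ∈ J, sgn (ε i)) * Real.exp (-∑ p ∈ P, c p * (sgn (ε (a p)) * sgn (ε (b p)))) =
        ∑ E ∈ P.powerset, ((∏ p ∈ E, -Real.sinh (c p)) * ∏ p ∈ P \ E, Real.cosh (c p)) *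
          ((∏ i ∈ J, sgn (ε i)) * ∏ p ∈ E, (sgn (ε (a p)) * sgn (ε (b p)))) := by
    intro ε
    rw [← Finset.sum_neg_distrib, Real.exp_sum]
    simp only [exp_neg_mul_sign (sgn_mul_sgn_eq _ _)]
    rw [Finset.prod_add, Finset.mul_sum]
    refine Finset.sum_congr rfl fun E _ => ?_
    rw [Finset.prod_mul_distrib]
    ring
  have hcard : ∀ E ∈ P.powerset,
      |∑ ε : ι → Bool, (∏ i ∈ J, sgn (ε i)) * ∏ p ∈ E, (sgn (ε (a p)) * sgn (ε (b p)))| ≤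
        2 ^ Fintype.card ι * (w⁻¹ ^ J.card * (w ^ 2) ^ E.card) := by
    intro E _
    have hpos : (0 : ℝ) ≤ 2 ^ Fintype.card ι * (w⁻¹ ^ J.card * (w ^ 2) ^ E.card) := by positivity
    -- If some `i ∈ J` is missed by `E`, flipping it kills the average. Otherwise `J.card ≤ 2 *
    -- E.card`, and the bound `1 ≤ w⁻¹ ^ J.card * (w ^ 2) ^ E.card` trades the covering condition
    -- for weights that factor over edges.
    by_cases hJ : ∀ i ∈ J, ∃ p ∈ E, a p = i ∨ b p = i
    · have hle : J.card ≤ 2 * E.card := by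
        have hsub : J ⊆ E.image a ∪ E.image b := by
          intro i hi
          obtain ⟨p, hp, h | h⟩ := hJ i hi
          · exact Finset.mem_union_left _ (Finset.mem_image.2 ⟨p, hp, h⟩)
          · exact Finset.mem_union_right _ (Finset.mem_image.2 ⟨p, hp, h⟩)
        calc J.card ≤ (E.image a ∪ E.image b).card := Finset.card_le_card hsub
          _ ≤ (E.image a).card + (E.image b).card := Finset.card_union_le _ _
          _ ≤ E.card + E.card := add_le_add Finset.card_image_le Finset.card_image_le
          _ = 2 * E.card := by ring
      have h1 : (1 : ℝ) ≤ w⁻¹ ^ J.card * (w ^ 2) ^ E.card := by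
        rw [← pow_mul, inv_pow, ← div_eq_inv_mul, one_le_div (by positivity)]
        exact pow_le_pow_right₀ hw hle
      calc _ ≤ ∑ ε : ι → Bool,
            |(∏ i ∈ J, sgn (ε i)) * ∏ p ∈ E, (sgn (ε (a p)) * sgn (ε (b p)))| :=
            Finset.abs_sum_le_sum_abs _ _
        _ = 2 ^ Fintype.card ι := by
            simp [abs_mul, Finset.abs_prod, abs_sgn]
        _ ≤ _ := le_mul_of_one_le_right (by positivity) h1
    · push Not at hJ
      obtain ⟨i, hi, hE⟩ := hJ
      rw [sum_eq_zero_of_flipAt i, abs_zero]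
      · exact hpos
      · intro ε
        have h1 : ∀ j ≠ i, flipAt i ε j = ε j := fun j hj => update_of_ne hj _ _
        have h2 : ∏ p ∈ E, (sgn (flipAt i ε (a p)) * sgn (flipAt i ε (b p))) =
            ∏ p ∈ E, (sgn (ε (a p)) * sgn (ε (b p))) :=
          Finset.prod_congr rfl fun p hp => by rw [h1 _ (hE p hp).1, h1 _ (hE p hp).2]
        have h3 : ∏ j ∈ J, sgn (flipAt i ε j) = -∏ j ∈ J, sgn (ε j) := by
          rw [← Finset.mul_prod_erase J _ hi, ← Finset.mul_prod_erase J (fun j => sgn (ε j)) hi,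
            Finset.prod_congr rfl fun j hj => by rw [h1 j (Finset.ne_of_mem_erase hj)]]
          rw [flipAt, update_self, sgn_not, neg_mul]
        rw [h2, h3, neg_mul]
  simp only [hexp]
  rw [Finset.sum_comm]
  simp only [← Finset.mul_sum]
  calc _ ≤ ∑ E ∈ P.powerset, |((∏ p ∈ E, -Real.sinh (c p)) * ∏ p ∈ P \ E, Real.cosh (c p)) *
        ∑ ε : ι → Bool, (∏ i ∈ J, sgn (ε i)) * ∏ p ∈ E, (sgn (ε (a p)) * sgn (ε (b p)))| :=
        Finset.abs_sum_le_sum_abs _ _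
    _ ≤ ∑ E ∈ P.powerset, ((∏ p ∈ E, |Real.sinh (c p)|) * ∏ p ∈ P \ E, Real.cosh (c p)) *
        (2 ^ Fintype.card ι * (w⁻¹ ^ J.card * (w ^ 2) ^ E.card)) := by
        refine Finset.sum_le_sum fun E hE => ?_
        have h1 : |((∏ p ∈ E, -Real.sinh (c p)) * ∏ p ∈ P \ E, Real.cosh (c p))| =
            (∏ p ∈ E, |Real.sinh (c p)|) * ∏ p ∈ P \ E, Real.cosh (c p) := by
          simp only [abs_mul, Finset.abs_prod, abs_neg, abs_of_pos (Real.cosh_pos _)]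
        rw [abs_mul, h1]
        refine mul_le_mul_of_nonneg_left (hcard E hE) (mul_nonneg ?_ ?_)
        · exact Finset.prod_nonneg fun _ _ => abs_nonneg _
        · exact Finset.prod_nonneg fun _ _ => (Real.cosh_pos _).le
    _ = 2 ^ Fintype.card ι * (w⁻¹ ^ J.card *
          ∏ p ∈ P, (w ^ 2 * |Real.sinh (c p)| + Real.cosh (c p))) := by
        rw [Finset.prod_add, Finset.mul_sum, Finset.mul_sum]
        refine Finset.sum_congr rfl fun E _ => ?_
        rw [Finset.prod_mul_distrib, Finset.prod_const]
        ring
    _ ≤ _ := by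
        rw [Finset.mul_sum, Real.exp_sum]
        gcongr with p hp
        · rw [← Real.cosh_abs, Real.abs_sinh, add_comm]
          exact cosh_add_mul_sinh_le _ (one_le_pow₀ hw)

/-! ### The Gaussian vector -/

section

variable {m : ℕ}

/-- A standard Gaussian vector. -/
noncomputable def gaussianVector (m : ℕ) : Measure ((Fin m → Bool) → ℝ) :=
  Measure.pi fun _ => gaussianReal 0 1

instance : IsProbabilityMeasure (gaussianVector m) := by
  unfold gaussianVector
  infer_instance

/-- A vector and its normalized Fourier transform. -/
noncomputable def withFourier (v : (Fin m → Bool) → ℝ) : (Fin m → Bool) ⊕ (Fin m → Bool) → ℝ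
  | .inl x => (Real.sqrt (2 ^ m))⁻¹ * ∑ y, character x y * v y
  | .inr y => v y

theorem measurable_withFourier (i : (Fin m → Bool) ⊕ (Fin m → Bool)) :
    Measurable fun v => withFourier v i := by
  cases i with
  | inl x =>
    simp only [withFourier]
    fun_prop
  | inr y => exact measurable_pi_apply y

theorem integral_exp_gaussianVector (a : (Fin m → Bool) → ℝ) :
    ∫ v, Complex.exp ((∑ y, a y * v y : ℝ) * Complex.I) ∂gaussianVector m =
      Real.exp (-(∑ y, a y ^ 2) / 2) := by
  have h : ∀ v : (Fin m → Bool) → ℝ, Complex.exp ((∑ y, a y * v y : ℝ) * Complex.I) =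
      ∏ y, Complex.exp (a y * v y * Complex.I) := by
    intro v
    push_cast
    rw [Finset.sum_mul, Complex.exp_sum]
  simp only [h]
  rw [gaussianVector, integral_fintype_prod_eq_prod (fun y (t : ℝ) =>
    Complex.exp (a y * t * Complex.I))]
  simp only [← charFun_apply_real, charFun_gaussianReal]
  rw [← Complex.exp_sum, Complex.ofReal_exp]
  congr 1
  push_cast
  rw [neg_div, Finset.sum_div, ← Finset.sum_neg_distrib]
  refine Finset.sum_congr rfl fun y _ => ?_
  ring

theorem sum_character_mul_character (x x' : Fin m → Bool) :
    ∑ y, character x y * character x' y = if x = x' then (2 : ℝ) ^ m else 0 := by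
  split_ifs with h
  · subst h
    simp [character_mul_self]
  · obtain ⟨j, hj⟩ := Function.ne_iff.1 h
    have hflip : ∀ x y : Fin m → Bool, character x (flipAt j y) = sgn (x j) * character x y := by
      intro x y
      rw [character, character, ← Finset.mul_prod_erase _ _ (Finset.mem_univ j),
        ← Finset.mul_prod_erase _ (fun j => if (x j && y j) = true then (-1 : ℝ) else 1)
          (Finset.mem_univ j), ← mul_assoc]
      congr 1
      · simp only [flipAt, update_self, sgn]
        cases x j <;> cases y j <;> simp
      · refine Finset.prod_congr rfl fun i hi => ?_
        rw [flipAt, update_of_ne (Finset.ne_of_mem_erase hi)]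
    refine sum_eq_zero_of_flipAt j fun y => ?_
    rw [hflip, hflip]
    have : sgn (x j) * sgn (x' j) = -1 := by
      revert hj
      cases x j <;> cases x' j <;> simp [sgn]
    linear_combination character x y * character x' y * this

/-- The characteristic function of the Gaussian vector and its Fourier transform. -/
theorem integral_exp_withFourier (e : (Fin m → Bool) ⊕ (Fin m → Bool) → ℝ) :
    ∫ v, Complex.exp ((∑ i, e i * withFourier v i : ℝ) * Complex.I) ∂gaussianVector m =
      Real.exp (-(∑ i, e i ^ 2) / 2 - ∑ p : (Fin m → Bool) × (Fin m → Bool),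
        (Real.sqrt (2 ^ m))⁻¹ * character p.1 p.2 * (e (.inl p.1) * e (.inr p.2))) := by
  set κ := (Real.sqrt (2 ^ m))⁻¹ with hκ
  have hκ2 : κ ^ 2 * 2 ^ m = 1 := by
    rw [hκ, inv_pow, Real.sq_sqrt (by positivity)]
    exact inv_mul_cancel₀ (by positivity)
  -- The exponent is linear in `v`, so only the sum of the squared coefficients matters.
  -- Orthogonality of characters makes the coefficients on the Fourier side contribute with unit
  -- variance, leaving the cross terms.
  have hlin : ∀ v : (Fin m → Bool) → ℝ, ∑ i, e i * withFourier v i =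
      ∑ y, (e (.inr y) + κ * ∑ x, e (.inl x) * character x y) * v y := by
    intro v
    simp only [Fintype.sum_sum_type, withFourier, add_mul, Finset.sum_add_distrib]
    rw [add_comm]
    congr 1
    simp only [Finset.mul_sum, Finset.sum_mul]
    rw [Finset.sum_comm]
    exact Finset.sum_congr rfl fun y _ => Finset.sum_congr rfl fun x _ => by ring
  simp only [hlin, integral_exp_gaussianVector]
  congr 2
  have hsq : ∑ y, (∑ x, e (.inl x) * character x y) ^ 2 = 2 ^ m * ∑ x, e (.inl x) ^ 2 := by
    simp only [sq (∑ _, _), Finset.sum_mul_sum]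
    rw [Finset.sum_comm, Finset.mul_sum]
    refine Finset.sum_congr rfl fun x _ => ?_
    rw [Finset.sum_comm]
    have : ∀ x', ∑ y, e (.inl x) * character x y * (e (.inl x') * character x' y) =
        if x = x' then 2 ^ m * e (.inl x) ^ 2 else 0 := by
      intro x'
      have h := sum_character_mul_character x x'
      calc _ = e (.inl x) * e (.inl x') * ∑ y, character x y * character x' y := by
            rw [Finset.mul_sum]
            exact Finset.sum_congr rfl fun y _ => by ring
        _ = _ := by
            rw [h]
            split_ifs with hx
            · subst hx
              ring
            · ring
    simp only [this]
    rw [Finset.sum_ite_eq]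
    simp
  have hexpand : ∑ y, (e (.inr y) + κ * ∑ x, e (.inl x) * character x y) ^ 2 =
      ∑ y, e (.inr y) ^ 2 + 2 * (∑ y, ∑ x, κ * character x y * (e (.inl x) * e (.inr y))) +
        κ ^ 2 * ∑ y, (∑ x, e (.inl x) * character x y) ^ 2 := by
    rw [Finset.mul_sum, Finset.mul_sum, ← Finset.sum_add_distrib, ← Finset.sum_add_distrib]
    refine Finset.sum_congr rfl fun y _ => ?_
    have : ∑ x, κ * character x y * (e (.inl x) * e (.inr y)) =
        κ * e (.inr y) * ∑ x, e (.inl x) * character x y := by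
      rw [Finset.mul_sum]
      exact Finset.sum_congr rfl fun x _ => by ring
    rw [this]
    ring
  rw [hexpand, hsq, Fintype.sum_sum_type, Fintype.sum_prod_type_right]
  linear_combination (-(∑ x, e (.inl x) ^ 2) / 2) * hκ2

end

end FourierChecking

namespace FourierChecking

open Function MeasureTheory ProbabilityTheory

/-! ### Moments of the sines of the Gaussian vector and its Fourier transform -/

section

variable {m : ℕ}

theorem integrable_gaussianVector {E : Type*} [NormedAddCommGroup E] [MeasurableSpace E]
    [BorelSpace E] [SecondCountableTopology E]
    {f : ((Fin m → Bool) → ℝ) → E} (hf : Measurable f) {C : ℝ} (hC : ∀ v, ‖f v‖ ≤ C) :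
    Integrable f (gaussianVector m) :=
  Integrable.of_bound hf.aestronglyMeasurable C (Filter.Eventually.of_forall hC)

theorem measurable_sum_withFourier (e : (Fin m → Bool) ⊕ (Fin m → Bool) → ℝ) :
    Measurable fun v => ∑ i, e i * withFourier v i :=
  Finset.measurable_sum _ fun i _ => (measurable_withFourier i).const_mul _

theorem integrable_exp_withFourier (e : (Fin m → Bool) ⊕ (Fin m → Bool) → ℝ) :
    Integrable (fun v => Complex.exp ((∑ i, e i * withFourier v i : ℝ) * Complex.I))
      (gaussianVector m) := by
  refine integrable_gaussianVector (C := 1) ?_ fun v => ?_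
  · exact Complex.measurable_exp.comp
      ((Complex.measurable_ofReal.comp (measurable_sum_withFourier e)).mul_const _)
  · rw [Complex.norm_exp_ofReal_mul_I]

theorem integral_cos_withFourier (e : (Fin m → Bool) ⊕ (Fin m → Bool) → ℝ) :
    ∫ v, Real.cos (∑ i, e i * withFourier v i) ∂gaussianVector m =
      Real.exp (-(∑ i, e i ^ 2) / 2 - ∑ p : (Fin m → Bool) × (Fin m → Bool),
        (Real.sqrt (2 ^ m))⁻¹ * character p.1 p.2 * (e (.inl p.1) * e (.inr p.2))) := by
  have h := congrArg RCLike.re (integral_exp_withFourier e)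
  rw [← integral_re (integrable_exp_withFourier e)] at h
  rw [RCLike.re_to_complex, Complex.ofReal_re] at h
  rw [← h]
  exact integral_congr_ae (Filter.Eventually.of_forall fun v =>
    (Complex.exp_ofReal_mul_I_re _).symm)

/-- The expected product of two of the sines. -/
theorem integral_sin_mul_sin (x y : Fin m → Bool) :
    ∫ v, Real.sin (withFourier v (.inl x)) * Real.sin (withFourier v (.inr y))
      ∂gaussianVector m =
      Real.exp (-1) * Real.sinh ((Real.sqrt (2 ^ m))⁻¹ * character x y) := by
  -- For `s = 1` and `s = -1` this selects the sum and the difference of the two angles, whose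
  -- cosines express the product of the sines.
  set e : ℝ → (Fin m → Bool) ⊕ (Fin m → Bool) → ℝ := fun s =>
    Sum.elim (fun x' => if x' = x then 1 else 0) fun y' => if y' = y then s else 0 with he
  have hlin : ∀ s v, ∑ i, e s i * withFourier v i =
      withFourier v (.inl x) + s * withFourier v (.inr y) := by
    intro s v
    simp [he, Fintype.sum_sum_type]
  have hcos : ∀ s : ℝ, s ^ 2 = 1 →
      ∫ v, Real.cos (withFourier v (.inl x) + s * withFourier v (.inr y)) ∂gaussianVector m =
        Real.exp (-1 - (Real.sqrt (2 ^ m))⁻¹ * character x y * s) := by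
    intro s hs
    have h := integral_cos_withFourier (e s)
    simp only [hlin] at h
    rw [h]
    congr 1
    have h1 : ∑ i, e s i ^ 2 = 2 := by
      simp only [he, Fintype.sum_sum_type, Sum.elim_inl, Sum.elim_inr, ite_pow, one_pow, hs,
        zero_pow two_ne_zero, Finset.sum_ite_eq', Finset.mem_univ, if_true]
      norm_num
    have h2 : ∑ p : (Fin m → Bool) × (Fin m → Bool),
        (Real.sqrt (2 ^ m))⁻¹ * character p.1 p.2 * (e s (.inl p.1) * e s (.inr p.2)) =
          (Real.sqrt (2 ^ m))⁻¹ * character x y * s := by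
      rw [Finset.sum_eq_single (x, y)]
      · simp [he]
      · rintro ⟨x', y'⟩ - hne
        by_cases hx : x' = x
        · have hy : y' ≠ y := fun h => hne (by rw [hx, h])
          simp [he, hy]
        · simp [he, hx]
      · simp
    rw [h1, h2]
    ring
  have hint : ∀ s : ℝ, Integrable (fun v => Real.cos (withFourier v (.inl x) +
      s * withFourier v (.inr y))) (gaussianVector m) := by
    intro s
    refine integrable_gaussianVector (C := 1) ?_ fun v => ?_
    · exact Real.measurable_cos.comp
        ((measurable_withFourier _).add ((measurable_withFourier _).const_mul s))
    · exact Real.abs_cos_le_one _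
  have hprod : ∀ v : (Fin m → Bool) → ℝ,
      Real.sin (withFourier v (.inl x)) * Real.sin (withFourier v (.inr y)) =
        (Real.cos (withFourier v (.inl x) + (-1) * withFourier v (.inr y)) -
          Real.cos (withFourier v (.inl x) + 1 * withFourier v (.inr y))) / 2 := by
    intro v
    rw [neg_one_mul, one_mul, ← sub_eq_add_neg, Real.cos_sub, Real.cos_add]
    ring
  simp only [hprod]
  rw [integral_div, integral_sub (hint _) (hint _), hcos _ (by norm_num), hcos _ (by norm_num),
    Real.sinh_eq, sub_eq_add_neg (-1 : ℝ), sub_eq_add_neg (-1 : ℝ), Real.exp_add, Real.exp_add]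
  rw [mul_neg_one, neg_neg, mul_one]
  ring

/-- Euler's formula writes `sin θ` as the average of `-i ε exp(i ε θ)` over `ε = ±1`. Averaging over
signs outside `J` as well changes nothing and keeps one index set for all `J`. -/
theorem prod_sin_eq_sum {ι : Type*} [Fintype ι] [DecidableEq ι] (J : Finset ι) (θ : ι → ℝ) :
    ((∏ i ∈ J, Real.sin (θ i) : ℝ) : ℂ) = ∑ ε : ι → Bool,
      ((1 / 2) ^ Fintype.card ι * (-Complex.I) ^ J.card * (∏ i ∈ J, sgn (ε i) : ℝ)) *
        Complex.exp ((∑ i, (if i ∈ J then sgn (ε i) else 0) * θ i : ℝ) * Complex.I) := by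
  have hterm : ∀ ε : ι → Bool,
      ((1 / 2) ^ Fintype.card ι * (-Complex.I) ^ J.card * (∏ i ∈ J, sgn (ε i) : ℝ)) *
        Complex.exp ((∑ i, (if i ∈ J then sgn (ε i) else 0) * θ i : ℝ) * Complex.I) =
      ∏ i, (1 / 2 : ℂ) * (if i ∈ J then
        -Complex.I * sgn (ε i) * Complex.exp (sgn (ε i) * θ i * Complex.I) else 1) := by
    intro ε
    rw [Finset.prod_mul_distrib, Finset.prod_const, Finset.card_univ, Finset.prod_ite_mem,
      Finset.univ_inter, Finset.prod_mul_distrib, Finset.prod_mul_distrib, Finset.prod_const,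
      ← Complex.exp_sum]
    have : ∑ i, (if i ∈ J then sgn (ε i) else 0) * θ i = ∑ i ∈ J, sgn (ε i) * θ i := by
      simp only [ite_mul, zero_mul, Finset.sum_ite_mem, Finset.univ_inter]
    rw [this]
    push_cast
    rw [Finset.sum_mul]
    ring
  simp only [hterm]
  rw [sum_prod_bool fun i b => (1 / 2 : ℂ) * (if i ∈ J then
    -Complex.I * sgn b * Complex.exp (sgn b * θ i * Complex.I) else 1)]
  have hfac : ∀ i, (1 / 2 : ℂ) * (if i ∈ J then
      -Complex.I * sgn true * Complex.exp (sgn true * θ i * Complex.I) else 1) +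
      (1 / 2 : ℂ) * (if i ∈ J then
        -Complex.I * sgn false * Complex.exp (sgn false * θ i * Complex.I) else 1) =
      if i ∈ J then (Real.sin (θ i) : ℂ) else 1 := by
    intro i
    split_ifs
    · rw [Complex.ofReal_sin, Complex.sin]
      simp only [sgn, if_true, Bool.false_eq_true, if_false]
      push_cast
      rw [neg_one_mul, one_mul]
      ring
    · norm_num
  simp only [hfac, Finset.prod_ite_mem, Finset.univ_inter]
  push_cast
  rfl

theorem abs_character (x y : Fin m → Bool) : |character x y| = 1 := by
  rw [character, Finset.abs_prod]
  exact Finset.prod_eq_one fun j _ => by split_ifs <;> simp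

/-- The expected product of any number of the sines is small. -/
theorem abs_integral_prod_sin_le (J : Finset ((Fin m → Bool) ⊕ (Fin m → Bool))) {w : ℝ}
    (hw : 1 ≤ w) :
    |∫ v, ∏ i ∈ J, Real.sin (withFourier v i) ∂gaussianVector m| ≤
      w⁻¹ ^ J.card * Real.exp (w ^ 2 * (J.card ^ 2 * (Real.sqrt (2 ^ m))⁻¹)) := by
  classical
  set κ := (Real.sqrt (2 ^ m))⁻¹ with hκ
  have hκ0 : 0 ≤ κ := by positivity
  set P : Finset ((Fin m → Bool) × (Fin m → Bool)) :=
    Finset.univ.filter fun p => Sum.inl p.1 ∈ J ∧ Sum.inr p.2 ∈ J with hP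
  have hPcard : P.card ≤ J.card ^ 2 := by
    rw [sq, ← Finset.card_product]
    refine Finset.card_le_card_of_injOn (fun p => (Sum.inl p.1, Sum.inr p.2)) ?_ ?_
    · intro p hp
      have hp' := (Finset.mem_filter.1 hp).2
      exact Finset.mem_product.2 hp'
    · rintro ⟨x, y⟩ - ⟨x', y'⟩ - h
      exact Prod.ext (Sum.inl_injective (Prod.ext_iff.1 h).1)
        (Sum.inr_injective (Prod.ext_iff.1 h).2)
  have hform : ∀ ε : (Fin m → Bool) ⊕ (Fin m → Bool) → Bool,
      Real.exp (-(∑ i, (if i ∈ J then sgn (ε i) else 0) ^ 2) / 2 -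
        ∑ p : (Fin m → Bool) × (Fin m → Bool), κ * character p.1 p.2 *
          ((if Sum.inl p.1 ∈ J then sgn (ε (.inl p.1)) else 0) *
            (if Sum.inr p.2 ∈ J then sgn (ε (.inr p.2)) else 0))) =
      Real.exp (-(J.card : ℝ) / 2) * Real.exp (-∑ p ∈ P, κ * character p.1 p.2 *
          (sgn (ε (.inl p.1)) * sgn (ε (.inr p.2)))) := by
    intro ε
    rw [← Real.exp_add, sub_eq_add_neg]
    congr 3
    · have : ∀ i, (if i ∈ J then sgn (ε i) else 0) ^ 2 = if i ∈ J then (1 : ℝ) else 0 := by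
        intro i
        rw [sq]
        split_ifs
        · exact sgn_mul_self _
        · ring
      simp [this]
    · rw [hP, Finset.sum_filter]
      refine Finset.sum_congr rfl fun p _ => ?_
      by_cases h1 : Sum.inl p.1 ∈ J <;> by_cases h2 : Sum.inr p.2 ∈ J <;> simp [h1, h2]
  have hint : ((∫ v, ∏ i ∈ J, Real.sin (withFourier v i) ∂gaussianVector m : ℝ) : ℂ) =
      ((1 / 2) ^ Fintype.card ((Fin m → Bool) ⊕ (Fin m → Bool)) * (-Complex.I) ^ J.card) *
        ((Real.exp (-(J.card : ℝ) / 2) * ∑ ε : (Fin m → Bool) ⊕ (Fin m → Bool) → Bool,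
          (∏ i ∈ J, sgn (ε i)) * Real.exp (-∑ p ∈ P, κ * character p.1 p.2 *
            (sgn (ε (.inl p.1)) * sgn (ε (.inr p.2)))) : ℝ) : ℂ) := by
    rw [← integral_complex_ofReal]
    simp only [prod_sin_eq_sum]
    rw [integral_finsetSum _ fun ε _ => (integrable_exp_withFourier _).const_mul _]
    simp only [integral_const_mul, integral_exp_withFourier, ← hκ]
    simp only [hform]
    push_cast
    simp only [Finset.mul_sum]
    exact Finset.sum_congr rfl fun ε _ => by ring
  have hnorm := congrArg norm hint
  rw [Complex.norm_real, Real.norm_eq_abs] at hnorm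
  rw [hnorm, norm_mul, norm_mul, norm_pow, norm_pow, norm_neg, Complex.norm_I, one_pow, mul_one,
    Complex.norm_real, Real.norm_eq_abs, abs_mul, abs_of_pos (Real.exp_pos _)]
  have hsum := abs_sum_prod_mul_exp_le J P (fun p => Sum.inl p.1) (fun p => Sum.inr p.2)
    (fun p => κ * character p.1 p.2) hw
  have hc : ∑ p ∈ P, |κ * character p.1 p.2| ≤ J.card ^ 2 * κ := by
    simp only [abs_mul, abs_character, mul_one, abs_of_nonneg hκ0, Finset.sum_const, nsmul_eq_mul]
    exact mul_le_mul_of_nonneg_right (by exact_mod_cast hPcard) hκ0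
  have hw0 : 0 < w := by linarith
  -- The damping from the variances is not needed; the smallness comes from the cross covariances.
  have he1 : Real.exp (-(J.card : ℝ) / 2) ≤ 1 := by
    rw [Real.exp_le_one_iff]
    have : (0 : ℝ) ≤ J.card := Nat.cast_nonneg _
    linarith
  have hhalf : ‖(1 / 2 : ℂ)‖ = 1 / 2 := by norm_num
  rw [hhalf]
  set M := Fintype.card ((Fin m → Bool) ⊕ (Fin m → Bool))
  calc (1 / 2 : ℝ) ^ M * (Real.exp (-(J.card : ℝ) / 2) * |_|)
      ≤ (1 / 2 : ℝ) ^ M * (1 * (2 ^ M * (w⁻¹ ^ J.card *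
        Real.exp (w ^ 2 * ∑ p ∈ P, |κ * character p.1 p.2|)))) := by gcongr
    _ = w⁻¹ ^ J.card * Real.exp (w ^ 2 * ∑ p ∈ P, |κ * character p.1 p.2|) := by
        rw [one_mul, ← mul_assoc, ← mul_pow]
        norm_num
    _ ≤ _ := by gcongr

end

end FourierChecking

/-! ### Lower bound: the forrelated distribution, its values of `p` and its near independence. -/

namespace FourierChecking

open Function MeasureTheory ProbabilityTheory

/-! ### Random signs with given means -/

section

variable {ι : Type*} [Fintype ι] [DecidableEq ι]

theorem sum_prod_mul_prod_sgn (θ : ι → ℝ) (S : Finset ι) :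
    ∑ z : ι → Bool, (∏ i, (1 + sgn (z i) * θ i) / 2) * ∏ i ∈ S, sgn (z i) = ∏ i ∈ S, θ i := by
  have h : ∀ z : ι → Bool, (∏ i, (1 + sgn (z i) * θ i) / 2) * ∏ i ∈ S, sgn (z i) =
      ∏ i, (1 + sgn (z i) * θ i) / 2 * if i ∈ S then sgn (z i) else 1 := by
    intro z
    rw [Finset.prod_mul_distrib, Finset.prod_ite_mem, Finset.univ_inter]
  simp only [h]
  rw [sum_prod_bool fun i b => (1 + sgn b * θ i) / 2 * if i ∈ S then sgn b else 1]
  have h2 : ∀ i, ((1 + sgn true * θ i) / 2 * if i ∈ S then sgn true else 1) +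
      ((1 + sgn false * θ i) / 2 * if i ∈ S then sgn false else 1) =
        if i ∈ S then θ i else 1 := by
    intro i
    simp only [sgn, if_true, Bool.false_eq_true, if_false]
    split_ifs <;> ring
  simp only [h2, Finset.prod_ite_mem, Finset.univ_inter]

theorem sum_prod_mul_ite_forall (θ : ι → ℝ) (S : Finset ι) (u : ι → Bool) :
    ∑ z : ι → Bool, (∏ i, (1 + sgn (z i) * θ i) / 2) * (if ∀ i ∈ S, z i = u i then 1 else 0) =
      ∏ i ∈ S, (1 + sgn (u i) * θ i) / 2 := by
  have h : ∀ z : ι → Bool,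
      (∏ i, (1 + sgn (z i) * θ i) / 2) * (if ∀ i ∈ S, z i = u i then (1 : ℝ) else 0) =
      ∏ i, (1 + sgn (z i) * θ i) / 2 * if i ∈ S then (if z i = u i then 1 else 0) else 1 := by
    intro z
    rw [Finset.prod_mul_distrib, Finset.prod_ite_mem, Finset.univ_inter, Finset.prod_boole]
    split_ifs <;> rfl
  simp only [h]
  rw [sum_prod_bool fun i b => (1 + sgn b * θ i) / 2 *
    if i ∈ S then (if b = u i then 1 else 0) else 1]
  have h2 : ∀ i, ((1 + sgn true * θ i) / 2 *
      if i ∈ S then (if true = u i then (1 : ℝ) else 0) else 1) +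
      ((1 + sgn false * θ i) / 2 * if i ∈ S then (if false = u i then 1 else 0) else 1) =
        if i ∈ S then (1 + sgn (u i) * θ i) / 2 else 1 := by
    intro i
    by_cases hi : i ∈ S
    · simp only [hi, if_true]
      cases u i <;> simp
    · simp only [hi, sgn, if_true, Bool.false_eq_true, if_false]
      ring
  simp only [h2, Finset.prod_ite_mem, Finset.univ_inter]

end

/-! ### Signs whose means are sines of the Gaussian vector and its Fourier transform -/

section

variable {m : ℕ}

theorem toInput_mem_term (z : (Fin m → Bool) ⊕ (Fin m → Bool) → Bool)
    (S : Finset (Fin (2 ^ (m + 1)))) (v : Fin (2 ^ (m + 1)) → Bool) :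
    toInput z ∈ term S v ↔
      ∀ i ∈ S.map (positionEquiv m).symm.toEmbedding, z i = v (position m i) := by
  constructor
  · intro h i hi
    rw [← toInput_position z]
    exact h _ (Finset.mem_map_equiv.1 hi)
  · intro h j hj
    obtain ⟨i, rfl⟩ := (positionEquiv m).surjective j
    exact (toInput_position z i).trans (h i (Finset.mem_map_equiv.2 hj))

/-- The probability of a pattern of signs: given the Gaussian vector, the signs are independent
and have the sines of its entries and of those of its Fourier transform as means. -/
noncomputable def forrelatedWeight (z : (Fin m → Bool) ⊕ (Fin m → Bool) → Bool) : ℝ :=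
  ∫ v, ∏ i, (1 + sgn (z i) * Real.sin (withFourier v i)) / 2 ∂gaussianVector m

theorem abs_sgn_mul_sin_le_one (b : Bool) (t : ℝ) : |sgn b * Real.sin t| ≤ 1 := by
  rw [abs_mul, abs_sgn, one_mul]
  exact Real.abs_sin_le_one t

theorem forrelatedWeight_nonneg (z : (Fin m → Bool) ⊕ (Fin m → Bool) → Bool) :
    0 ≤ forrelatedWeight z := by
  refine integral_nonneg fun v => Finset.prod_nonneg fun i _ => ?_
  have := neg_le_of_abs_le (abs_sgn_mul_sin_le_one (z i) (withFourier v i))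
  linarith

theorem measurable_sin_withFourier (i : (Fin m → Bool) ⊕ (Fin m → Bool)) :
    Measurable fun v => Real.sin (withFourier v i) :=
  Real.measurable_sin.comp (measurable_withFourier i)

theorem integrable_prod_one_add (z : (Fin m → Bool) ⊕ (Fin m → Bool) → Bool) :
    Integrable (fun v => ∏ i, (1 + sgn (z i) * Real.sin (withFourier v i)) / 2)
      (gaussianVector m) := by
  refine integrable_gaussianVector (C := 1) ?_ fun v => ?_
  · exact Finset.measurable_prod _ fun i _ =>
      (((measurable_sin_withFourier i).const_mul _).const_add _).div_const _
  · rw [Real.norm_eq_abs, Finset.abs_prod]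
    refine Finset.prod_le_one (fun _ _ => abs_nonneg _) fun i _ => ?_
    have := abs_le.1 (abs_sgn_mul_sin_le_one (z i) (withFourier v i))
    rw [abs_le]
    constructor <;> linarith

theorem sum_forrelatedWeight_mul (F : ((Fin m → Bool) ⊕ (Fin m → Bool) → Bool) → ℝ) :
    ∑ z, forrelatedWeight z * F z =
      ∫ v, ∑ z : (Fin m → Bool) ⊕ (Fin m → Bool) → Bool,
        (∏ i, (1 + sgn (z i) * Real.sin (withFourier v i)) / 2) * F z ∂gaussianVector m := by
  rw [integral_finsetSum _ fun z _ => (integrable_prod_one_add z).mul_const _]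
  simp only [integral_mul_const, forrelatedWeight]

theorem sum_forrelatedWeight :
    ∑ z : (Fin m → Bool) ⊕ (Fin m → Bool) → Bool, forrelatedWeight z = 1 := by
  have h := sum_forrelatedWeight_mul (m := m) fun z => ∏ i ∈ ∅, sgn (z i)
  simp only [sum_prod_mul_prod_sgn fun i => Real.sin (withFourier _ i)] at h
  simpa using h

/-- The mean of the product of the signs at `x` and `y` is `e⁻¹ * sinh (κ * character x y)`. As
`sinh` is odd, multiplying by the character makes all pairs contribute `e⁻¹ * sinh κ`, which is at
least `e⁻¹ * κ`. -/
theorem one_div_le_sum_forrelatedWeight_mul_correlation :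
    ((2 : ℝ) ^ m) ^ 2 * (Real.exp (-1) * (Real.sqrt (2 ^ m))⁻¹) ≤
      ∑ z : (Fin m → Bool) ⊕ (Fin m → Bool) → Bool, forrelatedWeight z * correlation z := by
  set κ := (Real.sqrt (2 ^ m))⁻¹ with hκ
  have hκ0 : 0 ≤ κ := by positivity
  have hpair : ∀ x y : Fin m → Bool,
      ∑ z : (Fin m → Bool) ⊕ (Fin m → Bool) → Bool,
        forrelatedWeight z * (sgn (z (.inl x)) * character x y * sgn (z (.inr y))) =
      Real.exp (-1) * Real.sinh κ := by
    intro x y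
    have h1 : ∀ z : (Fin m → Bool) ⊕ (Fin m → Bool) → Bool,
        forrelatedWeight z * (sgn (z (.inl x)) * character x y * sgn (z (.inr y))) =
        character x y * (forrelatedWeight z *
          ∏ i ∈ ({.inl x, .inr y} : Finset ((Fin m → Bool) ⊕ (Fin m → Bool))), sgn (z i)) := by
      intro z
      rw [Finset.prod_pair (by simp)]
      ring
    simp only [h1]
    rw [← Finset.mul_sum, sum_forrelatedWeight_mul]
    simp only [sum_prod_mul_prod_sgn fun i => Real.sin (withFourier _ i)]
    have h2 : ∀ v : (Fin m → Bool) → ℝ,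
        ∏ i ∈ ({.inl x, .inr y} : Finset ((Fin m → Bool) ⊕ (Fin m → Bool))),
          Real.sin (withFourier v i) =
        Real.sin (withFourier v (.inl x)) * Real.sin (withFourier v (.inr y)) :=
      fun v => Finset.prod_pair (by simp)
    simp only [h2]
    rw [integral_sin_mul_sin, ← hκ]
    have h3 := abs_character x y
    rcases abs_eq (zero_le_one) |>.1 h3 with h | h <;> rw [h] <;> simp
  simp only [correlation, Finset.mul_sum]
  rw [Finset.sum_comm]
  have : ∀ x : Fin m → Bool, ∑ z : (Fin m → Bool) ⊕ (Fin m → Bool) → Bool, ∑ y : Fin m → Bool,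
      forrelatedWeight z * (sgn (z (.inl x)) * character x y * sgn (z (.inr y))) =
        ∑ _y : Fin m → Bool, Real.exp (-1) * Real.sinh κ := by
    intro x
    rw [Finset.sum_comm]
    exact Finset.sum_congr rfl fun y _ => hpair x y
  rw [Finset.sum_congr rfl fun x _ => this x]
  simp only [Finset.sum_const, Finset.card_univ, Fintype.card_fun, Fintype.card_bool,
    Fintype.card_fin, nsmul_eq_mul]
  push_cast
  rw [← mul_assoc ((2 : ℝ) ^ m), ← sq]
  gcongr
  exact Real.self_le_sinh_iff.2 hκ0

/-- The distribution of the signs. -/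
noncomputable def forrelatedMeasure (m : ℕ) : Measure (Fin (2 ^ (m + 1)) → Bool) :=
  inputMeasure forrelatedWeight

instance : IsProbabilityMeasure (forrelatedMeasure m) := by
  classical
  constructor
  have h := inputMeasure_real (m := m) forrelatedWeight_nonneg Set.univ
  simp only [Set.mem_univ, if_true, mul_one, sum_forrelatedWeight] at h
  have h2 := (ENNReal.toReal_eq_one_iff _).1 h
  exact h2

/-- Inputs with a large value of `p` have a large probability. -/
theorem le_forrelatedMeasure_real (A : Set (Fin (2 ^ (m + 1)) → Bool))
    (hA : ∀ u, 0.05 ≤ inputForrelation m u → u ∈ A) : 0.07 ≤ (forrelatedMeasure m).real A := by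
  classical
  rw [forrelatedMeasure, inputMeasure_real forrelatedWeight_nonneg]
  set κ := (Real.sqrt (2 ^ m))⁻¹ with hκ
  have hκ2 : κ ^ 2 * 2 ^ m = 1 := by
    rw [hκ, inv_pow, Real.sq_sqrt (by positivity)]
    exact inv_mul_cancel₀ (by positivity)
  have hκ0 : 0 ≤ κ := by positivity
  have hp : ∀ z : (Fin m → Bool) ⊕ (Fin m → Bool) → Bool,
      inputForrelation m (toInput z) = (κ ^ 3 * correlation z) ^ 2 := by
    intro z
    have h3 : (κ ^ 2) ^ 3 * ((2 : ℝ) ^ m) ^ 3 = 1 := by rw [← mul_pow, hκ2, one_pow]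
    rw [inputForrelation_toInput, ← eq_one_div_of_mul_eq_one_left h3]
    ring
  have hmean : 0.36 ≤ ∑ z : (Fin m → Bool) ⊕ (Fin m → Bool) → Bool,
      forrelatedWeight z * (κ ^ 3 * correlation z) := by
    have h1 := mul_le_mul_of_nonneg_left
      (one_div_le_sum_forrelatedWeight_mul_correlation (m := m)) (pow_nonneg hκ0 3)
    rw [Finset.mul_sum, ← hκ] at h1
    have h2 : κ ^ 3 * (((2 : ℝ) ^ m) ^ 2 * (Real.exp (-1) * κ)) = Real.exp (-1) := by
      calc _ = (κ ^ 2 * 2 ^ m) ^ 2 * Real.exp (-1) := by ring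
        _ = _ := by rw [hκ2]; ring
    have h3 : (0.36 : ℝ) ≤ Real.exp (-1) := by
      rw [Real.exp_neg, le_inv_comm₀ (by norm_num) (Real.exp_pos _)]
      have := Real.exp_one_lt_d9
      norm_num at this ⊢
      linarith
    rw [h2] at h1
    refine h3.trans (h1.trans (le_of_eq (Finset.sum_congr rfl fun z _ => ?_)))
    ring
  -- Nonnegativity of the second moment about `0.36` turns the bound on the mean into `0.36 ^ 2` for
  -- the mean of `p`.
  have hsq : 0.1296 ≤ ∑ z : (Fin m → Bool) ⊕ (Fin m → Bool) → Bool,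
      forrelatedWeight z * (κ ^ 3 * correlation z) ^ 2 := by
    have h0 : 0 ≤ ∑ z : (Fin m → Bool) ⊕ (Fin m → Bool) → Bool,
        forrelatedWeight z * (κ ^ 3 * correlation z - 0.36) ^ 2 :=
      Finset.sum_nonneg fun z _ => mul_nonneg (forrelatedWeight_nonneg z) (sq_nonneg _)
    have h1 : ∑ z : (Fin m → Bool) ⊕ (Fin m → Bool) → Bool,
        forrelatedWeight z * (κ ^ 3 * correlation z - 0.36) ^ 2 =
        ∑ z : (Fin m → Bool) ⊕ (Fin m → Bool) → Bool,
          forrelatedWeight z * (κ ^ 3 * correlation z) ^ 2 -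
          0.72 * ∑ z : (Fin m → Bool) ⊕ (Fin m → Bool) → Bool,
            forrelatedWeight z * (κ ^ 3 * correlation z) +
            0.1296 * ∑ z : (Fin m → Bool) ⊕ (Fin m → Bool) → Bool, forrelatedWeight z := by
      rw [Finset.mul_sum, Finset.mul_sum, ← Finset.sum_sub_distrib, ← Finset.sum_add_distrib]
      exact Finset.sum_congr rfl fun z _ => by ring
    rw [h1, sum_forrelatedWeight] at h0
    linarith
  -- Since `p ≤ 1`, its mean is at most `0.05` plus the probability of `A`; this leaves `0.0796`.
  have hle : ∑ z : (Fin m → Bool) ⊕ (Fin m → Bool) → Bool,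
      forrelatedWeight z * (κ ^ 3 * correlation z) ^ 2 ≤
      ∑ z, (0.05 * forrelatedWeight z + forrelatedWeight z * if toInput z ∈ A then 1 else 0) := by
    refine Finset.sum_le_sum fun z _ => ?_
    have h0 := forrelatedWeight_nonneg z
    rw [← hp z]
    have h1 : inputForrelation m (toInput z) ≤ 1 := forrelation_le_one _ _
    split_ifs with hz
    · nlinarith
    · have h2 : inputForrelation m (toInput z) < 0.05 := not_le.1 fun h => hz (hA _ h)
      nlinarith
  rw [Finset.sum_add_distrib, ← Finset.mul_sum, sum_forrelatedWeight] at hle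
  linarith

/-- Inputs with a value of `p` that is not small have a small uniform probability. -/
theorem uniform_real_le (A : Set (Fin (2 ^ (m + 1)) → Bool))
    (hA : ∀ u ∈ A, 0.01 < inputForrelation m u) :
    (uniform (2 ^ (m + 1))).real A ≤ 100 / 2 ^ m := by
  classical
  rw [uniform_real]
  -- Markov's inequality: the indicator of `A` is at most `100 * p`.
  calc _ ≤ ∑ z : (Fin m → Bool) ⊕ (Fin m → Bool) → Bool,
        (1 / 2 : ℝ) ^ (2 ^ (m + 1)) * (100 * (1 / ((2 : ℝ) ^ m) ^ 3 * correlation z ^ 2)) := by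
        refine Finset.sum_le_sum fun z _ => mul_le_mul_of_nonneg_left ?_ (by positivity)
        split_ifs with hz
        · have := hA _ hz
          rw [inputForrelation_toInput] at this
          linarith
        · positivity
    _ = 100 / 2 ^ m := by
        rw [← Finset.mul_sum, ← Finset.mul_sum, ← Finset.mul_sum, sum_correlation_sq, one_div_pow]
        field_simp

/-- The expectation of a product of random signs conditioned on a term. -/
theorem abs_integral_prod_one_add_sub_one_le (S : Finset ((Fin m → Bool) ⊕ (Fin m → Bool)))
    (u : (Fin m → Bool) ⊕ (Fin m → Bool) → Bool) {w : ℝ} (hw : 1 ≤ w) :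
    |∫ v, ∏ i ∈ S, (1 + sgn (u i) * Real.sin (withFourier v i)) ∂gaussianVector m - 1| ≤
      Real.exp (w ^ 2 * (S.card ^ 2 * (Real.sqrt (2 ^ m))⁻¹)) * ((1 + w⁻¹) ^ S.card - 1) := by
  have hw0 : 0 < w := by linarith
  have hint : ∀ J : Finset ((Fin m → Bool) ⊕ (Fin m → Bool)),
      Integrable (fun v => ∏ i ∈ J, Real.sin (withFourier v i)) (gaussianVector m) := by
    intro J
    refine integrable_gaussianVector (C := 1)
      (Finset.measurable_prod _ fun i _ => measurable_sin_withFourier i) fun v => ?_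
    rw [Real.norm_eq_abs, Finset.abs_prod]
    exact Finset.prod_le_one (fun _ _ => abs_nonneg _) fun i _ => Real.abs_sin_le_one _
  have hexp : ∫ v, ∏ i ∈ S, (1 + sgn (u i) * Real.sin (withFourier v i)) ∂gaussianVector m =
      ∑ J ∈ S.powerset, (∏ i ∈ J, sgn (u i)) *
        ∫ v, ∏ i ∈ J, Real.sin (withFourier v i) ∂gaussianVector m := by
    simp only [Finset.prod_one_add, Finset.prod_mul_distrib]
    rw [integral_finsetSum _ fun J _ => (hint J).const_mul _]
    simp only [integral_const_mul]
  have hbinom : ∑ J ∈ S.powerset, w⁻¹ ^ J.card = (1 + w⁻¹) ^ S.card := by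
    rw [← Finset.prod_const, Finset.prod_one_add]
    simp only [Finset.prod_const]
  have hempty : ∅ ∈ S.powerset := Finset.empty_mem_powerset S
  rw [← hbinom, hexp]
  -- The empty set contributes exactly `1` to both expansions, so removing it accounts for both
  -- subtracted ones.
  have h1 := Finset.sum_erase_eq_sub (f := fun J => (∏ i ∈ J, sgn (u i)) *
    ∫ v, ∏ i ∈ J, Real.sin (withFourier v i) ∂gaussianVector m) hempty
  have h2 := Finset.sum_erase_eq_sub (f := fun J => w⁻¹ ^ J.card) hempty
  simp only [Finset.prod_empty, Finset.card_empty, pow_zero, integral_const, probReal_univ,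
    smul_eq_mul, mul_one] at h1 h2
  rw [← h1, ← h2, Finset.mul_sum]
  refine (Finset.abs_sum_le_sum_abs _ _).trans (Finset.sum_le_sum fun J hJ => ?_)
  have hJS : J.card ≤ S.card :=
    Finset.card_le_card (Finset.mem_powerset.1 (Finset.mem_of_mem_erase hJ))
  rw [abs_mul, Finset.abs_prod]
  simp only [abs_sgn, Finset.prod_const_one, one_mul]
  refine (abs_integral_prod_sin_le J hw).trans ?_
  rw [mul_comm]
  gcongr

-- Given the Gaussian vector the bits are independent, so a term has conditional probability the
-- product of `(1 ± sin) / 2`; the halves cancel against the uniform probability, which is the same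
-- computation with all means zero.
open Classical in
theorem forrelatedMeasure_real_term (S : Finset (Fin (2 ^ (m + 1))))
    (v : Fin (2 ^ (m + 1)) → Bool) :
    (forrelatedMeasure m).real (term S v) / (uniform (2 ^ (m + 1))).real (term S v) =
      ∫ t, ∏ i ∈ S.map (positionEquiv m).symm.toEmbedding,
        (1 + sgn (v (position m i)) * Real.sin (withFourier t i)) ∂gaussianVector m := by
  have hU : (uniform (2 ^ (m + 1))).real (term S v) = (1 / 2) ^ S.card := by
    rw [uniform_real]
    simp only [toInput_mem_term]
    have h := sum_prod_mul_ite_forall (fun _ => 0) (S.map (positionEquiv m).symm.toEmbedding)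
      fun i => v (position m i)
    simp only [mul_zero, add_zero, Finset.prod_const, Finset.card_map, Finset.card_univ,
      Fintype.card_sum, Fintype.card_fun, Fintype.card_bool, Fintype.card_fin,
      ← two_mul, ← pow_succ'] at h
    convert h using 3
  rw [hU, forrelatedMeasure, inputMeasure_real forrelatedWeight_nonneg]
  simp only [toInput_mem_term]
  rw [sum_forrelatedWeight_mul]
  have h := fun t => sum_prod_mul_ite_forall (fun i => Real.sin (withFourier t i))
    (S.map (positionEquiv m).symm.toEmbedding) fun i => v (position m i)
  have h2 : ∀ t, ∏ i ∈ S.map (positionEquiv m).symm.toEmbedding,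
      (1 + sgn (v (position m i)) * Real.sin (withFourier t i)) / 2 =
      (∏ i ∈ S.map (positionEquiv m).symm.toEmbedding,
        (1 + sgn (v (position m i)) * Real.sin (withFourier t i))) * (1 / 2) ^ S.card := by
    intro t
    rw [Finset.prod_div_distrib, Finset.prod_const, Finset.card_map, one_div_pow,
      div_eq_mul_one_div]
  rw [div_eq_iff (by positivity), ← integral_mul_const]
  refine integral_congr_ae (Filter.Eventually.of_forall fun t => ?_)
  simp only [← h2, ← h]

theorem almostWiseIndependent_forrelatedMeasure {k : ℕ} {w ε : ℝ} (hw : 1 ≤ w)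
    (hε : Real.exp (w ^ 2 * (k ^ 2 * (Real.sqrt (2 ^ m))⁻¹)) * ((1 + w⁻¹) ^ k - 1) ≤ ε) :
    AlmostWiseIndependent (forrelatedMeasure m) ε k := by
  intro S v hS
  rw [forrelatedMeasure_real_term]
  have h := abs_integral_prod_one_add_sub_one_le (S.map (positionEquiv m).symm.toEmbedding)
    (fun i => v (position m i)) hw
  rw [Finset.card_map, hS] at h
  have := abs_le.1 (h.trans hε)
  constructor <;> linarith

end

end FourierChecking

/-! ### Lower bound: choice of parameters and the contradiction. -/

namespace FourierChecking

open Function MeasureTheory ProbabilityTheory Filter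

/-! ### The lower bound -/

/-- A polynomial in `n` is a power of `n ^ η`, hence negligible against an exponential in `n ^ η`.
The constant `3 ^ c` absorbs `n + 2 ≤ 3 * n`. -/
theorem eventually_pow_le_two_rpow (c : ℕ) {η : ℝ} (hη : 0 < η) :
    ∀ᶠ n : ℕ in atTop, (((n + 2) ^ c : ℕ) : ℝ) ≤ (2 : ℝ) ^ ((n : ℝ) ^ η) := by
  have hlim : Tendsto (fun n : ℕ => (n : ℝ) ^ η) atTop atTop :=
    (tendsto_rpow_atTop hη).comp tendsto_natCast_atTop_atTop
  have hlog : 0 < Real.log 2 := Real.log_pos one_lt_two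
  have h3 : (0 : ℝ) < (3 ^ c)⁻¹ := by positivity
  filter_upwards [hlim.eventually ((isLittleO_rpow_exp_pos_mul_atTop (c / η) hlog).bound h3),
    eventually_ge_atTop 1] with n hn h1
  have hn0 : (0 : ℝ) ≤ n := Nat.cast_nonneg n
  have h1' : (1 : ℝ) ≤ n := by exact_mod_cast h1
  rw [← Real.rpow_mul hn0, mul_div_cancel₀ _ hη.ne', Real.rpow_natCast, Real.norm_eq_abs,
    Real.norm_eq_abs, abs_of_nonneg (by positivity), abs_of_pos (Real.exp_pos _),
    ← Real.rpow_def_of_pos two_pos, ← div_eq_inv_mul, le_div_iff₀ (by positivity), ← mul_pow] at hn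
  push_cast
  refine le_trans ?_ hn
  gcongr
  linarith

/-- With `k = q`, `√N = q ^ 10` and `w = q ^ 3`, the exponents `w ^ 2 * k ^ 2 / √N` and `k / w` both
equal `t = q⁻²`. The error is at most `e ^ t * (e ^ t - 1) ≤ 6 * q⁻²`, which is below `q⁻¹` because
`q ≥ 8`. -/
theorem almostWiseIndependent_forrelatedMeasure_two_pow {r : ℕ} (hr : 3 ≤ r) {ε : ℝ}
    (hε : ((2 : ℝ) ^ r)⁻¹ ≤ ε) :
    AlmostWiseIndependent (forrelatedMeasure (20 * r)) ε (2 ^ r) := by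
  set q : ℝ := 2 ^ r with hq
  have hq8 : 8 ≤ q := by
    calc (8 : ℝ) = 2 ^ 3 := by norm_num
      _ ≤ 2 ^ r := pow_le_pow_right₀ one_le_two hr
  have hq0 : 0 < q := by linarith
  have hsqrt : Real.sqrt (2 ^ (20 * r)) = q ^ 10 := by
    rw [show (2 : ℝ) ^ (20 * r) = (q ^ 10) ^ 2 by rw [hq, ← pow_mul, ← pow_mul]; ring_nf]
    exact Real.sqrt_sq (by positivity)
  refine almostWiseIndependent_forrelatedMeasure (w := q ^ 3) (one_le_pow₀ (by linarith)) ?_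
  refine le_trans ?_ hε
  rw [hsqrt]
  push_cast
  rw [← hq]
  set t : ℝ := (q ^ 2)⁻¹ with ht
  have ht0 : 0 ≤ t := by positivity
  have htq : t * q ^ 2 = 1 := inv_mul_cancel₀ (by positivity)
  have ht1 : t ≤ 1 := by nlinarith
  have e1 : (q ^ 3) ^ 2 * (q ^ 2 * (q ^ 10)⁻¹) = t := by
    rw [ht]
    field_simp
  have e2 : (1 + (q ^ 3)⁻¹) ^ (2 ^ r) ≤ Real.exp t := by
    have h := Real.add_one_le_exp ((q ^ 3)⁻¹)
    calc (1 + (q ^ 3)⁻¹) ^ (2 ^ r) ≤ Real.exp ((q ^ 3)⁻¹) ^ (2 ^ r) := by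
          rw [add_comm]
          gcongr
      _ = Real.exp t := by
          rw [← Real.exp_nat_mul]
          congr 1
          push_cast
          rw [← hq, ht]
          field_simp
  have e3 : Real.exp t - 1 ≤ 2 * t := by
    have h := Real.abs_exp_sub_one_le (x := t) (by rwa [abs_of_nonneg ht0])
    rw [abs_of_nonneg ht0] at h
    exact (le_abs_self _).trans h
  have e4 : Real.exp t ≤ 3 := by linarith
  rw [e1]
  calc Real.exp t * ((1 + (q ^ 3)⁻¹) ^ (2 ^ r) - 1) ≤ 3 * (2 * t) := by
        refine mul_le_mul e4 (by linarith) ?_ (by norm_num)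
        rw [sub_nonneg]
        exact one_le_pow₀ (le_add_of_nonneg_right (by positivity))
    _ ≤ q⁻¹ := by
        rw [ht]
        field_simp
        linarith

theorem not_inAC0_promiseFourierChecking (hGLN : GLNConjecture) :
    ¬ InAC0 promiseFourierChecking := by
  rintro ⟨d, c, hC⟩
  -- The input length is `n = 2 ^ (20 * r + 1) ≤ (2 ^ r) ^ 40`, so `n ^ (1 / 40)` is at most `k = 2
  -- ^ r`, and the error `2 ^ (-r)` is at most `n ^ (-1 / 40)`. The tolerance `0.01` is below the
  -- gap `0.07 - 0.01`.
  have hev := hGLN (1 / 40) (1 / 40) (by norm_num) (by norm_num) d (fun n => (n + 2) ^ c)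
    (fun η hη => eventually_pow_le_two_rpow c hη) 0.01 (by norm_num)
  have hlim : Tendsto (fun r : ℕ => 2 ^ (20 * r + 1)) atTop atTop := by
    refine tendsto_atTop_mono (fun r => ?_) tendsto_id
    have := (Nat.lt_two_pow_self (n := 20 * r + 1)).le
    simp only [id]
    omega
  obtain ⟨r, hr, hr3⟩ := ((hlim.eventually hev).and (eventually_ge_atTop 3)).exists
  obtain ⟨C, hd, hsize, hyes, hno⟩ := hC (2 ^ (20 * r + 1))
  have hroot : ((2 ^ (20 * r + 1) : ℕ) : ℝ) ^ (1 / 40 : ℝ) ≤ 2 ^ r := by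
    have h40 : ((2 : ℝ) ^ r) = (((2 : ℝ) ^ r) ^ 40) ^ (1 / 40 : ℝ) := by
      have h := Real.pow_rpow_inv_natCast (x := (2 : ℝ) ^ r) (by positivity)
        (show (40 : ℕ) ≠ 0 by norm_num)
      rw [one_div]
      exact_mod_cast h.symm
    rw [h40]
    push_cast
    rw [← pow_mul]
    refine Real.rpow_le_rpow (by positivity) ?_ (by norm_num)
    exact pow_le_pow_right₀ one_le_two (by omega)
  have hε : ((2 : ℝ) ^ r)⁻¹ ≤ ((2 ^ (20 * r + 1) : ℕ) : ℝ) ^ (-(1 / 40) : ℝ) := by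
    rw [Real.rpow_neg (Nat.cast_nonneg _)]
    exact inv_anti₀ (Real.rpow_pos_of_pos (by positivity) _) hroot
  have hdiff := hr (forrelatedMeasure (20 * r)) (2 ^ r) inferInstance
    (by push_cast at hroot ⊢; exact hroot) (Nat.pow_le_pow_right two_pos (by omega))
    (almostWiseIndependent_forrelatedMeasure_two_pow hr3 hε) C hd hsize
  have hD := le_forrelatedMeasure_real {x | C.eval x = true} fun u hu =>
    hyes u ⟨20 * r, rfl, hu⟩
  have hU := uniform_real_le {x | C.eval x = true} fun u hu => by
    by_contra hle
    have h := hno u ⟨20 * r, rfl, not_lt.1 hle⟩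
    exact Bool.false_ne_true (h.symm.trans hu)
  have hsmall : (100 : ℝ) / 2 ^ (20 * r) ≤ 0.01 := by
    rw [div_le_iff₀ (by positivity)]
    have : (2 : ℝ) ^ 20 ≤ 2 ^ (20 * r) := pow_le_pow_right₀ one_le_two (by omega)
    norm_num at this ⊢
    linarith
  have := (le_abs_self _).trans hdiff
  linarith

end FourierChecking

theorem mainTheorem7 :
    FourierChecking.InBQLOGTIME FourierChecking.promiseFourierChecking ∧
      (FourierChecking.GLNConjecture →
        ¬ FourierChecking.InAC0 FourierChecking.promiseFourierChecking) :=
  ⟨FourierChecking.inBQLOGTIME_promiseFourierChecking,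
    FourierChecking.not_inAC0_promiseFourierChecking⟩
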